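/- Let $G$ be a finite group acting by automorphisms $a\mapsto g\triangleright a$ on a finite abelian group $A$, and let $\mathcal G$ be the associated split 2-group: one object, 1-morphisms $g\in G$ composed by multiplication, 2-morphisms $a\colon g\Rightarrow g$ with $a\in A$, and horizontal composition $(a\colon g\Rightarrow g)\star(b\colon h\Rightarrow h)=a\,(g\triangleright b)\colon gh\Rightarrow gh$. Let $\mathrm{2Vect}$ be the 2-category with objects $n\in\mathbb N$, 1-morphisms matrices of finite-dimensional complex vector spaces (composed by matrix multiplication with $\otimes$ and $\oplus$), and 2-morphisms matrices of linear maps. Let $\mathrm{2Rep}(\mathcal G)$ be the 2-category of pseudofunctors $\mathcal G\to\mathrm{2Vect}$, pseudonatural transformations and modifications. A nonzero 2-representation is simple if it is not equivalent to a direct sum of two nonzero 2-representations. A label $(H,u,\alpha)$ consists of a subgroup $H\le G$, a 2-cocycle $u\in Z^2(H,U(1))$ and an $H$-invariant character $\alpha\colon A\to U(1)$. Its induced 2-representation $\mathrm{Ind}_H^{\mathcal G}(u,\alpha)$ is given as follows. Let $R_1,\dots,R_n$ be representatives of $G/H$ and write $gR_i=R_{\sigma_g(i)}h_i(g)$ with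 $h_i(g)\in H$. The object is sent to $n$ and $g$ to the permutation matrix of $\sigma_g$ with entries $\mathbb C$ or $0$. The composition isomorphism $F_g\circ F_{g'}\to F_{gg'}$ is given on the $i$-th row by $c_i(g,g')=u\big(h_{\sigma_g^{-1}(i)}(g),h_{\sigma_{gg'}^{-1}(i)}(g')\big)$, and $a\in A$ acts on the $i$-th row by $\chi_i(a)=\alpha(R_i^{-1}\triangleright a)$. A 2-representation is labelled by $(H,u,\alpha)$ if it is equivalent in $\mathrm{2Rep}(\mathcal G)$ to $\mathrm{Ind}_H^{\mathcal G}(u,\alpha)$. For $g\in G$ and a label $(K,v,\beta)$ put ${}^gK=gKg^{-1}$, ${}^gv(x,y)=v(g^{-1}xg,g^{-1}yg)$ and ${}^g\beta(a)=\beta(g^{-1}\triangleright a)$. For a group $L$ and a 2-cocycle $w$ on $L$ with values in $U(1)$ let $\mathrm{Rep}^w(L)$ be the category of finite-dimensional complex projective representations $\varphi\colon L\to GL(V)$ with $\varphi(xy)=w(x,y)\,\varphi(x)\varphi(y)$, with the intertwining linear maps as morphisms. **Proposition.** 1. Let $F$ and $F'$ be 2-representations of $\mathcal G$ labelled by $(H,u,\alpha)$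 and $(K,v,\beta)$. For every choice of representatives $g$ of the double cosets $[g]\in H\backslash G/K$ there is an equivalence of $\mathbb C$-linear categories $$\mathrm{Hom}_{\mathrm{2Rep}(\mathcal G)}(F,F')\;\simeq\bigoplus_{\substack{[g]\in H\backslash G/K\\ \overline\alpha\otimes{}^g\beta=1}}\mathrm{Rep}^{\overline u\otimes{}^gv}(H\cap{}^gK).$$ 2. In particular, for such $F$ and $F'$, the category $\mathrm{Hom}(F,F')$ contains a nonzero object if and only if $\alpha={}^g\beta$ for some $g\in G$. 3. The connected components of $\mathrm{2Rep}(\mathcal G)$, that is, the classes of simple 2-representations under the equivalence relation generated by the existence of a nonzero 1-morphism, are labelled by the $G$-orbits of characters of $A$. Precisely, every 2-representation labelled by some $(H,u,\alpha)$ is simple, and there is a bijection from the set of connected components to the set of $G$-orbits in $A^\vee=\mathrm{Hom}(A,U(1))$ that sends the component of every 2-representation labelled by $(H,u,\alpha)$ to the $G$-orbit of $\alpha$. -/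

import Mathlib

open CategoryTheory TensorProduct
open scoped CategoryTheory.Bicategory CategoryTheory.Pseudofunctor.StrongTrans

noncomputable section

namespace HigherRep

universe u v

/-! ### Matrices of vector spaces -/

/-- An `n × m` matrix of finite-dimensional complex vector spaces. -/
structure Mat (n m : ℕ) : Type 1 where
  entry : Fin n → Fin m → Type
  [grp : ∀ i j, AddCommGroup (entry i j)]
  [mod : ∀ i j, Module ℂ (entry i j)]
  [fin : ∀ i j, Module.Finite ℂ (entry i j)]

namespace Mat

attribute [instance] Mat.grp Mat.mod Mat.fin

/-- A matrix of linear maps between the entries of two matrices of vector spaces. -/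
@[ext]
structure Hom {n m : ℕ} (A B : Mat n m) : Type where
  app : ∀ i j, A.entry i j →ₗ[ℂ] B.entry i j

instance category (n m : ℕ) : Category (Mat n m) where
  Hom A B := Hom A B
  id _ := ⟨fun _ _ => LinearMap.id⟩
  comp f g := ⟨fun i j => (g.app i j) ∘ₗ (f.app i j)⟩

section Basic

variable {n m k l : ℕ}

@[ext]
theorem hom_ext {A B : Mat n m} {f g : A ⟶ B}
    (h : ∀ i j (x : A.entry i j), f.app i j x = g.app i j x) : f = g :=
  Hom.ext (by funext i j; exact LinearMap.ext (h i j))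

@[simp]
theorem id_app (A : Mat n m) (i j) (x : A.entry i j) : Hom.app (𝟙 A) i j x = x := rfl

@[simp]
theorem comp_app {A B C : Mat n m} (f : A ⟶ B) (g : B ⟶ C) (i j) (x : A.entry i j) :
    Hom.app (f ≫ g) i j x = g.app i j (f.app i j x) := rfl

/-- The vector space that is `ℂ` if `P` holds and zero otherwise. -/
abbrev Line (P : Prop) : Type := PLift P → ℂ

/-- The basis vector of `Line P` (which is zero if `P` fails). -/
def basisVec (P : Prop) : Line P := fun _ => 1

open Classical in
/-- The linear map on `Line P` that sends the basis vector to `f h` if `h : P`. -/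
def lineLift {P : Prop} {V : Type} [AddCommGroup V] [Module ℂ V] (f : P → V) :
    Line P →ₗ[ℂ] V where
  toFun x := if h : P then x ⟨h⟩ • f h else 0
  map_add' x y := by split_ifs <;> simp [add_smul]
  map_smul' c x := by split_ifs <;> simp [mul_smul]

theorem lineLift_basisVec {P : Prop} {V : Type} [AddCommGroup V] [Module ℂ V] (f : P → V)
    (h : P) : lineLift f (basisVec P) = f h := by
  simp [lineLift, basisVec, h]

theorem line_ext {P : Prop} {V : Type} [AddCommGroup V] [Module ℂ V]
    {f g : Line P →ₗ[ℂ] V} (h : P → f (basisVec P) = g (basisVec P)) : f = g := by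
  refine LinearMap.ext fun x => ?_
  by_cases p : P
  · have hx : x = x ⟨p⟩ • basisVec P := by funext q; simp [basisVec]
    rw [hx, map_smul, map_smul, h p]
  · have hx : x = 0 := by funext q; exact absurd q.down p
    rw [hx, map_zero, map_zero]

/-- The matrix with entry `ℂ` where `P i j` holds and `0` elsewhere. -/
def lineMat (P : Fin n → Fin m → Prop) : Mat n m where
  entry i j := Line (P i j)

/-- The basis vector `1 ∈ ℂ` of the entry `(i, j)` of `lineMat P` (zero if `P i j` fails). -/
def vec (P : Fin n → Fin m → Prop) (i : Fin n) (j : Fin m) : (lineMat P).entry i j :=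
  basisVec (P i j)

/-- The linear map on the entry `(i, j)` of `lineMat P` with value `f h` at `1` if `h : P i j`. -/
def vecLift {P : Fin n → Fin m → Prop} {i : Fin n} {j : Fin m} {V : Type} [AddCommGroup V]
    [Module ℂ V] (f : P i j → V) : (lineMat P).entry i j →ₗ[ℂ] V :=
  lineLift f

theorem vecLift_vec {P : Fin n → Fin m → Prop} {i : Fin n} {j : Fin m} {V : Type}
    [AddCommGroup V] [Module ℂ V] (f : P i j → V) (h : P i j) :
    vecLift f (vec P i j) = f h :=
  lineLift_basisVec f h

theorem vec_ext {P : Fin n → Fin m → Prop} {i : Fin n} {j : Fin m} {V : Type} [AddCommGroup V]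
    [Module ℂ V] {f g : (lineMat P).entry i j →ₗ[ℂ] V}
    (h : P i j → f (vec P i j) = g (vec P i j)) : f = g :=
  line_ext h

/-- The matrix product `(A ∘ B)ᵢₖ = ⨁ⱼ Aᵢⱼ ⊗ Bⱼₖ` (a finite direct sum, as a product). -/
def prod (A : Mat n m) (B : Mat m k) : Mat n k where
  entry i t := ∀ j, A.entry i j ⊗[ℂ] B.entry j t

/-- The identity matrix: `ℂ` on the diagonal and `0` elsewhere. -/
abbrev one (n : ℕ) : Mat n n := lineMat fun i j => i = j

/-- The vector `1` in the `i`-th diagonal entry of the identity matrix. -/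
abbrev oneVec (i : Fin n) : (one n).entry i i := vec (fun i j => i = j) i i

/-- The pure tensor `a ⊗ b` in the `j`-th summand of an entry of a matrix product. -/
def pure (A : Mat n m) (B : Mat m k) (i : Fin n) (j : Fin m) (t : Fin k) :
    A.entry i j →ₗ[ℂ] B.entry j t →ₗ[ℂ] (A.prod B).entry i t :=
  (TensorProduct.mk ℂ (A.entry i j) (B.entry j t)).compr₂
    (LinearMap.single ℂ (fun j => A.entry i j ⊗[ℂ] B.entry j t) j)

/-- The linear map out of a finite direct sum of tensor products given by bilinear maps. -/
def sumLift {ι : Type} [Fintype ι] {X Y : ι → Type} [∀ j, AddCommGroup (X j)]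
    [∀ j, Module ℂ (X j)] [∀ j, AddCommGroup (Y j)] [∀ j, Module ℂ (Y j)] {V : Type}
    [AddCommGroup V] [Module ℂ V] (f : ∀ j, X j →ₗ[ℂ] Y j →ₗ[ℂ] V) :
    (∀ j, X j ⊗[ℂ] Y j) →ₗ[ℂ] V :=
  ∑ j, (TensorProduct.lift (f j)) ∘ₗ LinearMap.proj j

theorem sumLift_single {ι : Type} [Fintype ι] [DecidableEq ι] {X Y : ι → Type}
    [∀ j, AddCommGroup (X j)] [∀ j, Module ℂ (X j)] [∀ j, AddCommGroup (Y j)]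
    [∀ j, Module ℂ (Y j)] {V : Type} [AddCommGroup V] [Module ℂ V]
    (f : ∀ j, X j →ₗ[ℂ] Y j →ₗ[ℂ] V) (j : ι) (x : X j) (y : Y j) :
    sumLift f (Pi.single j (x ⊗ₜ y)) = f j x y := by
  simp only [sumLift, LinearMap.sum_apply, LinearMap.comp_apply, LinearMap.proj_apply]
  rw [Finset.sum_eq_single j]
  · simp
  · intro b' _ hb
    simp [Pi.single_eq_of_ne hb]
  · simp

/-- The linear map out of an entry of a matrix product given by a family of bilinear maps. -/
def lift {A : Mat n m} {B : Mat m k} {i : Fin n} {t : Fin k} {V : Type} [AddCommGroup V]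
    [Module ℂ V] (f : ∀ j, A.entry i j →ₗ[ℂ] B.entry j t →ₗ[ℂ] V) :
    (A.prod B).entry i t →ₗ[ℂ] V :=
  sumLift f

@[simp]
theorem lift_pure {A : Mat n m} {B : Mat m k} {i : Fin n} {t : Fin k} {V : Type} [AddCommGroup V]
    [Module ℂ V] (f : ∀ j, A.entry i j →ₗ[ℂ] B.entry j t →ₗ[ℂ] V) (j : Fin m)
    (a : A.entry i j) (b : B.entry j t) : lift f (pure A B i j t a b) = f j a b :=
  sumLift_single f j a b

theorem prod_ext {A : Mat n m} {B : Mat m k} {i : Fin n} {t : Fin k} {V : Type} [AddCommGroup V]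
    [Module ℂ V] {f g : (A.prod B).entry i t →ₗ[ℂ] V}
    (h : ∀ j a b, f (pure A B i j t a b) = g (pure A B i j t a b)) : f = g := by
  refine LinearMap.pi_ext' fun j => TensorProduct.ext' fun a b => ?_
  exact h j a b

/-- Horizontal composition of matrices of linear maps. -/
def hprod {A A' : Mat n m} {B B' : Mat m k} (f : A ⟶ A') (g : B ⟶ B') : A.prod B ⟶ A'.prod B' :=
  ⟨fun i t => lift fun j => (pure A' B' i j t).compl₁₂ (f.app i j) (g.app j t)⟩

@[simp]
theorem hprod_pure {A A' : Mat n m} {B B' : Mat m k} (f : A ⟶ A') (g : B ⟶ B') (i j t) (a b) :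
    (hprod f g).app i t (pure A B i j t a b) = pure A' B' i j t (f.app i j a) (g.app j t b) := by
  simp [hprod]

theorem app_smul {A B : Mat n m} (f : A ⟶ B) (i j) (c : ℂ) (x : A.entry i j) :
    f.app i j (c • x) = c • f.app i j x := map_smul _ _ _

theorem pure_smul_left (A : Mat n m) (B : Mat m k) (i j t) (c : ℂ) (a b) :
    pure A B i j t (c • a) b = c • pure A B i j t a b := by
  rw [map_smul, LinearMap.smul_apply]

theorem pure_smul_right (A : Mat n m) (B : Mat m k) (i j t) (c : ℂ) (a b) :
    pure A B i j t a (c • b) = c • pure A B i j t a b := map_smul _ _ _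

theorem hom_prod_ext {A : Mat n m} {B : Mat m k} {C : Mat n k} {f g : A.prod B ⟶ C}
    (h : ∀ i j t a b, f.app i t (pure A B i j t a b) = g.app i t (pure A B i j t a b)) : f = g :=
  Hom.ext (by funext i t; exact prod_ext (h i · t))

theorem prod_ext₃ {A : Mat n m} {B : Mat m k} {C : Mat k l} {i : Fin n} {t : Fin l} {V : Type}
    [AddCommGroup V] [Module ℂ V] {f g : ((A.prod B).prod C).entry i t →ₗ[ℂ] V}
    (h : ∀ j s a b c, f (pure _ _ i s t (pure A B i j s a b) c) =
      g (pure _ _ i s t (pure A B i j s a b) c)) : f = g := by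
  refine prod_ext fun s x c => ?_
  have : f ∘ₗ (pure (A.prod B) C i s t).flip c = g ∘ₗ (pure (A.prod B) C i s t).flip c :=
    prod_ext fun j a b => h j s a b c
  exact LinearMap.congr_fun this x

theorem prod_ext₃' {A : Mat n m} {B : Mat m k} {C : Mat k l} {i : Fin n} {t : Fin l} {V : Type}
    [AddCommGroup V] [Module ℂ V] {f g : (A.prod (B.prod C)).entry i t →ₗ[ℂ] V}
    (h : ∀ j s a b c, f (pure _ _ i j t a (pure B C j s t b c)) =
      g (pure _ _ i j t a (pure B C j s t b c))) : f = g := by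
  refine prod_ext fun j a x => ?_
  have : f ∘ₗ (pure A (B.prod C) i j t a) = g ∘ₗ (pure A (B.prod C) i j t a) :=
    prod_ext fun s b c => h j s a b c
  exact LinearMap.congr_fun this x

/-- The canonical isomorphism `(A ∘ B) ∘ C ≅ A ∘ (B ∘ C)`. -/
def assoc (A : Mat n m) (B : Mat m k) (C : Mat k l) : (A.prod B).prod C ≅ A.prod (B.prod C) where
  hom := ⟨fun i t => lift fun s => lift fun j =>
    { toFun := fun a => (pure B C j s t).compr₂ (pure A (B.prod C) i j t a)
      map_add' := fun _ _ => by ext; simp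
      map_smul' := fun _ _ => by ext; simp }⟩
  inv := ⟨fun i t => lift fun j =>
    { toFun := fun a => lift fun s => (pure (A.prod B) C i s t) ∘ₗ (pure A B i j s a)
      map_add' := fun _ _ => prod_ext fun s b c => by simp
      map_smul' := fun _ _ => prod_ext fun s b c => by simp }⟩
  hom_inv_id := Hom.ext (by
    funext i t; exact prod_ext₃ fun j s a b c => by simp)
  inv_hom_id := Hom.ext (by
    funext i t; exact prod_ext₃' fun j s a b c => by simp)

@[simp]
theorem assoc_hom_pure (A : Mat n m) (B : Mat m k) (C : Mat k l) (i j s t a b c) :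
    (assoc A B C).hom.app i t (pure (A.prod B) C i s t (pure A B i j s a b) c) =
      pure A (B.prod C) i j t a (pure B C j s t b c) := by
  simp [assoc]

@[simp]
theorem assoc_inv_pure (A : Mat n m) (B : Mat m k) (C : Mat k l) (i j s t a b c) :
    (assoc A B C).inv.app i t (pure A (B.prod C) i j t a (pure B C j s t b c)) =
      pure (A.prod B) C i s t (pure A B i j s a b) c := by
  simp [assoc]

/-- The map between entries in equal rows. -/
def castRow (B : Mat n m) {i j : Fin n} (h : i = j) (t : Fin m) :
    B.entry j t →ₗ[ℂ] B.entry i t :=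
  h ▸ LinearMap.id

/-- The map between entries in equal columns. -/
def castCol (B : Mat n m) (i : Fin n) {j t : Fin m} (h : j = t) :
    B.entry i j →ₗ[ℂ] B.entry i t :=
  h ▸ LinearMap.id

@[simp]
theorem castRow_rfl (B : Mat n m) (i t) (x : B.entry i t) : castRow B (rfl : i = i) t x = x := rfl

@[simp]
theorem castCol_rfl (B : Mat n m) (i t) (x : B.entry i t) : castCol B i (rfl : t = t) x = x := rfl

theorem one_prod_ext {B : Mat n m} {i : Fin n} {t : Fin m} {V : Type} [AddCommGroup V]
    [Module ℂ V] {f g : ((one n).prod B).entry i t →ₗ[ℂ] V}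
    (h : ∀ b, f (pure (one n) B i i t (oneVec i) b) = g (pure (one n) B i i t (oneVec i) b)) :
    f = g := by
  refine prod_ext fun j x b => ?_
  have : f ∘ₗ (pure (one n) B i j t).flip b = g ∘ₗ (pure (one n) B i j t).flip b :=
    vec_ext (by rintro rfl; exact h b)
  exact LinearMap.congr_fun this x

theorem prod_one_ext {B : Mat n m} {i : Fin n} {t : Fin m} {V : Type} [AddCommGroup V]
    [Module ℂ V] {f g : (B.prod (one m)).entry i t →ₗ[ℂ] V}
    (h : ∀ b, f (pure B (one m) i t t b (oneVec t)) = g (pure B (one m) i t t b (oneVec t))) :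
    f = g := by
  refine prod_ext fun j b x => ?_
  have : f ∘ₗ (pure B (one m) i j t b) = g ∘ₗ (pure B (one m) i j t b) :=
    vec_ext (by rintro rfl; exact h b)
  exact LinearMap.congr_fun this x

/-- The canonical isomorphism `𝕀 ∘ B ≅ B`. -/
def leftUnit (B : Mat n m) : (one n).prod B ≅ B where
  hom := ⟨fun i t => lift fun _ => vecLift fun h => castRow B h t⟩
  inv := ⟨fun i t => pure (one n) B i i t (oneVec i)⟩
  hom_inv_id := Hom.ext (by
    funext i t
    refine one_prod_ext fun b => ?_
    simp only [comp_app, id_app]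
    rw [lift_pure, vecLift_vec _ rfl, castRow_rfl])
  inv_hom_id := by
    ext i t b
    simp only [comp_app, id_app]
    rw [lift_pure, vecLift_vec _ rfl, castRow_rfl]

@[simp]
theorem leftUnit_hom_pure (B : Mat n m) (i t b) :
    (leftUnit B).hom.app i t (pure (one n) B i i t (oneVec i) b) = b := by
  simp only [leftUnit]
  rw [lift_pure, vecLift_vec _ rfl, castRow_rfl]

@[simp]
theorem leftUnit_inv_app (B : Mat n m) (i t b) :
    (leftUnit B).inv.app i t b = pure (one n) B i i t (oneVec i) b := rfl

/-- The canonical isomorphism `B ∘ 𝕀 ≅ B`. -/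
def rightUnit (B : Mat n m) : B.prod (one m) ≅ B where
  hom := ⟨fun i t => lift fun _ => (vecLift fun h => castCol B i h).flip⟩
  inv := ⟨fun i t => (pure B (one m) i t t).flip (oneVec t)⟩
  hom_inv_id := Hom.ext (by
    funext i t
    refine prod_one_ext fun b => ?_
    simp only [comp_app, id_app, LinearMap.flip_apply, lift_pure]
    rw [vecLift_vec _ rfl, castCol_rfl])
  inv_hom_id := by
    ext i t b
    simp only [comp_app, id_app]
    rw [LinearMap.flip_apply, lift_pure, LinearMap.flip_apply, vecLift_vec _ rfl,
      castCol_rfl]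

@[simp]
theorem rightUnit_hom_pure (B : Mat n m) (i t b) :
    (rightUnit B).hom.app i t (pure B (one m) i t t b (oneVec t)) = b := by
  simp only [rightUnit]
  rw [lift_pure, LinearMap.flip_apply, vecLift_vec _ rfl, castCol_rfl]

@[simp]
theorem rightUnit_inv_app (B : Mat n m) (i t b) :
    (rightUnit B).inv.app i t b = pure B (one m) i t t b (oneVec t) := rfl

end Basic
end Mat

/-- The objects of the 2-category of 2-vector spaces: natural numbers. -/
structure TwoVect : Type where
  dim : ℕ

namespace TwoVect

/-- The 2-category of 2-vector spaces: 1-morphisms `n ⟶ m` are `n × m` matrices of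
finite-dimensional complex vector spaces, 2-morphisms are matrices of linear maps. -/
instance bicategory : Bicategory TwoVect where
  Hom a b := Mat a.dim b.dim
  id a := Mat.one a.dim
  comp A B := A.prod B
  homCategory a b := Mat.category a.dim b.dim
  whiskerLeft A _ _ g := Mat.hprod (𝟙 A) g
  whiskerRight f B := Mat.hprod f (𝟙 B)
  associator A B C := Mat.assoc A B C
  leftUnitor A := Mat.leftUnit A
  rightUnitor A := Mat.rightUnit A
  whiskerLeft_id A B := Mat.hom_prod_ext fun i j t a b => by simp
  whiskerLeft_comp A B C D f g := Mat.hom_prod_ext fun i j t a b => by simp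
  id_whiskerLeft f := Mat.Hom.ext (by
    funext i t
    exact Mat.one_prod_ext fun b => by simp)
  comp_whiskerLeft A B C C' f := Mat.Hom.ext (by
    funext i t
    exact Mat.prod_ext₃ fun j s a b c => by simp)
  id_whiskerRight A B := Mat.hom_prod_ext fun i j t a b => by simp
  comp_whiskerRight f g C := Mat.hom_prod_ext fun i j t a b => by simp
  whiskerRight_id f := Mat.Hom.ext (by
    funext i t
    exact Mat.prod_one_ext fun b => by simp)
  whiskerRight_comp f B C := Mat.Hom.ext (by
    funext i t
    exact Mat.prod_ext₃' fun j s a b c => by simp)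
  whisker_assoc A B B' f C := Mat.Hom.ext (by
    funext i t
    exact Mat.prod_ext₃ fun j s a b c => by simp)
  whisker_exchange f g := Mat.hom_prod_ext fun i j t a b => by simp
  pentagon A B C D := Mat.Hom.ext (by
    funext i t
    refine Mat.prod_ext fun s x d => ?_
    have : ∀ {V : Type} [AddCommGroup V] [Module ℂ V]
        (f g : (((A.prod B).prod C).prod D).entry i t →ₗ[ℂ] V),
        (∀ j r a b c, f (Mat.pure _ D i s t (Mat.pure _ C i r s (Mat.pure A B i j r a b) c) d) =
          g (Mat.pure _ D i s t (Mat.pure _ C i r s (Mat.pure A B i j r a b) c) d)) →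
        f (Mat.pure _ D i s t x d) = g (Mat.pure _ D i s t x d) := by
      intro V _ _ f g h
      have : f ∘ₗ (Mat.pure _ D i s t).flip d = g ∘ₗ (Mat.pure _ D i s t).flip d :=
        Mat.prod_ext₃ fun j r a b c => h j r a b c
      exact LinearMap.congr_fun this x
    refine this _ _ fun j r a b c => ?_
    simp)
  triangle A B := Mat.Hom.ext (by
    funext i t
    refine Mat.prod_ext fun j x b => ?_
    have : (Mat.Hom.app ((Mat.assoc A (Mat.one _) B).hom ≫ Mat.hprod (𝟙 A) (Mat.leftUnit B).hom) i t) ∘ₗ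
        (Mat.pure _ B i j t).flip b =
        (Mat.Hom.app (Mat.hprod (Mat.rightUnit A).hom (𝟙 B)) i t) ∘ₗ (Mat.pure _ B i j t).flip b :=
      Mat.prod_one_ext fun a => by simp
    exact LinearMap.congr_fun this x)

end TwoVect

/-! ### Split 2-groups -/

/-- The split 2-group `(G, A, ρ)`, with the action `ρ` of `G` on the abelian group `A` given by
the instance `MulDistribMulAction G A`: the 2-category with a single object, 1-morphisms the
elements of `G`, and 2-morphisms the elements of `A` as 2-endomorphisms of each 1-morphism. -/
inductive SplitTwoGroup (G : Type u) (A : Type v) : Type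
  | pt

namespace SplitTwoGroup

/-- A 1-morphism of the split 2-group: an element of `G`. -/
@[ext]
structure OneCell (G : Type u) (A : Type v) : Type u where
  elt : G

/-- A 2-morphism `g ⟶ h` of the split 2-group: an element of `A`, provided that `g = h`. -/
@[ext]
structure TwoCell {G : Type u} {A : Type v} (g h : OneCell G A) : Type v where
  eq : g = h
  elt : A

variable {G : Type u} {A : Type v} [CommGroup A]

instance category : Category (OneCell G A) where
  Hom g h := TwoCell g h
  id _ := ⟨rfl, 1⟩
  comp a b := ⟨a.eq.trans b.eq, a.elt * b.elt⟩
  id_comp _ := TwoCell.ext (one_mul _)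
  comp_id _ := TwoCell.ext (mul_one _)
  assoc _ _ _ := TwoCell.ext (mul_assoc _ _ _)

@[ext]
theorem hom_ext {g h : OneCell G A} {a b : g ⟶ h} (e : a.elt = b.elt) : a = b := TwoCell.ext e

@[simp]
theorem id_elt (g : OneCell G A) : TwoCell.elt (𝟙 g) = 1 := rfl

@[simp]
theorem comp_elt {g h k : OneCell G A} (a : g ⟶ h) (b : h ⟶ k) :
    TwoCell.elt (a ≫ b) = a.elt * b.elt := rfl

/-- The identity 2-morphism, for an equality of 1-morphisms. -/
def isoOfEq {g h : OneCell G A} (e : g = h) : g ≅ h where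
  hom := ⟨e, 1⟩
  inv := ⟨e.symm, 1⟩
  hom_inv_id := TwoCell.ext (one_mul _)
  inv_hom_id := TwoCell.ext (one_mul _)

@[simp]
theorem isoOfEq_hom_elt {g h : OneCell G A} (e : g = h) : (isoOfEq e).hom.elt = 1 := rfl

@[simp]
theorem isoOfEq_inv_elt {g h : OneCell G A} (e : g = h) : (isoOfEq e).inv.elt = 1 := rfl

variable [Group G] [MulDistribMulAction G A]

/-- Horizontal composition is the multiplication of `G` on 1-morphisms, and
`a ⋆ b = a * (g • b)` on 2-morphisms `a : g ⟶ g`, `b : h ⟶ h`. -/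
instance bicategory : Bicategory (SplitTwoGroup G A) where
  Hom _ _ := OneCell G A
  id _ := ⟨1⟩
  comp g h := ⟨g.elt * h.elt⟩
  homCategory _ _ := category
  whiskerLeft f _ _ a := ⟨by rw [a.eq], f.elt • a.elt⟩
  whiskerRight a _ := ⟨by rw [a.eq], a.elt⟩
  associator f g h := isoOfEq (OneCell.ext (mul_assoc _ _ _))
  leftUnitor f := isoOfEq (OneCell.ext (one_mul _))
  rightUnitor f := isoOfEq (OneCell.ext (mul_one _))
  whiskerLeft_id _ _ := TwoCell.ext (by simp)
  whiskerLeft_comp _ _ _ _ _ _ := TwoCell.ext (by simp)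
  id_whiskerLeft _ := TwoCell.ext (by simp)
  comp_whiskerLeft _ _ _ _ _ := TwoCell.ext (by simp [mul_smul])
  id_whiskerRight _ _ := TwoCell.ext (by simp)
  comp_whiskerRight _ _ _ := TwoCell.ext (by simp)
  whiskerRight_id _ := TwoCell.ext (by simp)
  whiskerRight_comp _ _ _ := TwoCell.ext (by simp)
  whisker_assoc _ _ _ _ _ := TwoCell.ext (by simp)
  whisker_exchange a b := TwoCell.ext (by simp [a.eq, mul_comm])
  pentagon _ _ _ _ := TwoCell.ext (by simp)
  triangle _ _ := TwoCell.ext (by simp)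

/-- The element `g` of `G` as a 1-morphism. -/
abbrev cell (A : Type v) [CommGroup A] [MulDistribMulAction G A] (g : G) :
    (pt : SplitTwoGroup G A) ⟶ pt :=
  (⟨g⟩ : OneCell G A)

end SplitTwoGroup

/-! ### 2-representations -/

section TwoRep

variable (G : Type u) (A : Type v) [Group G] [CommGroup A] [MulDistribMulAction G A]

/-- A 2-representation of the split 2-group is a pseudofunctor to 2-vector spaces. Together with
pseudonatural transformations and modifications, these form a 2-category. -/
abbrev TwoRep := Pseudofunctor (SplitTwoGroup G A) TwoVect

/-- The data `(σ, c, χ)` of a permutation action of `G` on `{1, …, n}`, a twisted 2-cocycle with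
values in `U(1)ⁿ` and an equivariant collection of `n` characters of `A`. -/
structure TwoRepData where
  dim : ℕ
  perm : G →* Equiv.Perm (Fin dim)
  cocycle : Fin dim → G → G → Circle
  char : Fin dim → (A →* Circle)
  cocycle_eq : ∀ i g h k,
    cocycle ((perm g)⁻¹ i) h k * cocycle i g (h * k) = cocycle i (g * h) k * cocycle i g h
  char_smul : ∀ i g a, char i (g • a) = char ((perm g)⁻¹ i) a

namespace TwoRepData

variable {G A} (D : TwoRepData G A)

theorem cocycle_one_left (i g) : D.cocycle i 1 g = D.cocycle i 1 1 := by
  have h := D.cocycle_eq i 1 1 g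
  simp only [map_one, inv_one, Equiv.Perm.coe_one, id_eq, one_mul] at h
  exact mul_left_cancel (a := D.cocycle i 1 g) (by rw [h])

theorem cocycle_one_right (i g) : D.cocycle i g 1 = D.cocycle ((D.perm g)⁻¹ i) 1 1 := by
  have h := D.cocycle_eq i g 1 1
  simp only [mul_one] at h
  exact (mul_right_cancel h).symm

/-- The permutation matrix of `g`, with entry `ℂ` at `(i, j)` if `i = σ_g(j)`. -/
abbrev permMat (g : G) : Mat D.dim D.dim := Mat.lineMat fun i j => i = D.perm g j

/-- The basis vector in the entry `(i, j)` of the permutation matrix of `g`. -/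
abbrev permVec (g : G) (i j : Fin D.dim) : (D.permMat g).entry i j :=
  Mat.vec (fun i j => i = D.perm g j) i j

/-- The linear map on the entry `(i, j)` of `F_g` with value `v` at the basis vector. -/
def permLift (g : G) (i j : Fin D.dim) {V : Type} [AddCommGroup V] [Module ℂ V] (v : V) :
    (D.permMat g).entry i j →ₗ[ℂ] V :=
  Mat.vecLift fun _ => v

theorem permLift_permVec {g : G} {i j : Fin D.dim} (p : i = D.perm g j) {V : Type}
    [AddCommGroup V] [Module ℂ V] (v : V) : D.permLift g i j v (D.permVec g i j) = v :=
  Mat.vecLift_vec (P := fun i j => i = D.perm g j) _ p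

theorem perm_ext {g : G} {i j : Fin D.dim} {V : Type} [AddCommGroup V] [Module ℂ V]
    {f f' : (D.permMat g).entry i j →ₗ[ℂ] V}
    (h : i = D.perm g j → f (D.permVec g i j) = f' (D.permVec g i j)) : f = f' :=
  Mat.vec_ext h

/-- A 2-morphism acts on the `i`-th row through the character `χᵢ`. -/
def mapCell (g h : G) (a : A) : D.permMat g ⟶ D.permMat h :=
  ⟨fun i j => D.permLift g i j ((D.char i a : ℂ) • D.permVec h i j)⟩

/-- The identifier `F_e ≅ 𝕀`, which is multiplication by `cᵢ(e, e)` in the `i`-th row. -/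
def unitIso : D.permMat 1 ≅ Mat.one D.dim where
  hom := ⟨fun i j => D.permLift 1 i j
    ((D.cocycle i 1 1 : ℂ) • Mat.vec (fun i j => i = j) i j)⟩
  inv := ⟨fun i j => Mat.vecLift fun _ => ((D.cocycle i 1 1)⁻¹ : ℂ) • D.permVec 1 i j⟩
  hom_inv_id := Mat.Hom.ext (by
    funext i j
    refine D.perm_ext fun h => ?_
    have h' : i = j := by simpa using h
    simp only [Mat.comp_app, Mat.id_app]
    rw [D.permLift_permVec h, map_smul, Mat.vecLift_vec (P := fun i j => i = j) _ h', smul_smul]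
    simp)
  inv_hom_id := Mat.Hom.ext (by
    funext i j
    refine Mat.vec_ext fun h => ?_
    have h' : i = D.perm 1 j := by simpa using h
    simp only [Mat.comp_app, Mat.id_app]
    rw [Mat.vecLift_vec (P := fun i j => i = j) _ h, map_smul, D.permLift_permVec h', smul_smul]
    simp)

theorem comp_ext {g h : G} {i t : Fin D.dim} {V : Type} [AddCommGroup V] [Module ℂ V]
    {f f' : ((D.permMat g).prod (D.permMat h)).entry i t →ₗ[ℂ] V}
    (e : ∀ j, i = D.perm g j → j = D.perm h t →
      f (Mat.pure _ _ i j t (D.permVec g i j) (D.permVec h j t)) =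
      f' (Mat.pure _ _ i j t (D.permVec g i j) (D.permVec h j t))) : f = f' := by
  refine Mat.prod_ext fun j x y => ?_
  have h₂ : ∀ y, f ∘ₗ (Mat.pure _ _ i j t).flip y = f' ∘ₗ (Mat.pure _ _ i j t).flip y := fun y =>
    D.perm_ext fun p => by
      have h₁ : f ∘ₗ (Mat.pure _ _ i j t (D.permVec g i j)) =
          f' ∘ₗ (Mat.pure _ _ i j t (D.permVec g i j)) := D.perm_ext fun q => e j p q
      exact LinearMap.congr_fun h₁ y
  exact LinearMap.congr_fun (h₂ y) x

/-- The compositor, as an isomorphism `F_{gh} ≅ F_g ∘ F_h`. The map `F_g ∘ F_h ⟶ F_{gh}` is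
multiplication by `cᵢ(g, h)` in the `i`-th row. -/
def compIso (g h : G) : D.permMat (g * h) ≅ (D.permMat g).prod (D.permMat h) where
  hom := ⟨fun i t => D.permLift (g * h) i t (((D.cocycle i g h)⁻¹ : ℂ) •
    Mat.pure _ _ i (D.perm h t) t (D.permVec g i _) (D.permVec h _ t))⟩
  inv := ⟨fun i t => Mat.lift fun j => D.permLift g i j (D.permLift h j t
    ((D.cocycle i g h : ℂ) • D.permVec (g * h) i t))⟩
  hom_inv_id := Mat.Hom.ext (by
    funext i t
    refine D.perm_ext fun p => ?_
    simp only [Mat.comp_app, Mat.id_app]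
    rw [D.permLift_permVec p, map_smul, Mat.lift_pure, D.permLift_permVec (by simpa using p),
      D.permLift_permVec rfl, smul_smul]
    simp)
  inv_hom_id := Mat.Hom.ext (by
    funext i t
    refine D.comp_ext fun j p q => ?_
    subst q
    simp only [Mat.comp_app, Mat.id_app]
    rw [Mat.lift_pure, D.permLift_permVec p, D.permLift_permVec rfl, map_smul,
      D.permLift_permVec (by simpa using p), smul_smul]
    simp)

theorem mapCell_app (g h : G) (a : A) {i j} (p : i = D.perm g j) :
    (D.mapCell g h a).app i j (D.permVec g i j) = (D.char i a : ℂ) • D.permVec h i j :=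
  D.permLift_permVec p _

theorem unitIso_hom_app {i j} (p : i = D.perm 1 j) :
    D.unitIso.hom.app i j (D.permVec 1 i j) =
      (D.cocycle i 1 1 : ℂ) • Mat.vec (fun i j => i = j) i j :=
  D.permLift_permVec p _

theorem compIso_hom_app (g h : G) {i t} (p : i = D.perm (g * h) t) :
    (D.compIso g h).hom.app i t (D.permVec (g * h) i t) = ((D.cocycle i g h)⁻¹ : ℂ) •
      Mat.pure _ _ i (D.perm h t) t (D.permVec g i _) (D.permVec h _ t) :=
  D.permLift_permVec p _

theorem compIso_inv_app (g h : G) {i j t} (p : i = D.perm g j) (q : j = D.perm h t) :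
    (D.compIso g h).inv.app i t (Mat.pure _ _ i j t (D.permVec g i j) (D.permVec h j t)) =
      (D.cocycle i g h : ℂ) • D.permVec (g * h) i t := by
  simp only [compIso]
  rw [Mat.lift_pure, D.permLift_permVec p, D.permLift_permVec q]

theorem mapCell_one (g : G) : D.mapCell g g (1 : A) = 𝟙 (D.permMat g) :=
  Mat.Hom.ext (by
    funext i j
    refine D.perm_ext fun p => ?_
    rw [D.mapCell_app _ _ _ p]
    simp)

theorem mapCell_mul (g h k : G) (e : g = h) (a b : A) :
    D.mapCell g k (a * b) = D.mapCell g h a ≫ D.mapCell h k b :=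
  Mat.Hom.ext (by
    funext i j
    refine D.perm_ext fun p => ?_
    subst e
    rw [Mat.comp_app, D.mapCell_app _ _ _ p, D.mapCell_app _ _ _ p, map_smul,
      D.mapCell_app _ _ _ p, smul_smul]
    simp)

theorem mapCell_left (f g h : G) (a : A) (e : g = h) :
    D.mapCell (f * g) (f * h) (f • a) = (D.compIso f g).hom ≫
      Mat.hprod (𝟙 (D.permMat f)) (D.mapCell g h a) ≫ (D.compIso f h).inv :=
  Mat.Hom.ext (by
    funext i t
    refine D.perm_ext fun p => ?_
    subst e
    have p' : i = D.perm f (D.perm g t) := by simpa using p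
    have hi : (D.perm f)⁻¹ i = D.perm g t := by rw [p']; simp
    rw [Mat.comp_app, Mat.comp_app, D.mapCell_app _ _ _ p, D.compIso_hom_app _ _ p, Mat.app_smul,
      Mat.hprod_pure, Mat.id_app, D.mapCell_app _ _ _ rfl, Mat.pure_smul_right, Mat.app_smul,
      Mat.app_smul, D.compIso_inv_app _ _ p' rfl, smul_smul, smul_smul, D.char_smul, hi]
    congr 1
    field_simp)

theorem mapCell_right (f g h : G) (a : A) (e : f = g) :
    D.mapCell (f * h) (g * h) a = (D.compIso f h).hom ≫
      Mat.hprod (D.mapCell f g a) (𝟙 (D.permMat h)) ≫ (D.compIso g h).inv :=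
  Mat.Hom.ext (by
    funext i t
    refine D.perm_ext fun p => ?_
    subst e
    have p' : i = D.perm f (D.perm h t) := by simpa using p
    rw [Mat.comp_app, Mat.comp_app, D.mapCell_app _ _ _ p, D.compIso_hom_app _ _ p, Mat.app_smul,
      Mat.hprod_pure, Mat.id_app, D.mapCell_app _ _ _ p', Mat.pure_smul_left, Mat.app_smul,
      Mat.app_smul, D.compIso_inv_app _ _ p' rfl, smul_smul, smul_smul]
    congr 1
    field_simp)

theorem mapCell_assoc (f g h : G) :
    D.mapCell (f * g * h) (f * (g * h)) (1 : A) = (D.compIso (f * g) h).hom ≫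
      Mat.hprod (D.compIso f g).hom (𝟙 (D.permMat h)) ≫
      (Mat.assoc (D.permMat f) (D.permMat g) (D.permMat h)).hom ≫
      Mat.hprod (𝟙 (D.permMat f)) (D.compIso g h).inv ≫ (D.compIso f (g * h)).inv :=
  Mat.Hom.ext (by
    funext i t
    refine D.perm_ext fun p => ?_
    have p₁ : i = D.perm (f * g) (D.perm h t) := by simpa using p
    have p₂ : i = D.perm f (D.perm g (D.perm h t)) := by simpa using p
    have hi : (D.perm f)⁻¹ i = D.perm g (D.perm h t) := by rw [p₂]; simp
    have hc := D.cocycle_eq i f g h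
    rw [hi] at hc
    have hc' : (D.cocycle (D.perm g (D.perm h t)) g h : ℂ) * (D.cocycle i f (g * h) : ℂ) =
        (D.cocycle i (f * g) h : ℂ) * (D.cocycle i f g : ℂ) := by
      rw [← Circle.coe_mul, ← Circle.coe_mul, hc]
    rw [Mat.comp_app, Mat.comp_app, Mat.comp_app, Mat.comp_app, D.mapCell_app _ _ _ p,
      D.compIso_hom_app _ _ p, Mat.app_smul, Mat.hprod_pure, D.compIso_hom_app _ _ p₁, Mat.id_app,
      Mat.pure_smul_left]
    repeat rw [Mat.app_smul]
    rw [Mat.assoc_hom_pure, Mat.hprod_pure, Mat.id_app, D.compIso_inv_app _ _ rfl rfl,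
      Mat.pure_smul_right]
    repeat rw [Mat.app_smul]
    rw [D.compIso_inv_app f (g * h) p₂ (by simp), smul_smul, smul_smul, smul_smul]
    congr 1
    rw [mul_assoc, mul_assoc, hc', map_one]
    field_simp
    simp)

theorem mapCell_leftUnit (g : G) :
    D.mapCell (1 * g) g (1 : A) = (D.compIso 1 g).hom ≫
      Mat.hprod D.unitIso.hom (𝟙 (D.permMat g)) ≫ (Mat.leftUnit (D.permMat g)).hom :=
  Mat.Hom.ext (by
    funext i t
    refine D.perm_ext fun p => ?_
    have p' : i = D.perm g t := by simpa using p
    subst p'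
    rw [Mat.comp_app, Mat.comp_app, D.mapCell_app _ _ _ p, D.compIso_hom_app _ _ p, Mat.app_smul,
      Mat.hprod_pure, Mat.id_app, D.unitIso_hom_app (by simp), Mat.pure_smul_left, Mat.app_smul,
      Mat.app_smul, Mat.leftUnit_hom_pure, smul_smul, D.cocycle_one_left]
    congr 1
    simp)

theorem mapCell_rightUnit (g : G) :
    D.mapCell (g * 1) g (1 : A) = (D.compIso g 1).hom ≫
      Mat.hprod (𝟙 (D.permMat g)) D.unitIso.hom ≫ (Mat.rightUnit (D.permMat g)).hom :=
  Mat.Hom.ext (by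
    funext i t
    refine D.perm_ext fun p => ?_
    have p' : i = D.perm g t := by simpa using p
    have hi : (D.perm g)⁻¹ i = t := by rw [p']; simp
    have key : ∀ s, s = t → (Mat.hprod (𝟙 (D.permMat g)) D.unitIso.hom ≫
        (Mat.rightUnit (D.permMat g)).hom).app i t
        (Mat.pure _ _ i s t (D.permVec g i s) (D.permVec 1 s t)) =
          (D.cocycle t 1 1 : ℂ) • D.permVec g i t := by
      rintro s rfl
      rw [Mat.comp_app, Mat.hprod_pure, Mat.id_app, D.unitIso_hom_app (by simp),
        Mat.pure_smul_right, Mat.app_smul, Mat.rightUnit_hom_pure]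
    rw [D.mapCell_app _ _ _ p, Mat.comp_app, D.compIso_hom_app _ _ p, Mat.app_smul,
      key _ (by simp), smul_smul, D.cocycle_one_right, hi]
    congr 1
    simp)

/-- The 2-representation given by a triple `(σ, c, χ)`. -/
def toTwoRep : TwoRep G A where
  obj _ := ⟨D.dim⟩
  map g := D.permMat g.elt
  map₂ {_ _ g h} a := D.mapCell g.elt h.elt a.elt
  map₂_id _ := D.mapCell_one _
  map₂_comp a _ := D.mapCell_mul _ _ _ (congrArg _ a.eq) _ _
  mapId _ := D.unitIso
  mapComp g h := D.compIso g.elt h.elt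
  map₂_whisker_left _ _ _ a := D.mapCell_left _ _ _ a.elt (congrArg _ a.eq)
  map₂_whisker_right a _ := D.mapCell_right _ _ _ a.elt (congrArg _ a.eq)
  map₂_associator _ _ _ := D.mapCell_assoc _ _ _
  map₂_left_unitor _ := D.mapCell_leftUnit _
  map₂_right_unitor _ := D.mapCell_rightUnit _

end TwoRepData
end TwoRep
/-! ### Simple 2-representations -/

section Labels

variable {G : Type u} {A : Type v} [Group G] [CommGroup A] [MulDistribMulAction G A]

/-- The conjugate character `ᵍβ`, with `ᵍβ(a) = β(g⁻¹ • a)`. -/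
def conjChar (g : G) (β : A →* Circle) : A →* Circle :=
  β.comp (MulDistribMulAction.toMonoidHom A g⁻¹)

@[simp]
theorem conjChar_apply (g : G) (β : A →* Circle) (a : A) : conjChar g β a = β (g⁻¹ • a) := rfl

variable (G A) in
/-- The equivalence relation on characters of `A` whose classes are the `G`-orbits. -/
def orbitSetoid : Setoid (A →* Circle) where
  r α β := ∃ g : G, α = conjChar g β
  iseqv :=
    { refl := fun α => ⟨1, by ext; simp⟩
      symm := by
        rintro α β ⟨g, rfl⟩
        exact ⟨g⁻¹, by ext; simp⟩
      trans := by
        rintro α β γ ⟨g, rfl⟩ ⟨h, rfl⟩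
        exact ⟨g * h, by ext; simp [mul_smul]⟩ }

variable (G A) in
/-- A label `(H, u, α)`: a subgroup `H` of `G`, a 2-cocycle `u ∈ Z²(H, U(1))` and an
`H`-invariant character `α` of `A`. -/
structure SimpleLabel where
  H : Subgroup G
  u : H → H → Circle
  cocycle_eq : ∀ x y z, u y z * u x (y * z) = u (x * y) z * u x y
  α : A →* Circle
  invariant : ∀ h ∈ H, ∀ a, α (h • a) = α a

namespace SimpleLabel

/-- The isomorphism `x ↦ g⁻¹ x g` from `ᵍK = g K g⁻¹` to `K`. -/
def unconj (g : G) (K : Subgroup G) (x : K.map (MulAut.conj g).toMonoidHom) : K :=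
  ⟨g⁻¹ * x * g, by
    obtain ⟨k, hk, e⟩ := x.2
    rw [← e]
    simpa [mul_assoc] using hk⟩

/-- The conjugate label `ᵍ(K, v, β) = (g K g⁻¹, ᵍv, ᵍβ)`. -/
def conj (g : G) (m : SimpleLabel G A) : SimpleLabel G A where
  H := m.H.map (MulAut.conj g).toMonoidHom
  u x y := m.u (unconj g m.H x) (unconj g m.H y)
  cocycle_eq x y z := by
    have e : ∀ x y, unconj g m.H (x * y) = unconj g m.H x * unconj g m.H y := fun x y =>
      Subtype.ext (by simp only [unconj, Subgroup.coe_mul]; group)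
    rw [e, e]
    exact m.cocycle_eq _ _ _
  α := conjChar g m.α
  invariant h hh a := by
    have := m.invariant _ (unconj g m.H ⟨h, hh⟩).2 (g⁻¹ • a)
    simpa [unconj, smul_smul, mul_assoc] using this

/-- The intersection `H ∩ ᵍK` for labels `(H, u, α)` and `(K, v, β)`. -/
abbrev homSubgroup (l m : SimpleLabel G A) (g : G) : Subgroup G := l.H ⊓ (m.conj g).H

/-- The 2-cocycle `ū ⊗ ᵍv` on `H ∩ ᵍK`; complex conjugation on `U(1)` is inversion. -/
def homCocycle (l m : SimpleLabel G A) (g : G) (x y : homSubgroup l m g) : Circle :=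
  (l.u ⟨x, x.2.1⟩ ⟨y, y.2.1⟩)⁻¹ * (m.conj g).u ⟨x, x.2.2⟩ ⟨y, y.2.2⟩

variable [Finite G] (l : SimpleLabel G A)

/-- An enumeration of the left cosets of `H`. -/
def cosetEquiv : (G ⧸ l.H) ≃ Fin (Nat.card (G ⧸ l.H)) := Finite.equivFin _

/-- The fixed representative `Rᵢ` of the `i`-th left coset of `H`. -/
def rep (i : Fin (Nat.card (G ⧸ l.H))) : G := (l.cosetEquiv.symm i).out

/-- The permutation action of `G` on the (enumerated) left cosets of `H`. -/
def indPerm : G →* Equiv.Perm (Fin (Nat.card (G ⧸ l.H))) :=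
  l.cosetEquiv.permCongrHom.toMonoidHom.comp (MulAction.toPermHom G (G ⧸ l.H))

theorem mk_rep (i) : (QuotientGroup.mk (l.rep i) : G ⧸ l.H) = l.cosetEquiv.symm i :=
  Quotient.out_eq' _

theorem mk_rep_indPerm (g : G) (i) :
    (QuotientGroup.mk (l.rep (l.indPerm g i)) : G ⧸ l.H) = QuotientGroup.mk (g * l.rep i) := by
  rw [mk_rep]
  have : (QuotientGroup.mk (g * l.rep i) : G ⧸ l.H) = g • QuotientGroup.mk (l.rep i) := rfl
  rw [this, mk_rep]
  simp [indPerm]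

/-- The element `hᵢ(g)` of `H` with `g Rᵢ = R_{g(i)} hᵢ(g)`. -/
def stabElt (g : G) (i : Fin (Nat.card (G ⧸ l.H))) : l.H :=
  ⟨(l.rep (l.indPerm g i))⁻¹ * (g * l.rep i), QuotientGroup.eq.1 (l.mk_rep_indPerm g i)⟩

theorem stabElt_mul (g h : G) (i) :
    l.stabElt (g * h) i = l.stabElt g (l.indPerm h i) * l.stabElt h i :=
  Subtype.ext (by simp [stabElt, mul_assoc])

/-- The data `(σ, c, χ)` of the 2-representation induced from `(u, α)`. -/
def indData : TwoRepData G A where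
  dim := Nat.card (G ⧸ l.H)
  perm := l.indPerm
  cocycle i g h := l.u (l.stabElt g ((l.indPerm g)⁻¹ i)) (l.stabElt h ((l.indPerm (g * h))⁻¹ i))
  char i := conjChar (l.rep i) l.α
  cocycle_eq i g h k := by
    have e₁ : (l.indPerm h)⁻¹ ((l.indPerm g)⁻¹ i) = (l.indPerm (g * h))⁻¹ i := by simp
    have e₂ : (l.indPerm (h * k))⁻¹ ((l.indPerm g)⁻¹ i) = (l.indPerm (g * h * k))⁻¹ i := by simp
    have e₃ : l.stabElt (h * k) ((l.indPerm (g * (h * k)))⁻¹ i) =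
        l.stabElt h ((l.indPerm (g * h))⁻¹ i) * l.stabElt k ((l.indPerm (g * h * k))⁻¹ i) := by
      rw [stabElt_mul]
      simp
    have e₄ : l.stabElt (g * h) ((l.indPerm (g * h))⁻¹ i) =
        l.stabElt g ((l.indPerm g)⁻¹ i) * l.stabElt h ((l.indPerm (g * h))⁻¹ i) := by
      rw [stabElt_mul]
      simp
    rw [e₁, e₂, e₃, e₄]
    exact l.cocycle_eq _ _ _
  char_smul i g a := by
    have h := l.invariant _ (l.stabElt g ((l.indPerm g)⁻¹ i)).2
      ((l.rep ((l.indPerm g)⁻¹ i))⁻¹ • a)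
    have e : l.indPerm g ((l.indPerm g)⁻¹ i) = i := by simp
    simp only [stabElt, e] at h
    simpa [smul_smul, mul_assoc] using h

/-- The 2-representation `Ind_H(u, α)`. -/
def ind : TwoRep G A := l.indData.toTwoRep

end SimpleLabel

namespace TwoRep

/-- The dimension of a 2-representation. -/
def dim (F : TwoRep G A) : ℕ := (F.obj .pt).dim

/-- The matrix `F_g` of a 2-representation. -/
def mat (F : TwoRep G A) (g : G) : Mat F.dim F.dim := F.map (SplitTwoGroup.cell A g)

/-- `F` is the direct sum of its blocks on `S` and on the complement of `S`: the entries of all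
the matrices `F_g` outside of these two diagonal blocks are zero. -/
def IsDirectSumOfBlocks (F : TwoRep G A) (S : Set (Fin F.dim)) : Prop :=
  ∀ (g : G) (i j : Fin F.dim), ¬ (i ∈ S ↔ j ∈ S) → Subsingleton ((F.mat g).entry i j)

/-- A nonzero 2-representation is simple if no 2-representation equivalent to it is a direct sum
of two nonzero blocks. -/
def IsSimple (F : TwoRep G A) : Prop :=
  F.dim ≠ 0 ∧ ∀ F' : TwoRep G A, Nonempty (Bicategory.Equivalence F' F) →
    ∀ S : Set (Fin F'.dim), F'.IsDirectSumOfBlocks S → S = ∅ ∨ S = Set.univ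

/-- `F` is labelled by `(H, u, α)` if it is equivalent to `Ind_H(u, α)`. -/
def IsLabelledBy [Finite G] (F : TwoRep G A) (l : SimpleLabel G A) : Prop :=
  Nonempty (Bicategory.Equivalence F l.ind)

/-- There is a nonzero 1-morphism from `F` to `F'`. -/
def HasNonzeroHom (F F' : TwoRep G A) : Prop := ∃ η : F ⟶ F', ¬ Limits.IsZero η

variable (G A) in
/-- The connected components of the 2-category of 2-representations: classes of simple objects
under the equivalence relation generated by having a nonzero 1-morphism. -/
def Components : Type _ :=
  Quot fun F F' : {F : TwoRep G A // F.IsSimple} => HasNonzeroHom F.1 F'.1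

/-- The connected component of a simple 2-representation. -/
def component (F : TwoRep G A) (hF : F.IsSimple) : Components G A := Quot.mk _ ⟨F, hF⟩

end TwoRep

end Labels

/-! ### Linear structures on the categories of 1-morphisms -/

namespace Mat

variable {n m k : ℕ}

instance (A B : Mat n m) : Add (A ⟶ B) := ⟨fun f g => ⟨fun i j => f.app i j + g.app i j⟩⟩
instance (A B : Mat n m) : Zero (A ⟶ B) := ⟨⟨fun _ _ => 0⟩⟩
instance (A B : Mat n m) : Neg (A ⟶ B) := ⟨fun f => ⟨fun i j => -f.app i j⟩⟩
instance (A B : Mat n m) : SMul ℂ (A ⟶ B) := ⟨fun c f => ⟨fun i j => c • f.app i j⟩⟩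

@[simp] theorem add_app {A B : Mat n m} (f g : A ⟶ B) (i j x) :
    Hom.app (f + g) i j x = f.app i j x + g.app i j x := rfl
@[simp] theorem zero_app {A B : Mat n m} (i j x) : Hom.app (0 : A ⟶ B) i j x = 0 := rfl
@[simp] theorem neg_app {A B : Mat n m} (f : A ⟶ B) (i j x) :
    Hom.app (-f) i j x = -f.app i j x := rfl
@[simp] theorem smul_app {A B : Mat n m} (c : ℂ) (f : A ⟶ B) (i j x) :
    Hom.app (c • f) i j x = c • f.app i j x := rfl

instance (A B : Mat n m) : AddCommGroup (A ⟶ B) where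
  add_assoc _ _ _ := by ext; simp [add_assoc]
  zero_add _ := by ext; simp
  add_zero _ := by ext; simp
  add_comm _ _ := by ext; simp [add_comm]
  neg_add_cancel _ := by ext; simp
  nsmul := nsmulRec
  zsmul := zsmulRec

instance (A B : Mat n m) : Module ℂ (A ⟶ B) where
  one_smul _ := by ext; simp
  mul_smul _ _ _ := by ext; simp [mul_smul]
  smul_zero _ := by ext; simp
  smul_add _ _ _ := by ext; simp
  add_smul _ _ _ := by ext; simp [add_smul]
  zero_smul _ := by ext; simp

instance : Preadditive (Mat n m) where
  add_comp _ _ _ _ _ _ := by ext; simp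
  comp_add _ _ _ _ _ _ := by ext; simp

instance : Linear ℂ (Mat n m) where
  smul_comp _ _ _ _ _ _ := by ext; simp
  comp_smul _ _ _ _ _ _ := by ext; simp

theorem hprod_add {A A' : Mat n m} {B B' : Mat m k} (f : A ⟶ A') (g h : B ⟶ B') :
    hprod f (g + h) = hprod f g + hprod f h := hom_prod_ext fun _ _ _ _ _ => by simp

theorem add_hprod {A A' : Mat n m} {B B' : Mat m k} (f g : A ⟶ A') (h : B ⟶ B') :
    hprod (f + g) h = hprod f h + hprod g h := hom_prod_ext fun _ _ _ _ _ => by simp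

theorem hprod_smul {A A' : Mat n m} {B B' : Mat m k} (c : ℂ) (f : A ⟶ A') (g : B ⟶ B') :
    hprod f (c • g) = c • hprod f g := hom_prod_ext fun _ _ _ _ _ => by simp

theorem smul_hprod {A A' : Mat n m} {B B' : Mat m k} (c : ℂ) (f : A ⟶ A') (g : B ⟶ B') :
    hprod (c • f) g = c • hprod f g := hom_prod_ext fun _ _ _ _ _ => by simp

end Mat

namespace TwoVect

instance (a b : TwoVect) : Preadditive (a ⟶ b) := inferInstanceAs (Preadditive (Mat a.dim b.dim))
instance (a b : TwoVect) : Linear ℂ (a ⟶ b) := inferInstanceAs (Linear ℂ (Mat a.dim b.dim))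

open Bicategory

theorem whiskerLeft_add {a b c : TwoVect} (f : a ⟶ b) {g h : b ⟶ c} (x y : g ⟶ h) :
    f ◁ (x + y) = f ◁ x + f ◁ y := Mat.hprod_add _ _ _

theorem whiskerLeft_smul {a b c : TwoVect} (f : a ⟶ b) {g h : b ⟶ c} (z : ℂ) (x : g ⟶ h) :
    f ◁ (z • x) = z • f ◁ x := Mat.hprod_smul _ _ _

theorem whiskerLeft_zero {a b c : TwoVect} (f : a ⟶ b) (g h : b ⟶ c) :
    f ◁ (0 : g ⟶ h) = 0 := Mat.hom_prod_ext fun i j t x y =>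
  (Mat.hprod_pure (𝟙 f) 0 i j t x y).trans (map_zero _)

theorem zero_whiskerRight {a b c : TwoVect} (f g : a ⟶ b) (h : b ⟶ c) :
    (0 : f ⟶ g) ▷ h = 0 := Mat.hom_prod_ext fun i j t x y =>
  (Mat.hprod_pure 0 (𝟙 h) i j t x y).trans (by simp)

theorem add_whiskerRight {a b c : TwoVect} {f g : a ⟶ b} (x y : f ⟶ g) (h : b ⟶ c) :
    (x + y) ▷ h = x ▷ h + y ▷ h := Mat.add_hprod _ _ _

theorem smul_whiskerRight {a b c : TwoVect} {f g : a ⟶ b} (z : ℂ) (x : f ⟶ g) (h : b ⟶ c) :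
    (z • x) ▷ h = z • x ▷ h := Mat.smul_hprod _ _ _

end TwoVect

section HomCategory

open Bicategory

variable {G : Type u} {A : Type v} [Group G] [CommGroup A] [MulDistribMulAction G A]
  {F F' : TwoRep G A}

variable {η θ : F ⟶ F'}

instance : SMul ℂ (η ⟶ θ) :=
  ⟨fun z x => ⟨⟨fun a => z • x.as.app a, fun {a b} f => by
    rw [TwoVect.whiskerLeft_smul, TwoVect.smul_whiskerRight, Linear.smul_comp, Linear.comp_smul,
      x.as.naturality]⟩⟩⟩

instance : Add (η ⟶ θ) :=
  ⟨fun x y => ⟨⟨fun a => x.as.app a + y.as.app a, fun {a b} f => by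
    rw [TwoVect.whiskerLeft_add, TwoVect.add_whiskerRight, Preadditive.add_comp,
      Preadditive.comp_add, x.as.naturality, y.as.naturality]⟩⟩⟩

instance : Zero (η ⟶ θ) :=
  ⟨⟨⟨fun _ => 0, fun {a b} f => by
    rw [TwoVect.whiskerLeft_zero, TwoVect.zero_whiskerRight, Limits.zero_comp,
      Limits.comp_zero]⟩⟩⟩

instance : Neg (η ⟶ θ) := ⟨fun x => (-1 : ℂ) • x⟩

@[simp] theorem smul_as_app (z : ℂ) (x : η ⟶ θ) (a) : (z • x).as.app a = z • x.as.app a := rfl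
@[simp] theorem add_as_app (x y : η ⟶ θ) (a) :
    (x + y).as.app a = x.as.app a + y.as.app a := rfl
@[simp] theorem zero_as_app (a) : (0 : η ⟶ θ).as.app a = 0 := rfl
@[simp] theorem neg_as_app (x : η ⟶ θ) (a) : (-x).as.app a = -x.as.app a :=
  neg_one_smul ℂ (x.as.app a)

theorem mod_ext {x y : η ⟶ θ} (h : ∀ a, x.as.app a = y.as.app a) : x = y :=
  Pseudofunctor.StrongTrans.homCategory.ext h

instance : AddCommGroup (η ⟶ θ) where
  add_assoc _ _ _ := mod_ext fun _ => add_assoc _ _ _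
  zero_add _ := mod_ext fun _ => zero_add _
  add_zero _ := mod_ext fun _ => add_zero _
  add_comm _ _ := mod_ext fun _ => add_comm _ _
  neg_add_cancel x := mod_ext fun a => by
    rw [add_as_app, neg_as_app]
    exact neg_add_cancel _
  nsmul := nsmulRec
  zsmul := zsmulRec

instance : Module ℂ (η ⟶ θ) where
  one_smul _ := mod_ext fun _ => one_smul _ _
  mul_smul _ _ _ := mod_ext fun _ => mul_smul _ _ _
  smul_zero _ := mod_ext fun _ => smul_zero _
  smul_add _ _ _ := mod_ext fun _ => smul_add _ _ _
  add_smul _ _ _ := mod_ext fun _ => add_smul _ _ _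
  zero_smul _ := mod_ext fun _ => zero_smul _ _

/-- The category of 1-morphisms `F ⟶ F'` and 2-morphisms is preadditive. -/
instance : Preadditive (F ⟶ F') where
  add_comp _ _ _ _ _ _ := mod_ext fun _ => Preadditive.add_comp _ _ _ _ _ _
  comp_add _ _ _ _ _ _ := mod_ext fun _ => Preadditive.comp_add _ _ _ _ _ _

/-- The category of 1-morphisms `F ⟶ F'` and 2-morphisms is `ℂ`-linear. -/
instance : Linear ℂ (F ⟶ F') where
  smul_comp _ _ _ _ _ _ := mod_ext fun _ => Linear.smul_comp _ _ _ _ _ _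
  comp_smul _ _ _ _ _ _ := mod_ext fun _ => Linear.comp_smul _ _ _ _ _ _

end HomCategory

/-! ### Projective representations -/

/-- A finite-dimensional projective representation of `L` with 2-cocycle `w`, that is, with
`φ(x y) = w(x, y) φ(x) φ(y)`. -/
structure ProjRep {L : Type u} [Group L] (w : L → L → Circle) : Type (max u 1) where
  space : Type
  [grp : AddCommGroup space]
  [mod : Module ℂ space]
  [fin : Module.Finite ℂ space]
  action : L → (space ≃ₗ[ℂ] space)
  action_mul : ∀ x y v, action (x * y) v = (w x y : ℂ) • action x (action y v)

namespace ProjRep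

attribute [instance] ProjRep.grp ProjRep.mod ProjRep.fin

variable {L : Type u} [Group L] {w : L → L → Circle}

/-- The linear maps that commute with the actions of `L`. -/
def intertwiners (V W : ProjRep w) : Submodule ℂ (V.space →ₗ[ℂ] W.space) where
  carrier := {f | ∀ x v, f (V.action x v) = W.action x (f v)}
  add_mem' hf hg x v := by simp [hf x v, hg x v]
  zero_mem' x v := by simp
  smul_mem' c f hf x v := by simp [hf x v]

/-- Morphisms of projective representations are the intertwiners. -/
instance : Category (ProjRep w) where
  Hom V W := intertwiners V W
  id V := ⟨LinearMap.id, fun _ _ => rfl⟩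
  comp f g := ⟨g.1 ∘ₗ f.1, fun x v => by simp [f.2 x v, g.2 x (f.1 v)]⟩

instance (V W : ProjRep w) : AddCommGroup (V ⟶ W) :=
  inferInstanceAs (AddCommGroup (intertwiners V W))

instance (V W : ProjRep w) : Module ℂ (V ⟶ W) :=
  inferInstanceAs (Module ℂ (intertwiners V W))

instance : Preadditive (ProjRep w) where
  add_comp _ _ _ f g h := Subtype.ext (LinearMap.ext fun v => map_add h.1 (f.1 v) (g.1 v))
  comp_add _ _ _ _ _ _ := rfl

instance : Linear ℂ (ProjRep w) where
  smul_comp _ _ _ c f g := Subtype.ext (LinearMap.ext fun v => map_smul g.1 c (f.1 v))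
  comp_smul _ _ _ _ _ _ := rfl

end ProjRep

/-! ### Finite direct sums of linear categories -/

/-- The direct sum of a finite family of categories: objects and morphisms are families of objects
and morphisms. -/
abbrev DirectSumCat {ι : Type u} (C : ι → Type v) : Type (max u v) := ∀ i, C i

section DirectSum

universe w

variable {ι : Type u} (C : ι → Type v) [∀ i, Category.{w} (C i)] [∀ i, Preadditive (C i)]

instance : Preadditive (DirectSumCat C) where
  homGroup X Y := inferInstanceAs (AddCommGroup (∀ i, X i ⟶ Y i))
  add_comp _ _ _ _ _ _ := funext fun _ => Preadditive.add_comp _ _ _ _ _ _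
  comp_add _ _ _ _ _ _ := funext fun _ => Preadditive.comp_add _ _ _ _ _ _

instance [∀ i, Linear ℂ (C i)] : Linear ℂ (DirectSumCat C) where
  homModule X Y := inferInstanceAs (Module ℂ (∀ i, X i ⟶ Y i))
  smul_comp _ _ _ _ _ _ := funext fun _ => Linear.smul_comp _ _ _ _ _ _
  comp_smul _ _ _ _ _ _ := funext fun _ => Linear.comp_smul _ _ _ _ _ _

end DirectSum

namespace SimpleLabel

variable {G : Type u} {A : Type v} [Group G] [CommGroup A] [MulDistribMulAction G A]

/-- The direct sum of the categories `Rep^{ū ⊗ ᵍv}(H ∩ ᵍK)` over the double cosets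
`[g] ∈ H \ G / K` with `ᾱ ⊗ ᵍβ = 1`, for representatives `g = r [g]`. -/
abbrev HomSum (l m : SimpleLabel G A)
    (r : DoubleCoset.Quotient (l.H : Set G) (m.H : Set G) → G) :=
  DirectSumCat fun d : {d : DoubleCoset.Quotient (l.H : Set G) (m.H : Set G) //
      l.α⁻¹ * conjChar (r d) m.α = 1} =>
    ProjRep (homCocycle l m (r d.1))

end SimpleLabel
end HigherRep
end

noncomputable section

namespace HigherRep

universe u v x

/-! ### Twisted equivariant bundles -/

/-! Part 1. A 1-morphism η between strict 2-representations (σ, c, χ) and (σ', c', χ') is a matrix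
of vector spaces Mᵢⱼ. Multiplying by a permutation matrix only relabels rows or columns, so the
naturality isomorphism at g is a family of isomorphisms from Mᵢⱼ to the entry at (σ_g i, σ'_g j).
Compatibility with compositors says that these isomorphisms compose up to the scalar c⁻¹c', and
naturality for a ∈ A forces χᵢ = χ'ⱼ wherever Mᵢⱼ ≠ 0. Hence 1-morphisms are twisted equivariant
bundles over the G-set of pairs (i, j), supported on pairs with equal characters (`bundleFunctor` is
an equivalence). For induced 2-representations the G-set is G/H × G/K. Its orbits correspond to
H\G/K, with base points (H, gK) and stabilizers H ∩ gKg⁻¹. A bundle is determined by its fibres at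
the base points, which are projective representations of the stabilizers; coinduction provides the
converse (`restrict_faithful`, `restrict_full`, `restrict_essSurj`). The cocycle so obtained is
computed with the fixed coset representatives, so it agrees with ū ⊗ ᵍv only up to a coboundary,
because conjugation by an element of a group changes a 2-cocycle by a coboundary
(`conjCochain_mul`); rescaling removes the difference. Composition with equivalences passes from
induced to labelled 2-representations. Part 2. If α = ᵍβ, the summand of the double coset of g
contains the twisted regular representation, which is nonzero. Conversely, A acts on the i-th row of
any F by a character, these characters are permuted by G, and a 1-morphism with nonzero entry (i, j)
forces the characters of i and j to agree (`Transitive.orbit_eq_of_hom`). Part 3. Simplicity means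
that the supports of the matrices F_g connect any two indices, so all characters of a simple F form
one orbit, and this orbit is constant on components. For injectivity no classification of simple
objects is needed: the t-th columns of the matrices F_g assemble to a nonzero 1-morphism from F to
the 2-representation induced from the trivial subgroup and the t-th character of F
(`hasNonzeroHom_trivialLabel`). Two simple objects with the same orbit thus map to a common simple
target. Surjectivity uses the same targets. -/

/-- Finite-dimensional `G`-equivariant vector bundles over a `G`-set `X`, twisted by the scalars
`w`, with support in `P`. -/
structure TwistedBundle {G : Type u} [Group G] (X : Type x) [MulAction G X]
    (w : X → G → G → Circle) (P : X → Prop) : Type (max u x 1) where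
  fib : X → Type
  [grp : ∀ x, AddCommGroup (fib x)]
  [mod : ∀ x, Module ℂ (fib x)]
  [fin : ∀ x, Module.Finite ℂ (fib x)]
  act : ∀ (g : G) {x y : X}, g • x = y → (fib x ≃ₗ[ℂ] fib y)
  act_mul : ∀ (g h : G) {x y z : X} (p : h • x = y) (q : g • y = z) (r : (g * h) • x = z) (v),
    act (g * h) r v = (w z g h : ℂ) • act g q (act h p v)
  support : ∀ x, ¬ P x → Subsingleton (fib x)

namespace TwistedBundle

attribute [instance] TwistedBundle.grp TwistedBundle.mod TwistedBundle.fin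

variable {G : Type u} [Group G] {X : Type x} [MulAction G X] {w : X → G → G → Circle}
  {P : X → Prop}

/-- The families of linear maps that commute with the actions of `G`. -/
def homs (B C : TwistedBundle X w P) : Submodule ℂ (∀ x, B.fib x →ₗ[ℂ] C.fib x) where
  carrier := {f | ∀ (g : G) {x y : X} (p : g • x = y) v, f y (B.act g p v) = C.act g p (f x v)}
  add_mem' hf hg g x y p v := by simp [hf g p v, hg g p v]
  zero_mem' g x y p v := by simp
  smul_mem' c f hf g x y p v := by simp [hf g p v]

instance : Category (TwistedBundle X w P) where
  Hom B C := homs B C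
  id B := ⟨fun _ => LinearMap.id, fun _ _ _ _ _ => rfl⟩
  comp f g := ⟨fun x => g.1 x ∘ₗ f.1 x, fun h x y p v => by simp [f.2 h p v, g.2 h p]⟩

instance (B C : TwistedBundle X w P) : AddCommGroup (B ⟶ C) :=
  inferInstanceAs (AddCommGroup (homs B C))

instance (B C : TwistedBundle X w P) : Module ℂ (B ⟶ C) :=
  inferInstanceAs (Module ℂ (homs B C))

theorem hom_ext {B C : TwistedBundle X w P} {f g : B ⟶ C} (h : ∀ x v, f.1 x v = g.1 x v) :
    f = g :=
  Subtype.ext (funext fun x => LinearMap.ext (h x))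

instance : Preadditive (TwistedBundle X w P) where
  add_comp _ _ _ f g h := hom_ext fun x v => map_add (h.1 x) (f.1 x v) (g.1 x v)
  comp_add _ _ _ _ _ _ := rfl

instance : Linear ℂ (TwistedBundle X w P) where
  smul_comp _ _ _ c f g := hom_ext fun x v => map_smul (g.1 x) c (f.1 x v)
  comp_smul _ _ _ _ _ _ := rfl

/-- An isomorphism of bundles, from isomorphisms of the fibres that commute with the action. -/
def isoMk {B C : TwistedBundle X w P} (e : ∀ x, B.fib x ≃ₗ[ℂ] C.fib x)
    (h : ∀ (g : G) {x y : X} (p : g • x = y) v, e y (B.act g p v) = C.act g p (e x v)) :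
    B ≅ C where
  hom := ⟨fun x => e x, h⟩
  inv := ⟨fun x => (e x).symm, fun g x y p v => by
    apply (e y).injective
    simp [h]⟩
  hom_inv_id := hom_ext fun x v => (e x).symm_apply_apply v
  inv_hom_id := hom_ext fun x v => (e x).apply_symm_apply v

variable (B : TwistedBundle X w P)

theorem act_act (g h : G) {x y z : X} (p : h • x = y) (q : g • y = z) (v) :
    B.act g q (B.act h p v) =
      ((w z g h)⁻¹ : ℂ) • B.act (g * h) (by rw [mul_smul, p, q]) v := by
  rw [B.act_mul g h p q, smul_smul, inv_mul_cancel₀ (Circle.coe_ne_zero _), one_smul]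

/-- The cocycle is not normalized, so the unit need not act as the identity. Its scalar is forced by
`act_mul` at g = h = 1, after cancelling one copy of the invertible map `act 1`. -/
theorem act_one {x : X} (p : (1 : G) • x = x) (v) : B.act 1 p v = ((w x 1 1)⁻¹ : ℂ) • v := by
  apply (B.act 1 p).injective
  rw [B.act_act 1 1 p p, map_smul]
  congr 1
  simp only [mul_one]

end TwistedBundle

/-! ### Restriction of a bundle to base points -/

namespace ProjRep

variable {L : Type u} [Group L] {w : L → L → Circle}

theorem hom_ext {V W : ProjRep w} {f g : V ⟶ W} (h : ∀ v, f.1 v = g.1 v) : f = g :=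
  Subtype.ext (LinearMap.ext h)

/-- An isomorphism of projective representations, from an equivariant linear isomorphism. -/
def isoMk {V W : ProjRep w} (e : V.space ≃ₗ[ℂ] W.space)
    (h : ∀ x v, e (V.action x v) = W.action x (e v)) : V ≅ W where
  hom := ⟨e, h⟩
  inv := ⟨e.symm, fun x v => by
    apply e.injective
    simp [h]⟩
  hom_inv_id := hom_ext fun v => e.symm_apply_apply v
  inv_hom_id := hom_ext fun v => e.apply_symm_apply v

theorem action_action (V : ProjRep w) (x y : L) (v) :
    V.action x (V.action y v) = ((w x y)⁻¹ : ℂ) • V.action (x * y) v := by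
  rw [V.action_mul, smul_smul, inv_mul_cancel₀ (Circle.coe_ne_zero _), one_smul]

theorem action_one (V : ProjRep w) (v) : V.action 1 v = ((w 1 1)⁻¹ : ℂ) • v := by
  apply (V.action 1).injective
  rw [V.action_action, map_smul, mul_one]

end ProjRep

namespace TwistedBundle

variable {G : Type u} [Group G] {X : Type x} [MulAction G X] {w : X → G → G → Circle}
  {P : X → Prop} {ι : Type u} (base : ι → X) (L : ι → Subgroup G)
  (hL : ∀ d g, g ∈ L d ↔ g • base d = base d)

/-- Restriction of a bundle to its fibres at the base points, which are projective representations
of the stabilizers. -/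
def restrict : TwistedBundle X w P ⥤
    DirectSumCat fun d => ProjRep (fun g h : L d => w (base d) g h) where
  obj B d :=
    { space := B.fib (base d)
      action g := B.act (g : G) ((hL d g).1 g.2)
      action_mul g h v := B.act_mul _ _ _ _ _ _ }
  map f d := ⟨f.1 (base d), fun _ _ => f.2 _ _ _⟩

instance : (restrict (w := w) (P := P) base L hL).Additive where

instance : (restrict (w := w) (P := P) base L hL).Linear ℂ where

variable (hbase : ∀ x, P x → ∃ d, ∃ g : G, g • base d = x)
include hbase

/-- Equivariance propagates a morphism from a base point along its whole orbit, and fibres outside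
the orbits of base points vanish. -/
theorem restrict_faithful : (restrict (w := w) (P := P) base L hL).Faithful where
  map_injective {B C} f f' h := hom_ext fun x v => by
    by_cases hx : P x
    · obtain ⟨d, g, p⟩ := hbase x hx
      obtain ⟨v, rfl⟩ := (B.act g p).surjective v
      rw [f.2 g p, f'.2 g p]
      congr 1
      exact LinearMap.congr_fun (congrArg Subtype.val (congrFun h d)) v
    · have := C.support x hx
      exact Subsingleton.elim _ _

variable (hdisj : ∀ d d', ∀ g : G, g • base d = base d' → d = d')
include hdisj

/-- Maps on the fibres at base points are extended by transport along the action. The result does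
not depend on the transporting element because the given maps commute with the stabilizers. -/
theorem restrict_full : (restrict (w := w) (P := P) base L hL).Full where
  map_surjective {B C} f := by
    -- The intertwiners are restated with stabilizers described by the equation g • base d = base d,
    -- so that elements of `L d` no longer appear as coerced terms.
    obtain ⟨φ, hφ, hf⟩ : ∃ φ : ∀ d, B.fib (base d) →ₗ[ℂ] C.fib (base d),
        (∀ d (g : G) (p : g • base d = base d) v, φ d (B.act g p v) = C.act g p (φ d v)) ∧
        ∀ d v, φ d v = (f d).1 v :=
      ⟨fun d => (f d).1, fun d g p v => (f d).2 ⟨g, (hL d g).2 p⟩ v, fun _ _ => rfl⟩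
    -- Well-definedness: two transports to x start at the same base point, and g = g' l with l in
    -- its stabilizer. The scalar w(x, g', l) appears for both B and C.
    have indep : ∀ x d g (p : g • base d = x) d' g' (p' : g' • base d' = x) v v',
        B.act g p v = B.act g' p' v' → C.act g p (φ d v) = C.act g' p' (φ d' v') := by
      intro x d g p d' g' p' v v' h
      have e : (g'⁻¹ * g) • base d = base d' := by rw [mul_smul, p, ← p', inv_smul_smul]
      obtain rfl := hdisj _ _ _ e
      obtain ⟨l, hl, rfl⟩ : ∃ l, l • base d = base d ∧ g = g' * l := ⟨g'⁻¹ * g, e, by simp⟩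
      rw [B.act_mul g' l hl p'] at h
      have hv : v' = (w x g' l : ℂ) • B.act l hl v :=
        ((B.act g' p').injective (by rw [map_smul, h])).symm
      rw [C.act_mul g' l hl p', hv, map_smul, map_smul, hφ]
    choose d s hs using hbase
    classical
    obtain ⟨Φ, hΦ⟩ : ∃ Φ : ∀ x, B.fib x →ₗ[ℂ] C.fib x,
        ∀ x d g (p : g • base d = x) v, Φ x (B.act g p v) = C.act g p (φ d v) := by
      refine ⟨fun x => if h : P x then (C.act (s x h) (hs x h)).toLinearMap ∘ₗ φ (d x h) ∘ₗ
        (B.act (s x h) (hs x h)).symm.toLinearMap else 0, fun x d' g p v => ?_⟩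
      by_cases h : P x
      · simp only [dif_pos h]
        exact indep _ _ _ _ _ _ _ _ _ (LinearEquiv.apply_symm_apply _ _)
      · have := C.support x h
        exact Subsingleton.elim _ _
    refine ⟨⟨Φ, fun g x y p v => ?_⟩, ?_⟩
    · by_cases h : P x
      · obtain ⟨v, rfl⟩ := (B.act (s x h) (hs x h)).surjective v
        rw [B.act_act, map_smul, hΦ, hΦ, C.act_act]
      · have := B.support x h
        obtain rfl : v = 0 := Subsingleton.elim _ _
        simp
    · funext d'
      refine ProjRep.hom_ext fun (v : B.fib (base d')) => ?_
      have h1 := hΦ (base d') d' 1 (one_smul _ _) v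
      -- The unit acts on both bundles by the same nonzero scalar, which cancels.
      rw [B.act_one, C.act_one, map_smul, hf] at h1
      exact smul_right_injective _ (inv_ne_zero (Circle.coe_ne_zero _)) h1

end TwistedBundle

/-! ### Coinduced bundles -/

namespace TwistedBundle

variable {G : Type u} [Group G] {X : Type x} [MulAction G X] {w : X → G → G → Circle}
  {P : X → Prop} {ι : Type u} {base : ι → X} {L : ι → Subgroup G}

/-- The fibre at `x` of the bundle coinduced from projective representations `V d` of the
stabilizers of the base points. -/
def coindFib (V : ∀ d, ProjRep (fun g h : L d => w (base d) g h)) (x : X) :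
    Submodule ℂ (∀ d, G → (V d).space) where
  -- For a vector v of the fibre at x of a genuine bundle, f d k stands for the preimage of v under
  -- the action of k. Writing v as the image of f d k under k and of f d (k l) under k l gives the
  -- second condition. All d are kept, so that no orbit has to be chosen for x.
  carrier := {f | (∀ d k, k • base d ≠ x → f d k = 0) ∧
    ∀ d k (l : L d), f d k = (w x k l : ℂ) • (V d).action l (f d (k * l))}
  add_mem' hf hg := ⟨fun d k h => by simp [hf.1 d k h, hg.1 d k h], fun d k l => by
    simp only [Pi.add_apply, map_add, smul_add]
    rw [← hf.2 d k l, ← hg.2 d k l]⟩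
  zero_mem' := ⟨fun _ _ _ => rfl, fun d k l => by simp⟩
  smul_mem' c f hf := ⟨fun d k h => by simp [hf.1 d k h], fun d k l => by
    simp only [Pi.smul_apply, map_smul]
    rw [smul_comm, ← hf.2 d k l]⟩

instance [Finite G] [Finite ι] (V : ∀ d, ProjRep (fun g h : L d => w (base d) g h)) (x : X) :
    Module.Finite ℂ (coindFib V x) :=
  inferInstance

variable (hL : ∀ d g, g ∈ L d ↔ g • base d = base d)
  (hw : ∀ (g h k : G) {y z : X}, g • y = z →
    w y h k * w z g (h * k) = w z (g * h) k * w z g h)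
  (V : ∀ d, ProjRep (fun g h : L d => w (base d) g h))

-- The cocycle identity as an equality of ratios, the form in which it moves the action of g past
-- the condition that defines `coindFib`.
include hw in
theorem cocycle_inv_mul (g h k : G) {y z : X} (p : g • y = z) :
    (w z g h : ℂ)⁻¹ * w y h k = (w z (g * h) k : ℂ) * (w z g (h * k) : ℂ)⁻¹ := by
  have h1 : (w y h k : ℂ) * w z g (h * k) = w z (g * h) k * w z g h := by
    rw [← Circle.coe_mul, hw g h k p, Circle.coe_mul]
  have := Circle.coe_ne_zero (w z g h)
  have := Circle.coe_ne_zero (w z g (h * k))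
  field_simp
  rw [h1, mul_comm]

/-- The action of `g` on the fibres of the coinduced bundle. -/
def coindAct (g : G) {y z : X} (p : g • y = z) : coindFib V y ≃ₗ[ℂ] coindFib V z where
  -- With f d k read as a preimage under k, the factorization k = g (g⁻¹ k) and `act_mul` dictate
  -- both the argument and the inverse scalar.
  toFun f := ⟨fun d k => (w z g (g⁻¹ * k) : ℂ)⁻¹ • f.1 d (g⁻¹ * k), by
    refine ⟨fun d k h => ?_, fun d k l => ?_⟩
    · change _ • f.1 d (g⁻¹ * k) = 0
      rw [f.2.1 d _ fun e => h ?_, smul_zero]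
      rw [← p, ← e, mul_smul, smul_inv_smul]
    · have := cocycle_inv_mul hw g (g⁻¹ * k) l p
      rw [mul_inv_cancel_left] at this
      change _ • f.1 d (g⁻¹ * k) = _ • (V d).action l (_ • f.1 d (g⁻¹ * (k * l)))
      rw [f.2.2 d (g⁻¹ * k) l, map_smul, smul_smul, smul_smul, this, mul_assoc]⟩
  map_add' f f' := Subtype.ext (by funext d k; simp)
  map_smul' c f := Subtype.ext (by
    funext d k
    exact smul_comm _ _ _)
  invFun f := ⟨fun d k => (w z g k : ℂ) • f.1 d (g * k), by
    refine ⟨fun d k h => ?_, fun d k l => ?_⟩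
    · change _ • f.1 d (g * k) = 0
      rw [f.2.1 d _ fun e => h ?_, smul_zero]
      rw [mul_smul, ← p] at e
      exact smul_left_cancel g e
    · have := cocycle_inv_mul hw g k l p
      change _ • f.1 d (g * k) = _ • (V d).action l (_ • f.1 d (g * (k * l)))
      rw [f.2.2 d (g * k) l, map_smul, smul_smul, smul_smul, mul_assoc]
      congr 1
      have h1 := Circle.coe_ne_zero (w z g k)
      have h2 := Circle.coe_ne_zero (w z g (k * l))
      field_simp at this
      rw [this, mul_comm]⟩
  left_inv f := Subtype.ext (by
    funext d k
    simp [smul_smul])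
  right_inv f := Subtype.ext (by
    funext d k
    simp [smul_smul])

theorem coindAct_apply (g : G) {y z : X} (p : g • y = z) (f : coindFib V y) (d k) :
    (coindAct hw V g p f).1 d k = (w z g (g⁻¹ * k) : ℂ)⁻¹ • f.1 d (g⁻¹ * k) := rfl

theorem coindAct_mul (g h : G) {x y z : X} (p : h • x = y) (q : g • y = z)
    (r : (g * h) • x = z) (f) :
    coindAct hw V (g * h) r f = (w z g h : ℂ) • coindAct hw V g q (coindAct hw V h p f) := by
  refine Subtype.ext ?_
  funext d k
  change (coindAct hw V (g * h) r f).1 d k =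
    (w z g h : ℂ) • (coindAct hw V g q (coindAct hw V h p f)).1 d k
  rw [coindAct_apply, coindAct_apply, coindAct_apply, smul_smul, smul_smul, mul_inv_rev,
    mul_assoc h⁻¹]
  congr 1
  have := cocycle_inv_mul hw g h (h⁻¹ * (g⁻¹ * k)) q
  rw [mul_inv_cancel_left] at this
  have h1 := Circle.coe_ne_zero (w z g h)
  have h2 := Circle.coe_ne_zero (w y h (h⁻¹ * (g⁻¹ * k)))
  have h3 := Circle.coe_ne_zero (w z g (g⁻¹ * k))
  have h4 := Circle.coe_ne_zero (w z (g * h) (h⁻¹ * (g⁻¹ * k)))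
  field_simp at this ⊢
  rw [← this, mul_comm]

variable [Finite G] [Finite ι] (hP : ∀ d (g : G), P (g • base d))

/-- The bundle coinduced from projective representations of the stabilizers of base points. -/
def coind : TwistedBundle X w P where
  -- Fibres of a bundle must lie in `Type`, whereas `coindFib` lives in the universe of G. A basis
  -- replaces it by a coordinate space.
  fib x := Fin (Module.finrank ℂ (coindFib V x)) → ℂ
  act g {x y} p := ((Module.finBasis ℂ (coindFib V x)).equivFun.symm.trans
    (coindAct hw V g p)).trans (Module.finBasis ℂ (coindFib V y)).equivFun
  act_mul g h x y z p q r v := by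
    simp only [LinearEquiv.trans_apply, LinearEquiv.symm_apply_apply]
    rw [coindAct_mul hw V g h p q r, map_smul]
  support x hx := by
    have : Subsingleton (coindFib V x) := ⟨fun f f' => Subtype.ext (by
      funext d k
      have hk : k • base d ≠ x := fun e => hx (e ▸ hP d k)
      rw [f.2.1 d k hk, f'.2.1 d k hk])⟩
    exact (Module.finBasis ℂ (coindFib V x)).equivFun.symm.injective.subsingleton

variable (hdisj : ∀ d d', ∀ g : G, g • base d = base d' → d = d')

omit [Finite G] [Finite ι] in
include hw in
theorem cocycle_one_left (x : X) (k : G) : w x 1 k = w x 1 1 := by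
  have h := hw 1 1 k (one_smul G x)
  rw [one_mul, one_mul] at h
  exact mul_left_cancel h

-- A function in the fibre at `base d` lives on the stabilizer of `base d`, since other base points
-- lie in other orbits. There the invariance condition determines all values from the one at 1.
omit [Finite G] [Finite ι] in
include hL hdisj in
theorem coindFib_eval_injective (d : ι) :
    Function.Injective fun f : coindFib V (base d) => f.1 d 1 := by
  refine fun f f' h => Subtype.ext (funext fun d' => funext fun k => ?_)
  by_cases e : k • base d' = base d
  · obtain rfl := hdisj _ _ _ e
    have hk := (hL d' k).2 e
    have h1 := f.2.2 d' 1 ⟨k, hk⟩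
    rw [show f.1 d' 1 = f'.1 d' 1 from h, f'.2.2 d' 1 ⟨k, hk⟩] at h1
    have h2 := (LinearEquiv.injective _ (smul_right_injective _ (Circle.coe_ne_zero _) h1)).symm
    simpa using h2
  · rw [f.2.1 _ _ e, f'.2.1 _ _ e]

omit [Finite G] [Finite ι] in
include hL in
theorem coindFib_eval_surjective (d : ι) :
    Function.Surjective fun f : coindFib V (base d) => f.1 d 1 := by
  classical
  intro v
  -- On the stabilizer the invariance condition leaves only k ↦ (action k)⁻¹ v, up to a scalar.
  have mem : Pi.single d (fun k => if h : k ∈ L d then ((V d).action ⟨k, h⟩).symm v else 0) ∈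
      coindFib V (base d) := by
    refine ⟨fun d' k h => ?_, fun d' k l => ?_⟩
    · by_cases e : d' = d
      · subst e
        rw [Pi.single_eq_same, dif_neg fun hk => h ((hL _ _).1 hk)]
      · rw [Pi.single_eq_of_ne e]
        rfl
    · by_cases e : d' = d
      · subst e
        rw [Pi.single_eq_same]
        by_cases hk : k ∈ L d'
        · have hkl : k * l ∈ L d' := mul_mem hk l.2
          rw [dif_pos hk, dif_pos hkl, LinearEquiv.symm_apply_eq]
          have := (V d').action_mul ⟨k, hk⟩ l (((V d').action ⟨k * l, hkl⟩).symm v)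
          rw [map_smul, ← this]
          exact (LinearEquiv.apply_symm_apply _ _).symm
        · have hkl : k * l ∉ L d' := fun h => hk ((mul_mem_cancel_right l.2).1 h)
          rw [dif_neg hk, dif_neg hkl, map_zero, smul_zero]
      · rw [Pi.single_eq_of_ne e]
        simp
  -- The action of 1 is w(1, 1)⁻¹, so the function above has the value w(1, 1) v at 1; the factor
  -- corrects this.
  refine ⟨(w (base d) 1 1 : ℂ)⁻¹ • ⟨_, mem⟩, ?_⟩
  change (w (base d) 1 1 : ℂ)⁻¹ • (Pi.single d _ : ∀ d, G → (V d).space) d 1 = v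
  rw [Pi.single_eq_same, dif_pos (one_mem _)]
  apply ((V d).action 1).injective
  rw [map_smul, (V d).action_one v]
  congr 1
  exact LinearEquiv.apply_symm_apply _ _

-- Evaluation at 1 intertwines the coinduced action of the stabilizer with the given one. This makes
-- it an isomorphism of projective representations, not only of vector spaces.
omit [Finite ι] [Finite G] in
include hw in
theorem coindAct_eval (d : ι) (l : L d) (p : (l : G) • base d = base d)
    (f : coindFib V (base d)) :
    (coindAct hw V l p f).1 d 1 = (V d).action l (f.1 d 1) := by
  have h1 := f.2.2 d 1 l⁻¹
  have h2 := (V d).action_mul l l⁻¹ (f.1 d (l⁻¹ : G))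
  rw [mul_inv_cancel, (V d).action_one] at h2
  rw [coindAct_apply, mul_one, h1, map_smul, cocycle_one_left hw, one_mul, ← Subgroup.coe_inv]
  rw [inv_smul_eq_iff₀ (Circle.coe_ne_zero _), smul_comm,
    ← inv_smul_eq_iff₀ (Circle.coe_ne_zero _)]
  exact h2

/-- Evaluation of the coinduced bundle at a base point. -/
def coindEval (d : ι) : coindFib V (base d) ≃ₗ[ℂ] (V d).space :=
  LinearEquiv.ofBijective
    { toFun := fun f => f.1 d 1, map_add' := fun _ _ => rfl, map_smul' := fun _ _ => rfl }
    ⟨coindFib_eval_injective hL V hdisj d, coindFib_eval_surjective hL V d⟩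

-- The coinduced bundle restricts to the given representations: evaluation at 1 is the required
-- isomorphism at each base point.
include hw hP hdisj in
theorem restrict_essSurj : (restrict (w := w) (P := P) base L hL).EssSurj where
  mem_essImage V := ⟨coind hw V hP, ⟨Pi.isoMk fun d => ProjRep.isoMk
    ((Module.finBasis ℂ (coindFib V (base d))).equivFun.symm.trans (coindEval hL V hdisj d))
    fun l v => by
      change coindEval hL V hdisj d ((Module.finBasis ℂ (coindFib V (base d))).equivFun.symm
        ((Module.finBasis ℂ (coindFib V (base d))).equivFun (coindAct hw V l ((hL d l).1 l.2)
          ((Module.finBasis ℂ (coindFib V (base d))).equivFun.symm v)))) = _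
      rw [LinearEquiv.symm_apply_apply]
      exact coindAct_eval hw V d l ((hL d l).1 l.2) _⟩⟩

end TwistedBundle

/-! ### Cohomologous cocycles -/

namespace ProjRep

variable {L : Type u} [Group L] {w w' : L → L → Circle}

/-- Rescaling a projective representation by `μ` changes its cocycle by a coboundary. -/
def rescale (μ : L → Circle) (h : ∀ x y, w' x y * (μ x * μ y) = μ (x * y) * w x y) :
    ProjRep w ⥤ ProjRep w' where
  obj V :=
    { space := V.space
      action x := (V.action x).trans (LinearEquiv.smulOfNeZero ℂ _ _ (Circle.coe_ne_zero (μ x)))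
      action_mul x y v := by
        change (μ (x * y) : ℂ) • V.action (x * y) v =
          (w' x y : ℂ) • (μ x : ℂ) • V.action x ((μ y : ℂ) • V.action y v)
        rw [V.action_mul, map_smul, smul_smul, smul_smul, smul_smul, ← Circle.coe_mul,
          ← Circle.coe_mul, ← Circle.coe_mul, ← h, mul_assoc] }
  map {V W} f := ⟨f.1, fun x v => by
    change f.1 ((μ x : ℂ) • V.action x v) = (μ x : ℂ) • W.action x (f.1 v)
    rw [map_smul, f.2]⟩

variable (μ : L → Circle) (h : ∀ x y, w' x y * (μ x * μ y) = μ (x * y) * w x y)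

instance : (rescale μ h).Additive where

instance : (rescale μ h).Linear ℂ where

/-- A nonzero scalar does not affect which maps commute with the action, and rescaling by μ⁻¹ gives
preimages of objects. -/
instance : (rescale μ h).IsEquivalence where
  faithful := ⟨fun e => hom_ext fun v => LinearMap.congr_fun (congrArg Subtype.val e) v⟩
  full := ⟨fun {V W} f => ⟨⟨f.1, fun x v => by
    let φ : V.space →ₗ[ℂ] W.space := f.1
    have e : φ ((μ x : ℂ) • V.action x v) = (μ x : ℂ) • W.action x (φ v) := f.2 x v
    rw [map_smul] at e
    exact smul_right_injective _ (Circle.coe_ne_zero _) e⟩, rfl⟩⟩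
  essSurj := ⟨fun V => ⟨(rescale (w := w') (w' := w) (fun x => (μ x)⁻¹) fun x y => by
      rw [eq_inv_mul_iff_mul_eq, ← mul_assoc, ← h]
      simp [mul_assoc]).obj V,
    ⟨isoMk (LinearEquiv.refl ℂ _) fun x v => by
      change (μ x : ℂ) • (((μ x)⁻¹ : Circle) : ℂ) • V.action x v = V.action x v
      rw [Circle.coe_inv, smul_inv_smul₀ (Circle.coe_ne_zero _)]⟩⟩⟩

end ProjRep

/-! ### Direct sums of functors -/

section Pi

universe w₁ w₂

variable {ι : Type u} {C D : ι → Type v} [∀ i, Category.{w₁} (C i)]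
  [∀ i, Category.{w₂} (D i)] [∀ i, Preadditive (C i)] [∀ i, Preadditive (D i)]
  (F : ∀ i, C i ⥤ D i)

/-- The direct sum of a family of functors. -/
abbrev directSumFunctor : DirectSumCat C ⥤ DirectSumCat D := Functor.pi F

instance [∀ i, (F i).Additive] : (directSumFunctor F).Additive where
  map_add := funext fun i => (F i).map_add

instance [∀ i, Linear ℂ (C i)] [∀ i, Linear ℂ (D i)] [∀ i, (F i).Additive]
    [∀ i, (F i).Linear ℂ] : (directSumFunctor F).Linear ℂ where
  map_smul _ _ := funext fun i => (F i).map_smul _ _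

instance [∀ i, (F i).IsEquivalence] : (directSumFunctor F).IsEquivalence :=
  (Equivalence.pi fun i => (F i).asEquivalence).isEquivalence_functor

end Pi

/-! ### Composition with equivalences -/

section Bicat

open Bicategory

universe w₁ v₁ u₁

variable {B : Type u₁} [Bicategory.{w₁, v₁} B] {a b : B}

theorem isEquivalence_postcomp (e : Bicategory.Equivalence a b) (c : B) :
    (postcomp c e.hom).IsEquivalence :=
  (CategoryTheory.Equivalence.mk (postcomp c e.hom) (postcomp c e.inv)
    ((rightUnitorNatIso c a).symm ≪≫ (postcomposing c a a).mapIso e.unit ≪≫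
      (associatorNatIsoLeft c e.hom e.inv).symm)
    (associatorNatIsoLeft c e.inv e.hom ≪≫ (postcomposing c b b).mapIso e.counit ≪≫
      rightUnitorNatIso c b)).isEquivalence_functor

/-- Precomposition is contravariant: the inverse `e.inv : b ⟶ a` is what carries 1-morphisms out of
a to 1-morphisms out of b. -/
theorem isEquivalence_precomp_inv (e : Bicategory.Equivalence a b) (c : B) :
    (precomp c e.inv).IsEquivalence :=
  (CategoryTheory.Equivalence.mk (precomp c e.inv) (precomp c e.hom)
    ((associatorNatIsoRight e.hom e.inv c).symm ≪≫ (precomposing a a c).mapIso e.unit.symm ≪≫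
      leftUnitorNatIso a c).symm
    ((leftUnitorNatIso b c).symm ≪≫ (precomposing b b c).mapIso e.counit.symm ≪≫
      associatorNatIsoRight e.inv e.hom c).symm).isEquivalence_functor

variable {G : Type u} {A : Type v} [Group G] [CommGroup A] [MulDistribMulAction G A]

instance {F F' : TwoRep G A} (η : F ⟶ F') (H : TwoRep G A) : (precomp H η).Additive where
  map_add := mod_ext fun _ => TwoVect.whiskerLeft_add _ _ _

instance {F F' : TwoRep G A} (η : F ⟶ F') (H : TwoRep G A) : (precomp H η).Linear ℂ where
  map_smul _ _ := mod_ext fun _ => TwoVect.whiskerLeft_smul _ _ _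

instance {F F' : TwoRep G A} (η : F ⟶ F') (H : TwoRep G A) : (postcomp H η).Additive where
  map_add := mod_ext fun _ => TwoVect.add_whiskerRight _ _ _

instance {F F' : TwoRep G A} (η : F ⟶ F') (H : TwoRep G A) : (postcomp H η).Linear ℂ where
  map_smul _ _ := mod_ext fun _ => TwoVect.smul_whiskerRight _ _ _

end Bicat

/-! ### Products with permutation matrices -/

namespace Mat

variable {n m k : ℕ}

/-- The permutation matrix of `σ`, with entry `ℂ` at `(i, j)` if `i = σ j`. -/
abbrev perm (σ : Equiv.Perm (Fin n)) : Mat n n := lineMat fun i j => i = σ j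

/-- The basis vector in an entry of a permutation matrix. -/
abbrev permVec (σ : Equiv.Perm (Fin n)) (i j : Fin n) : (perm σ).entry i j :=
  vec (fun i j => i = σ j) i j

/-- In each entry of a product with a permutation matrix only one summand is nonzero, so a linear
map is tested on a single kind of pure tensor. -/
theorem perm_prod_ext {σ : Equiv.Perm (Fin n)} {M : Mat n m} {i i' : Fin n} (h : i' = σ i)
    {j : Fin m} {V : Type} [AddCommGroup V] [Module ℂ V]
    {f f' : ((perm σ).prod M).entry i' j →ₗ[ℂ] V}
    (e : ∀ v, f (pure _ M i' i j (permVec σ i' i) v) = f' (pure _ M i' i j (permVec σ i' i) v)) :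
    f = f' := by
  refine prod_ext fun t y v => ?_
  have : f ∘ₗ (pure _ M i' t j).flip v = f' ∘ₗ (pure _ M i' t j).flip v :=
    vec_ext fun p => by
      obtain rfl : i = t := σ.injective (h.symm.trans p)
      exact e v
  exact LinearMap.congr_fun this y

theorem prod_perm_ext {σ : Equiv.Perm (Fin m)} {M : Mat n m} {j j' : Fin m} (h : j' = σ j)
    {i : Fin n} {V : Type} [AddCommGroup V] [Module ℂ V]
    {f f' : (M.prod (perm σ)).entry i j →ₗ[ℂ] V}
    (e : ∀ v, f (pure M _ i j' j v (permVec σ j' j)) = f' (pure M _ i j' j v (permVec σ j' j))) :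
    f = f' := by
  refine prod_ext fun t v y => ?_
  have : f ∘ₗ pure M _ i t j v = f' ∘ₗ pure M _ i t j v :=
    vec_ext fun p => by
      obtain rfl : j' = t := h.trans p.symm
      exact e v
  exact LinearMap.congr_fun this y

/-- Multiplication by a permutation matrix on the left permutes the rows. -/
def permLeft (σ : Equiv.Perm (Fin n)) (M : Mat n m) {i i' : Fin n} (h : i' = σ i) (j : Fin m) :
    M.entry i j ≃ₗ[ℂ] ((perm σ).prod M).entry i' j :=
  LinearEquiv.ofLinearMap (pure _ M i' i j (permVec σ i' i))
    (lift fun _ => vecLift fun p => castRow M (σ.injective (h.symm.trans p)) j)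
    (perm_prod_ext h fun v => by
      rw [LinearMap.comp_apply, lift_pure, vecLift_vec (P := fun i j => i = σ j) _ h]
      rfl)
    (LinearMap.ext fun v => by
      rw [LinearMap.comp_apply, lift_pure, vecLift_vec (P := fun i j => i = σ j) _ h]
      rfl)

/-- Multiplication by a permutation matrix on the right permutes the columns. -/
def permRight (M : Mat n m) (σ : Equiv.Perm (Fin m)) {j j' : Fin m} (h : j' = σ j) (i : Fin n) :
    M.entry i j' ≃ₗ[ℂ] (M.prod (perm σ)).entry i j :=
  LinearEquiv.ofLinearMap ((pure M _ i j' j).flip (permVec σ j' j))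
    (lift fun _ => (vecLift fun p => castCol M i (p.trans h.symm)).flip)
    (prod_perm_ext h fun v => by
      rw [LinearMap.comp_apply, lift_pure, LinearMap.flip_apply, LinearMap.flip_apply,
        vecLift_vec (P := fun i j => i = σ j) _ h]
      rfl)
    (LinearMap.ext fun v => by
      rw [LinearMap.comp_apply, LinearMap.flip_apply, lift_pure, LinearMap.flip_apply,
        vecLift_vec (P := fun i j => i = σ j) _ h]
      rfl)

@[simp]
theorem permLeft_apply (σ : Equiv.Perm (Fin n)) (M : Mat n m) {i i' : Fin n} (h : i' = σ i)
    (j : Fin m) (v) : permLeft σ M h j v = pure _ M i' i j (permVec σ i' i) v := rfl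

@[simp]
theorem permRight_apply (M : Mat n m) (σ : Equiv.Perm (Fin m)) {j j' : Fin m} (h : j' = σ j)
    (i : Fin n) (v) : permRight M σ h i v = pure M _ i j' j v (permVec σ j' j) := rfl

/-- The isomorphism of entries given by an isomorphism of matrices. -/
def entryEquiv {A B : Mat n m} (e : A ≅ B) (i j) : A.entry i j ≃ₗ[ℂ] B.entry i j :=
  LinearEquiv.ofLinearMap (e.hom.app i j) (e.inv.app i j)
    (LinearMap.ext fun v => by
      rw [LinearMap.comp_apply, ← comp_app, e.inv_hom_id]
      rfl)
    (LinearMap.ext fun v => by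
      rw [LinearMap.comp_apply, ← comp_app, e.hom_inv_id]
      rfl)

/-- An isomorphism of matrices, from isomorphisms of entries. -/
def isoMk {A B : Mat n m} (e : ∀ i j, A.entry i j ≃ₗ[ℂ] B.entry i j) : A ≅ B where
  hom := ⟨fun i j => e i j⟩
  inv := ⟨fun i j => (e i j).symm⟩
  hom_inv_id := hom_ext fun i j v => (e i j).symm_apply_apply v
  inv_hom_id := hom_ext fun i j v => (e i j).apply_symm_apply v

@[simp]
theorem isoMk_hom_app {A B : Mat n m} (e : ∀ i j, A.entry i j ≃ₗ[ℂ] B.entry i j) (i j v) :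
    (isoMk e).hom.app i j v = e i j v := rfl

end Mat

/-! ### 1-morphisms between strict 2-representations as bundles -/

namespace TwoRepData

variable {G : Type u} {A : Type v} [Group G] [CommGroup A] [MulDistribMulAction G A]

/-- The set of pairs of indices of two strict 2-representations. -/
@[ext]
structure Pairs (D D' : TwoRepData G A) : Type where
  fst : Fin D.dim
  snd : Fin D'.dim

variable {D D' : TwoRepData G A}

instance : MulAction G (Pairs D D') where
  smul g p := ⟨D.perm g p.fst, D'.perm g p.snd⟩
  one_smul p := Pairs.ext (by change D.perm 1 _ = _; simp) (by change D'.perm 1 _ = _; simp)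
  mul_smul g h p := Pairs.ext (by change D.perm (g * h) _ = D.perm g (D.perm h _); simp)
    (by change D'.perm (g * h) _ = D'.perm g (D'.perm h _); simp)

@[simp]
theorem smul_fst (g : G) (p : Pairs D D') : (g • p).fst = D.perm g p.fst := rfl

@[simp]
theorem smul_snd (g : G) (p : Pairs D D') : (g • p).snd = D'.perm g p.snd := rfl

variable (D D') in
/-- The twist of the bundle of a 1-morphism. -/
def twist (p : Pairs D D') (g h : G) : Circle := (D.cocycle p.fst g h)⁻¹ * D'.cocycle p.snd g h

variable (D D') in
/-- The pairs of indices with equal characters. -/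
def SameChar (p : Pairs D D') : Prop := D.char p.fst = D'.char p.snd

/-- The category of bundles for the 1-morphisms between two strict 2-representations. -/
abbrev Bundle (D D' : TwoRepData G A) := TwistedBundle (Pairs D D') (twist D D') (SameChar D D')

/-- The matrix of a 1-morphism between strict 2-representations. -/
def homMat (η : D.toTwoRep ⟶ D'.toTwoRep) : Mat D.dim D'.dim := η.app .pt

/-- The naturality isomorphisms of a 1-morphism between strict 2-representations. -/
def homNat (η : D.toTwoRep ⟶ D'.toTwoRep) (g : G) :
    (Mat.perm (D.perm g)).prod (homMat η) ≅ (homMat η).prod (Mat.perm (D'.perm g)) :=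
  η.naturality (SplitTwoGroup.cell A g)

theorem homNat_naturality (η : D.toTwoRep ⟶ D'.toTwoRep) (g : G) (a : A) :
    Mat.hprod (D.mapCell g g a) (𝟙 (homMat η)) ≫ (homNat η g).hom =
      (homNat η g).hom ≫ Mat.hprod (𝟙 (homMat η)) (D'.mapCell g g a) :=
  η.naturality_naturality (a := .pt) (b := .pt) (f := SplitTwoGroup.cell A g)
    (g := SplitTwoGroup.cell A g) (SplitTwoGroup.TwoCell.mk rfl a)

theorem homNat_comp (η : D.toTwoRep ⟶ D'.toTwoRep) (g h : G) :
    (homNat η (g * h)).hom ≫ Mat.hprod (𝟙 (homMat η)) (D'.compIso g h).hom =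
      Mat.hprod (D.compIso g h).hom (𝟙 (homMat η)) ≫
        (Mat.assoc (Mat.perm (D.perm g)) (Mat.perm (D.perm h)) (homMat η)).hom ≫
        Mat.hprod (𝟙 (Mat.perm (D.perm g))) (homNat η h).hom ≫
        (Mat.assoc (Mat.perm (D.perm g)) (homMat η) (Mat.perm (D'.perm h))).inv ≫
        Mat.hprod (homNat η g).hom (𝟙 (Mat.perm (D'.perm h))) ≫
        (Mat.assoc (homMat η) (Mat.perm (D'.perm g)) (Mat.perm (D'.perm h))).hom :=
  η.naturality_comp (SplitTwoGroup.cell A g) (SplitTwoGroup.cell A h)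

/-- The action on the bundle of a 1-morphism. -/
def homAct (η : D.toTwoRep ⟶ D'.toTwoRep) (g : G) {x y : Pairs D D'} (p : g • x = y) :
    (homMat η).entry x.fst x.snd ≃ₗ[ℂ] (homMat η).entry y.fst y.snd :=
  ((Mat.permLeft (D.perm g) (homMat η) (i' := y.fst) (by rw [← p]; rfl) x.snd).trans
    (Mat.entryEquiv (homNat η g) y.fst x.snd)).trans
    (Mat.permRight (homMat η) (D'.perm g) (j' := y.snd) (by rw [← p]; rfl) y.fst).symm

/-- The working description of `homAct`: a naturality isomorphism moves the basis vector of the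
permutation matrix from the left factor to the right one and applies the action to the other factor.
-/
theorem homNat_pure (η : D.toTwoRep ⟶ D'.toTwoRep) (g : G) {x y : Pairs D D'} (p : g • x = y)
    (v) : (homNat η g).hom.app y.fst x.snd
      (Mat.pure _ (homMat η) y.fst x.fst x.snd (Mat.permVec (D.perm g) y.fst x.fst) v) =
      Mat.pure (homMat η) _ y.fst y.snd x.snd (homAct η g p v)
        (Mat.permVec (D'.perm g) y.snd x.snd) := by
  rw [← Mat.permRight_apply (homMat η) (D'.perm g) (by rw [← p]; rfl)]
  simp only [homAct, LinearEquiv.trans_apply, LinearEquiv.apply_symm_apply]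
  rfl

/-- Reassociating exhibits the map as two successive column permutations, which are invertible. It
cancels the basis vectors at the end of `homAct_mul`. -/
theorem pure_perm_perm_injective {n m : ℕ} (M : Mat n m) {σ τ : Equiv.Perm (Fin m)}
    {i : Fin n} {j j' j'' : Fin m} (h : j' = τ j) (h' : j'' = σ j') :
    Function.Injective fun v => Mat.pure M ((Mat.perm σ).prod (Mat.perm τ)) i j'' j v
      (Mat.pure _ _ j'' j' j (Mat.permVec σ j'' j') (Mat.permVec τ j' j)) := by
  intro v v' e
  have e' := congrArg ((Mat.assoc M (Mat.perm σ) (Mat.perm τ)).inv.app i j) e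
  simp only [Mat.assoc_inv_pure] at e'
  exact (Mat.permRight M σ h' i).injective
    ((Mat.permRight (M.prod (Mat.perm σ)) τ h i).injective e')

/-- Both sides of the compositor axiom are evaluated on one pure tensor. The compositor of the
target contributes c'⁻¹ to one side and that of the source c⁻¹ to the other; the quotient is the
twist. -/
theorem homAct_mul (η : D.toTwoRep ⟶ D'.toTwoRep) (g h : G) {x y z : Pairs D D'} (p : h • x = y)
    (q : g • y = z) (r : (g * h) • x = z) (v) :
    homAct η (g * h) r v = (twist D D' z g h : ℂ) • homAct η g q (homAct η h p v) := by
  have e := congrArg (fun f => Mat.Hom.app f z.fst x.snd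
    (Mat.pure _ (homMat η) z.fst x.fst x.snd (Mat.permVec (D.perm (g * h)) z.fst x.fst) v))
    (homNat_comp η g h)
  have hy : y.fst = D.perm h x.fst := by rw [← p]; rfl
  have hz : z.fst = D.perm (g * h) x.fst := by rw [← r]; rfl
  have hy' : y.snd = D'.perm h x.snd := by rw [← p]; rfl
  have hz' : z.snd = D'.perm (g * h) x.snd := by rw [← r]; rfl
  simp only [Mat.comp_app] at e
  rw [homNat_pure η (g * h) r, Mat.hprod_pure, Mat.id_app, D'.compIso_hom_app g h hz',
    Mat.hprod_pure, D.compIso_hom_app g h hz, ← hy, ← hy', Mat.id_app,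
    Mat.pure_smul_left, Mat.pure_smul_right] at e
  simp only [Mat.app_smul] at e
  rw [Mat.assoc_hom_pure, Mat.hprod_pure, homNat_pure η h p, Mat.id_app, Mat.assoc_inv_pure,
    Mat.hprod_pure, homNat_pure η g q, Mat.id_app, Mat.assoc_hom_pure] at e
  rw [← Mat.pure_smul_left, ← Mat.pure_smul_left] at e
  have e' := pure_perm_perm_injective (homMat η) hy' (by rw [← q]; rfl) e
  rw [inv_smul_eq_iff₀ (Circle.coe_ne_zero _), smul_smul] at e'
  rw [e', twist, Circle.coe_mul, Circle.coe_inv, mul_comm]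

/-- A 2-cell a acts on the source through the character of the row and on the target through that of
the column; naturality equates the two scalars. On a nonzero fibre the characters must therefore
agree. -/
theorem homAct_char (η : D.toTwoRep ⟶ D'.toTwoRep) (g : G) {x y : Pairs D D'} (p : g • x = y)
    (a : A) (v) : (D.char y.fst a : ℂ) • homAct η g p v = (D'.char y.snd a : ℂ) • homAct η g p v := by
  have e := congrArg (fun f => Mat.Hom.app f y.fst x.snd
    (Mat.pure _ (homMat η) y.fst x.fst x.snd (Mat.permVec (D.perm g) y.fst x.fst) v))
    (homNat_naturality η g a)
  have hy : y.fst = D.perm g x.fst := by rw [← p]; rfl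
  have hy' : y.snd = D'.perm g x.snd := by rw [← p]; rfl
  simp only [Mat.comp_app] at e
  rw [homNat_pure η g p, Mat.hprod_pure, Mat.hprod_pure, D.mapCell_app _ _ _ hy,
    D'.mapCell_app _ _ _ hy', Mat.id_app, Mat.id_app, Mat.pure_smul_left, Mat.app_smul,
    homNat_pure η g p, Mat.pure_smul_right, ← Mat.pure_smul_left, ← Mat.pure_smul_left] at e
  exact (Mat.permRight (homMat η) (D'.perm g) hy' y.fst).injective e

/-- The bundle of a 1-morphism between strict 2-representations. -/
def homBundle (η : D.toTwoRep ⟶ D'.toTwoRep) : Bundle D D' where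
  fib x := (homMat η).entry x.fst x.snd
  act g _ _ p := homAct η g p
  act_mul g h _ _ _ p q r v := homAct_mul η g h p q r v
  support x hx := by
    by_contra h
    rw [not_subsingleton_iff_nontrivial] at h
    obtain ⟨v, hv⟩ := exists_ne (0 : (homMat η).entry x.fst x.snd)
    refine hx (MonoidHom.ext fun a => Circle.ext ?_)
    -- Already g = 1 suffices: `homAct` is invertible, so the image of v ≠ 0 is nonzero and the two
    -- scalars can be compared.
    have e := homAct_char η 1 (one_smul G x) a v
    exact smul_left_injective ℂ ((LinearEquiv.map_ne_zero_iff _).2 hv) e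

theorem modification_naturality {η θ : D.toTwoRep ⟶ D'.toTwoRep} (Γ : η ⟶ θ) (g : G) :
    Mat.hprod (𝟙 (Mat.perm (D.perm g))) (Γ.as.app .pt) ≫ (homNat θ g).hom =
      (homNat η g).hom ≫ Mat.hprod (Γ.as.app .pt) (𝟙 (Mat.perm (D'.perm g))) :=
  Γ.as.naturality (SplitTwoGroup.cell A g)

/-- A matrix of linear maps commutes with the naturality isomorphisms if and only if it commutes
with the actions on the bundles. -/
theorem naturality_iff {η θ : D.toTwoRep ⟶ D'.toTwoRep} (Γ : homMat η ⟶ homMat θ) (g : G) :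
    Mat.hprod (𝟙 (Mat.perm (D.perm g))) Γ ≫ (homNat θ g).hom =
      (homNat η g).hom ≫ Mat.hprod Γ (𝟙 (Mat.perm (D'.perm g))) ↔
    ∀ {x y : Pairs D D'} (p : g • x = y) v,
      Γ.app y.fst y.snd (homAct η g p v) = homAct θ g p (Γ.app x.fst x.snd v) := by
  have key : ∀ {x y : Pairs D D'} (p : g • x = y) v,
      (Mat.Hom.app (Mat.hprod (𝟙 (Mat.perm (D.perm g))) Γ ≫ (homNat θ g).hom) y.fst x.snd
        (Mat.pure _ (homMat η) y.fst x.fst x.snd (Mat.permVec (D.perm g) y.fst x.fst) v) =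
      Mat.Hom.app ((homNat η g).hom ≫ Mat.hprod Γ (𝟙 (Mat.perm (D'.perm g)))) y.fst x.snd
        (Mat.pure _ (homMat η) y.fst x.fst x.snd (Mat.permVec (D.perm g) y.fst x.fst) v)) ↔
      Γ.app y.fst y.snd (homAct η g p v) = homAct θ g p (Γ.app x.fst x.snd v) := by
    intro x y p v
    have hy' : y.snd = D'.perm g x.snd := by rw [← p]; rfl
    rw [Mat.comp_app, Mat.comp_app, homNat_pure η g p, Mat.hprod_pure, Mat.hprod_pure,
      Mat.id_app, Mat.id_app, homNat_pure θ g p, eq_comm]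
    exact (Mat.permRight (homMat θ) (D'.perm g) hy' y.fst).injective.eq_iff
  constructor
  · intro h x y p v
    rw [← key p, h]
  · intro h
    refine Mat.Hom.ext ?_
    funext i t
    have p : g • (⟨(D.perm g)⁻¹ i, t⟩ : Pairs D D') = ⟨i, D'.perm g t⟩ :=
      Pairs.ext (by simp) (by simp)
    exact Mat.perm_prod_ext (i := (D.perm g)⁻¹ i) (by simp) fun v => (key p v).2 (h p v)

variable (D D') in
/-- The functor that sends a 1-morphism between strict 2-representations to its bundle. -/
def bundleFunctor : (D.toTwoRep ⟶ D'.toTwoRep) ⥤ Bundle D D' where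
  obj := homBundle
  map {η θ} Γ := ⟨fun x => Mat.Hom.app (Γ.as.app .pt) x.fst x.snd, fun g _ _ p v =>
    (naturality_iff (η := η) (θ := θ) (Γ.as.app .pt) g).1 (modification_naturality Γ g) p v⟩

instance : (bundleFunctor D D').Additive where

instance : (bundleFunctor D D').Linear ℂ where

instance : (bundleFunctor D D').Faithful where
  map_injective h := mod_ext fun _ => Mat.hom_ext fun i j x =>
    LinearMap.congr_fun (congrFun (congrArg Subtype.val h) ⟨i, j⟩) x

instance : (bundleFunctor D D').Full where
  map_surjective {η θ} f := by
    let Γ : homMat η ⟶ homMat θ := ⟨fun i j => f.1 ⟨i, j⟩⟩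
    exact ⟨⟨⟨fun _ => Γ, fun g => (naturality_iff Γ g.elt).2 fun p v => f.2 _ p v⟩⟩, rfl⟩

end TwoRepData

/-! ### From bundles back to 1-morphisms -/

namespace TwoRepData

variable {G : Type u} {A : Type v} [Group G] [CommGroup A] [MulDistribMulAction G A]
  {D D' : TwoRepData G A} (B : Bundle D D')

/-- The matrix of the fibres of a bundle. -/
def bundleMat : Mat D.dim D'.dim where
  entry i j := B.fib ⟨i, j⟩

/-- The action on a bundle, on the entries of its matrix. -/
def bundleAct (g : G) {i i' j j'} (p : g • (⟨i, j⟩ : Pairs D D') = ⟨i', j'⟩) :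
    (bundleMat B).entry i j ≃ₗ[ℂ] (bundleMat B).entry i' j' :=
  B.act g p

/-- The naturality isomorphisms given by the action on a bundle. -/
def bundleNat (g : G) : (Mat.perm (D.perm g)).prod (bundleMat B) ≅
    (bundleMat B).prod (Mat.perm (D'.perm g)) :=
  Mat.isoMk fun i j => ((Mat.permLeft (D.perm g) (bundleMat B) (i := (D.perm g)⁻¹ i)
    (by simp) j).symm.trans (bundleAct B g (i := (D.perm g)⁻¹ i) (j' := D'.perm g j)
      (Pairs.ext (by simp) (by simp)))).trans (Mat.permRight (bundleMat B) (D'.perm g) rfl i)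

theorem bundleNat_pure (g : G) {i i' j j'} (p : g • (⟨i, j⟩ : Pairs D D') = ⟨i', j'⟩) (v) :
    (bundleNat B g).hom.app i' j
      (Mat.pure _ (bundleMat B) i' i j (Mat.permVec (D.perm g) i' i) v) =
      Mat.pure (bundleMat B) _ i' j' j (bundleAct B g p v) (Mat.permVec (D'.perm g) j' j) := by
  obtain rfl : D'.perm g j = j' := congrArg Pairs.snd p
  obtain rfl : i = (D.perm g)⁻¹ i' := by
    rw [← show D.perm g i = i' from congrArg Pairs.fst p]
    simp
  simp only [bundleNat, Mat.isoMk_hom_app, LinearEquiv.trans_apply]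
  rw [← Mat.permLeft_apply (D.perm g) (bundleMat B) (by simp), LinearEquiv.symm_apply_apply]
  rfl

theorem bundleNat_naturality (g : G) (a : A) :
    Mat.hprod (D.mapCell g g a) (𝟙 (bundleMat B)) ≫ (bundleNat B g).hom =
      (bundleNat B g).hom ≫ Mat.hprod (𝟙 (bundleMat B)) (D'.mapCell g g a) := by
  refine Mat.Hom.ext ?_
  funext i t
  refine Mat.perm_prod_ext (i := (D.perm g)⁻¹ i) (by simp) fun v => ?_
  have p : g • (⟨(D.perm g)⁻¹ i, t⟩ : Pairs D D') = ⟨i, D'.perm g t⟩ :=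
    Pairs.ext (by simp) (by simp)
  rw [Mat.comp_app, Mat.comp_app, Mat.hprod_pure, D.mapCell_app _ _ _ (by simp), Mat.id_app,
    Mat.pure_smul_left, Mat.app_smul, bundleNat_pure B g p, Mat.hprod_pure,
    D'.mapCell_app _ _ _ rfl, Mat.id_app, Mat.pure_smul_right]
  -- The support condition enters only here: either the two scalars agree or the vector they
  -- multiply is zero.
  by_cases h : SameChar D D' ⟨i, D'.perm g t⟩
  · rw [show D.char i = D'.char (D'.perm g t) from h]
  · have : Subsingleton ((bundleMat B).entry i (D'.perm g t)) := B.support _ h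
    rw [Subsingleton.elim (bundleAct B g p v) 0, map_zero, LinearMap.zero_apply, smul_zero,
      smul_zero]

/-- The unit of G acts by the inverse twist c(1, 1) c'(1, 1)⁻¹, which is exactly the discrepancy
between the unit constraints of the two 2-representations. -/
theorem bundleNat_id :
    (bundleNat B 1).hom ≫ Mat.hprod (𝟙 (bundleMat B)) D'.unitIso.hom =
      Mat.hprod D.unitIso.hom (𝟙 (bundleMat B)) ≫ (Mat.leftUnit (bundleMat B)).hom ≫
        (Mat.rightUnit (bundleMat B)).inv := by
  refine Mat.Hom.ext ?_
  funext i t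
  refine Mat.perm_prod_ext (i := i) (by simp) fun v => ?_
  have p : (1 : G) • (⟨i, t⟩ : Pairs D D') = ⟨i, t⟩ := one_smul _ _
  have e : bundleAct B 1 p v = (twist D D' ⟨i, t⟩ 1 1 : ℂ)⁻¹ • v := B.act_one p v
  rw [Mat.comp_app, Mat.comp_app, Mat.comp_app, Mat.hprod_pure, D.unitIso_hom_app (by simp),
    Mat.id_app, Mat.pure_smul_left, Mat.app_smul, Mat.leftUnit_hom_pure, Mat.rightUnit_inv_app,
    bundleNat_pure B 1 p, Mat.hprod_pure, D'.unitIso_hom_app (by simp), Mat.id_app,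
    Mat.pure_smul_right, e, ← Mat.pure_smul_left, smul_smul]
  congr 3
  rw [twist, Circle.coe_mul, Circle.coe_inv, mul_inv_rev, inv_inv,
    mul_inv_cancel_left₀ (Circle.coe_ne_zero _)]

theorem bundleNat_comp (g h : G) :
    (bundleNat B (g * h)).hom ≫ Mat.hprod (𝟙 (bundleMat B)) (D'.compIso g h).hom =
      Mat.hprod (D.compIso g h).hom (𝟙 (bundleMat B)) ≫
        (Mat.assoc (Mat.perm (D.perm g)) (Mat.perm (D.perm h)) (bundleMat B)).hom ≫
        Mat.hprod (𝟙 (Mat.perm (D.perm g))) (bundleNat B h).hom ≫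
        (Mat.assoc (Mat.perm (D.perm g)) (bundleMat B) (Mat.perm (D'.perm h))).inv ≫
        Mat.hprod (bundleNat B g).hom (𝟙 (Mat.perm (D'.perm h))) ≫
        (Mat.assoc (bundleMat B) (Mat.perm (D'.perm g)) (Mat.perm (D'.perm h))).hom := by
  refine Mat.Hom.ext ?_
  funext i'' j
  obtain ⟨i', rfl⟩ := (D.perm g).surjective i''
  obtain ⟨i, rfl⟩ := (D.perm h).surjective i'
  have hi : D.perm g (D.perm h i) = D.perm (g * h) i := by simp
  refine Mat.perm_prod_ext (i := i) hi fun v => ?_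
  have p : h • (⟨i, j⟩ : Pairs D D') = ⟨D.perm h i, D'.perm h j⟩ := rfl
  have q : g • (⟨D.perm h i, D'.perm h j⟩ : Pairs D D') =
    ⟨D.perm g (D.perm h i), D'.perm g (D'.perm h j)⟩ := rfl
  have r : (g * h) • (⟨i, j⟩ : Pairs D D') =
    ⟨D.perm g (D.perm h i), D'.perm g (D'.perm h j)⟩ := by rw [mul_smul, p, q]
  have e : bundleAct B (g * h) r v =
    (twist D D' ⟨D.perm g (D.perm h i), D'.perm g (D'.perm h j)⟩ g h : ℂ) •
      bundleAct B g q (bundleAct B h p v) := B.act_mul g h p q r v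
  simp only [Mat.comp_app]
  rw [bundleNat_pure B (g * h) r, Mat.hprod_pure, Mat.id_app, D'.compIso_hom_app g h (by simp),
    Mat.hprod_pure, D.compIso_hom_app g h hi, Mat.id_app, Mat.pure_smul_left, Mat.pure_smul_right]
  simp only [Mat.app_smul]
  rw [Mat.assoc_hom_pure, Mat.hprod_pure, bundleNat_pure B h p, Mat.id_app, Mat.assoc_inv_pure,
    Mat.hprod_pure, bundleNat_pure B g q, Mat.id_app, Mat.assoc_hom_pure, e,
    ← Mat.pure_smul_left, ← Mat.pure_smul_left, smul_smul]
  congr 3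
  rw [twist, Circle.coe_mul, Circle.coe_inv, mul_comm, mul_assoc,
    mul_inv_cancel₀ (Circle.coe_ne_zero _), mul_one]

/-- The 1-morphism given by a bundle. -/
def ofBundle : D.toTwoRep ⟶ D'.toTwoRep where
  app _ := bundleMat B
  naturality g := bundleNat B g.elt
  naturality_naturality {_ _ f g} a := by
    obtain ⟨e, a⟩ := a
    obtain rfl := e
    exact bundleNat_naturality B f.elt a
  naturality_id _ := bundleNat_id B
  naturality_comp g h := bundleNat_comp B g.elt h.elt

instance : (bundleFunctor D D').EssSurj where
  mem_essImage B := ⟨ofBundle B, ⟨TwistedBundle.isoMk (fun x => LinearEquiv.refl ℂ (B.fib x))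
    fun g x y p v => by
      have hy : y.snd = D'.perm g x.snd := by rw [← p]; rfl
      exact (Mat.permRight (bundleMat B) (D'.perm g) hy y.fst).injective
        ((homNat_pure (ofBundle B) g p v).symm.trans (bundleNat_pure B g p v))⟩⟩

instance : (bundleFunctor D D').IsEquivalence where

end TwoRepData

/-! ### Conjugation of cocycles -/

section Coboundary

variable {K : Type u} [Group K] (c : K → K → Circle)

/-- The 1-cochain whose coboundary relates a 2-cocycle to its conjugate by `s`. -/
def conjCochain (s x : K) : Circle := c x s / c s (s⁻¹ * x * s)

/-- If two cochains each relate a pair of cocycles, their quotient relates the quotients of the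
cocycles. It is applied with one cochain for each of the two labels. -/
theorem div_mul_div_of_coboundary {a b x y u u' p q r s : Circle} (h : a * u = u' * (x * y))
    (h' : b * r = s * (p * q)) : u⁻¹ * r * (x / p * (y / q)) = a / b * (u'⁻¹ * s) := by
  obtain rfl : u = a⁻¹ * (u' * (x * y)) := by rw [← h, inv_mul_cancel_left]
  obtain rfl : r = b⁻¹ * (s * (p * q)) := by rw [← h', inv_mul_cancel_left]
  refine Circle.ext ?_
  simp only [Circle.coe_mul, Circle.coe_div, Circle.coe_inv]
  have := Circle.coe_ne_zero
  field_simp [this]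

variable (hc : ∀ x y z, c y z * c x (y * z) = c (x * y) z * c x y)
include hc

/-- Inner automorphisms act trivially on second cohomology. The explicit cochain comes from
combining the cocycle identity at (x, y, s), (x, s, s⁻¹ys) and (s, s⁻¹xs, s⁻¹ys). -/
theorem conjCochain_mul (s x y : K) :
    conjCochain c s (x * y) * c x y =
      c (s⁻¹ * x * s) (s⁻¹ * y * s) * (conjCochain c s x * conjCochain c s y) := by
  have h1 := hc x y s
  have h2 := hc x s (s⁻¹ * y * s)
  have h3 := hc s (s⁻¹ * x * s) (s⁻¹ * y * s)
  have e1 : s * (s⁻¹ * y * s) = y * s := by group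
  have e2 : s * (s⁻¹ * x * s) = x * s := by group
  have e3 : s⁻¹ * x * s * (s⁻¹ * y * s) = s⁻¹ * (x * y) * s := by group
  rw [e1] at h2
  rw [e2, e3] at h3
  simp only [conjCochain]
  rw [div_mul_eq_mul_div, div_mul_div_comm, mul_div_assoc', div_eq_div_iff_mul_eq_mul, ← h1]
  calc c y s * c x (y * s) * (c s (s⁻¹ * x * s) * c s (s⁻¹ * y * s))
      = c y s * c s (s⁻¹ * x * s) * (c s (s⁻¹ * y * s) * c x (y * s)) := by
        simp only [mul_comm, mul_left_comm, mul_assoc]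
    _ = c y s * c x s * (c (x * s) (s⁻¹ * y * s) * c s (s⁻¹ * x * s)) := by
        rw [h2]
        simp only [mul_comm, mul_left_comm, mul_assoc]
    _ = _ := by
        rw [← h3]
        simp only [mul_comm, mul_left_comm, mul_assoc]

end Coboundary

/-! ### Equivariance of the twist and of the support -/

namespace TwoRepData

variable {G : Type u} {A : Type v} [Group G] [CommGroup A] [MulDistribMulAction G A]
  {D D' : TwoRepData G A}

theorem twist_cocycle (g h k : G) {y z : Pairs D D'} (p : g • y = z) :
    twist D D' y h k * twist D D' z g (h * k) =
      twist D D' z (g * h) k * twist D D' z g h := by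
  have h1 := D.cocycle_eq z.fst g h k
  have h2 := D'.cocycle_eq z.snd g h k
  have e1 : (D.perm g)⁻¹ z.fst = y.fst := by rw [← p]; simp
  have e2 : (D'.perm g)⁻¹ z.snd = y.snd := by rw [← p]; simp
  rw [e1] at h1
  rw [e2] at h2
  simp only [twist]
  rw [mul_mul_mul_comm, ← mul_inv, h1, h2, mul_inv, mul_mul_mul_comm]

theorem SameChar.smul {p : Pairs D D'} (h : SameChar D D' p) (g : G) : SameChar D D' (g • p) := by
  refine MonoidHom.ext fun a => ?_
  have h1 := D.char_smul (g • p).fst g (g⁻¹ • a)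
  have h2 := D'.char_smul (g • p).snd g (g⁻¹ • a)
  rw [smul_inv_smul] at h1 h2
  rw [h1, h2, smul_fst, smul_snd, Equiv.Perm.inv_eq_iff_eq.2 rfl, Equiv.Perm.inv_eq_iff_eq.2 rfl,
    show D.char p.fst = D'.char p.snd from h]

end TwoRepData

/-! ### Base points, stabilizers and cocycles for pairs of cosets -/

namespace SimpleLabel

variable {G : Type u} {A : Type v} [Group G] [CommGroup A] [MulDistribMulAction G A] [Finite G]

theorem indPerm_cosetEquiv (l : SimpleLabel G A) (g : G) (q : G ⧸ l.H) :
    l.indPerm g (l.cosetEquiv q) = l.cosetEquiv (g • q) := by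
  simp [indPerm]

/-- The fixed representative of gH need not be g. The error h ∈ H is harmless for characters, which
are H-invariant, and changes cocycles by a coboundary. -/
theorem rep_cosetEquiv (l : SimpleLabel G A) (g : G) :
    ∃ h : l.H, l.rep (l.cosetEquiv (QuotientGroup.mk g)) = g * h := by
  have h := l.mk_rep (l.cosetEquiv (QuotientGroup.mk g))
  rw [Equiv.symm_apply_apply] at h
  exact ⟨⟨g⁻¹ * _, QuotientGroup.eq.1 h.symm⟩, by simp⟩

theorem char_cosetEquiv (l : SimpleLabel G A) (g : G) :
    l.indData.char (l.cosetEquiv (QuotientGroup.mk g)) = conjChar g l.α := by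
  obtain ⟨h, e⟩ := l.rep_cosetEquiv g
  change conjChar (l.rep _) l.α = _
  rw [e]
  ext a
  simp only [conjChar_apply, mul_inv_rev, mul_smul]
  rw [l.invariant _ (inv_mem h.2)]

/-- The cocycle of an induced 2-representation at a fixed point of `x` and `y`. -/
theorem cocycle_fixed (l : SimpleLabel G A) {i} {x y : G} (hx : l.indPerm x i = i)
    (hy : l.indPerm y i = i) :
    l.indData.cocycle i x y = l.u (l.stabElt x i) (l.stabElt y i) := by
  have e1 : (l.indPerm x)⁻¹ i = i := by rw [Equiv.Perm.inv_eq_iff_eq, hx]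
  have e2 : (l.indPerm (x * y))⁻¹ i = i := by
    rw [Equiv.Perm.inv_eq_iff_eq, map_mul, Equiv.Perm.mul_apply, hy, hx]
  change l.u (l.stabElt x ((l.indPerm x)⁻¹ i)) (l.stabElt y ((l.indPerm (x * y))⁻¹ i)) = _
  rw [e1, e2]

theorem cosetEquiv_fixed_iff (l : SimpleLabel G A) (g x : G) :
    l.indPerm x (l.cosetEquiv (QuotientGroup.mk g)) = l.cosetEquiv (QuotientGroup.mk g) ↔
      g⁻¹ * x * g ∈ l.H := by
  rw [indPerm_cosetEquiv, Equiv.apply_eq_iff_eq]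
  change (QuotientGroup.mk (x * g) : G ⧸ l.H) = QuotientGroup.mk g ↔ _
  rw [eq_comm, QuotientGroup.eq, mul_assoc]

theorem stabElt_cosetEquiv (l : SimpleLabel G A) {g x : G} (hx : g⁻¹ * x * g ∈ l.H) (h : l.H)
    (e : l.rep (l.cosetEquiv (QuotientGroup.mk g)) = g * h) :
    l.stabElt x (l.cosetEquiv (QuotientGroup.mk g)) = h⁻¹ * ⟨g⁻¹ * x * g, hx⟩ * h := by
  refine Subtype.ext ?_
  simp only [stabElt]
  rw [(l.cosetEquiv_fixed_iff g x).2 hx, e]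
  simp [mul_assoc]

/-- With gh the fixed representative of gH, the induced cocycle at this fixed point is u evaluated
on conjugates by h. Since h lies in H, `conjCochain_mul` applies. -/
theorem exists_cochain_cosetEquiv (l : SimpleLabel G A) (g : G) :
    ∃ ν : l.H → Circle, ∀ (x y : G) (hx : g⁻¹ * x * g ∈ l.H) (hy : g⁻¹ * y * g ∈ l.H),
      ν (⟨_, hx⟩ * ⟨_, hy⟩) * l.u ⟨_, hx⟩ ⟨_, hy⟩ =
        l.indData.cocycle (l.cosetEquiv (QuotientGroup.mk g)) x y * (ν ⟨_, hx⟩ * ν ⟨_, hy⟩) := by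
  obtain ⟨h, e⟩ := l.rep_cosetEquiv g
  refine ⟨conjCochain l.u h, fun x y hx hy => ?_⟩
  rw [l.cocycle_fixed ((l.cosetEquiv_fixed_iff g x).2 hx) ((l.cosetEquiv_fixed_iff g y).2 hy),
    l.stabElt_cosetEquiv hx h e, l.stabElt_cosetEquiv hy h e]
  exact conjCochain_mul l.u l.cocycle_eq h _ _

variable (l m : SimpleLabel G A)

/-- A base point in the orbit of pairs of indices that belongs to the double coset of `g`. -/
def basePoint (g : G) : TwoRepData.Pairs l.indData m.indData :=
  ⟨l.cosetEquiv (QuotientGroup.mk 1), m.cosetEquiv (QuotientGroup.mk g)⟩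

/-- For g = g' this computes the stabilizer H ∩ gKg⁻¹; for different g and g' it shows that base
points in one orbit come from one double coset. -/
theorem smul_basePoint_eq_iff (x g g' : G) : x • basePoint l m g = basePoint l m g' ↔
    x ∈ l.H ∧ g'⁻¹ * x * g ∈ m.H := by
  rw [TwoRepData.Pairs.ext_iff]
  refine and_congr ?_ ?_
  · change l.indPerm x (l.cosetEquiv (QuotientGroup.mk 1)) = l.cosetEquiv (QuotientGroup.mk 1) ↔ _
    rw [cosetEquiv_fixed_iff]
    simp
  · change m.indPerm x (m.cosetEquiv _) = m.cosetEquiv _ ↔ _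
    rw [indPerm_cosetEquiv, Equiv.apply_eq_iff_eq, eq_comm]
    change (QuotientGroup.mk g' : G ⧸ m.H) = QuotientGroup.mk (x * g) ↔ _
    rw [QuotientGroup.eq, mul_assoc]

theorem mem_homSubgroup_iff (g x : G) :
    x ∈ homSubgroup l m g ↔ x • basePoint l m g = basePoint l m g := by
  rw [smul_basePoint_eq_iff, Subgroup.mem_inf]
  refine and_congr Iff.rfl ?_
  change x ∈ m.H.map (MulAut.conj g).toMonoidHom ↔ _
  rw [Subgroup.mem_map_equiv, MulAut.conj_symm_apply]

theorem sameChar_basePoint_iff (g : G) :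
    TwoRepData.SameChar l.indData m.indData (basePoint l m g) ↔
      l.α⁻¹ * conjChar g m.α = 1 := by
  rw [inv_mul_eq_one]
  have h1 : l.indData.char (basePoint l m g).fst = _ := l.char_cosetEquiv 1
  have h2 : m.indData.char (basePoint l m g).snd = _ := m.char_cosetEquiv g
  rw [TwoRepData.SameChar, h1, h2]
  have : conjChar (1 : G) l.α = l.α := by ext; simp
  rw [this]

/-- Each of the two factors of the twist is cohomologous to the corresponding factor of ū ⊗ ᵍv; the
quotient of the two cochains serves for the product. -/
theorem exists_rescaling (g : G) : ∃ μ : homSubgroup l m g → Circle, ∀ x y,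
    homCocycle l m g x y * (μ x * μ y) =
      μ (x * y) * TwoRepData.twist l.indData m.indData (basePoint l m g) x y := by
  obtain ⟨ν, hν⟩ := l.exists_cochain_cosetEquiv 1
  obtain ⟨κ, hκ⟩ := m.exists_cochain_cosetEquiv g
  have mem : ∀ x : homSubgroup l m g, (1 : G)⁻¹ * x * 1 ∈ l.H := fun x => by simpa using x.2.1
  have mem' : ∀ x : homSubgroup l m g, g⁻¹ * x * g ∈ m.H := fun x => (unconj g m.H ⟨x, x.2.2⟩).2
  refine ⟨fun x => ν ⟨_, mem x⟩ / κ ⟨_, mem' x⟩, fun x y => ?_⟩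
  have h1 := hν x y (mem x) (mem y)
  have h2 := hκ x y (mem' x) (mem' y)
  have e1 : (⟨_, mem x⟩ * ⟨_, mem y⟩ : l.H) = ⟨_, mem (x * y)⟩ := Subtype.ext (by simp)
  have e2 : (⟨_, mem' x⟩ * ⟨_, mem' y⟩ : m.H) = ⟨_, mem' (x * y)⟩ :=
    Subtype.ext (by simp [mul_assoc])
  have e3 : ∀ x : homSubgroup l m g, (⟨_, mem x⟩ : l.H) = ⟨x, x.2.1⟩ := fun x =>
    Subtype.ext (by simp)
  rw [e1, e3, e3, e3] at h1
  rw [e2] at h2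
  simp only [e3]
  change (l.u ⟨x, x.2.1⟩ ⟨y, y.2.1⟩)⁻¹ * m.u ⟨_, mem' x⟩ ⟨_, mem' y⟩ * _ = _ *
    ((l.indData.cocycle (l.cosetEquiv (QuotientGroup.mk 1)) x y)⁻¹ *
      m.indData.cocycle (m.cosetEquiv (QuotientGroup.mk g)) x y)
  exact div_mul_div_of_coboundary h1 h2

end SimpleLabel

/-! ### The category of 1-morphisms as a sum over double cosets -/

namespace SimpleLabel

variable {G : Type u} {A : Type v} [Group G] [CommGroup A] [MulDistribMulAction G A] [Finite G]
  (l m : SimpleLabel G A) (r : DoubleCoset.Quotient (l.H : Set G) (m.H : Set G) → G)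
  (hr : ∀ d, DoubleCoset.mk l.H m.H (r d) = d)

include hr in
theorem eq_of_smul_basePoint (d d') (x : G)
    (h : x • basePoint l m (r d) = basePoint l m (r d')) : d = d' := by
  rw [smul_basePoint_eq_iff] at h
  rw [← hr d, ← hr d', DoubleCoset.eq]
  exact ⟨x, h.1, _, inv_mem h.2, by group⟩

include hr in
theorem exists_smul_basePoint (p : TwoRepData.Pairs l.indData m.indData) :
    ∃ d, ∃ x : G, x • basePoint l m (r d) = p := by
  obtain ⟨i, j⟩ := p
  obtain ⟨q, rfl⟩ := l.cosetEquiv.surjective i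
  obtain ⟨q', rfl⟩ := m.cosetEquiv.surjective j
  obtain ⟨a, rfl⟩ := QuotientGroup.mk_surjective q
  obtain ⟨b, rfl⟩ := QuotientGroup.mk_surjective q'
  -- The pair (aH, bK) belongs to the double coset of a⁻¹b = h r k, where r is its representative.
  -- Translating (H, rK) by ah gives (aH, ahrK), and ahrK = bK.
  obtain ⟨h, hh, k, hk, e⟩ := (DoubleCoset.eq l.H m.H _ _).1
    (hr (DoubleCoset.mk l.H m.H (a⁻¹ * b)))
  refine ⟨DoubleCoset.mk l.H m.H (a⁻¹ * b), a * h, TwoRepData.Pairs.ext ?_ ?_⟩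
  · change l.indPerm _ (l.cosetEquiv _) = l.cosetEquiv _
    rw [indPerm_cosetEquiv, Equiv.apply_eq_iff_eq]
    change (QuotientGroup.mk (a * h * 1) : G ⧸ l.H) = QuotientGroup.mk a
    rw [eq_comm, QuotientGroup.eq]
    simpa using hh
  · change m.indPerm _ (m.cosetEquiv _) = m.cosetEquiv _
    rw [indPerm_cosetEquiv, Equiv.apply_eq_iff_eq]
    change (QuotientGroup.mk (a * h * _) : G ⧸ m.H) = QuotientGroup.mk b
    rw [QuotientGroup.eq]
    have : (a * h * r (DoubleCoset.mk l.H m.H (a⁻¹ * b)))⁻¹ * b = k := by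
      rw [inv_mul_eq_iff_eq_mul, mul_assoc, mul_assoc, ← mul_assoc h, ← e, mul_inv_cancel_left]
    rwa [this]

/-- The double cosets that contribute to the category of 1-morphisms. -/
abbrev HomIndex := {d : DoubleCoset.Quotient (l.H : Set G) (m.H : Set G) //
  l.α⁻¹ * conjChar (r d) m.α = 1}

/-- Restriction of a bundle to the base points given by representatives of double cosets. -/
abbrev restrictBase := TwistedBundle.restrict
  (w := TwoRepData.twist l.indData m.indData) (P := TwoRepData.SameChar l.indData m.indData)
  (fun d : HomIndex l m r => basePoint l m (r d)) (fun d => homSubgroup l m (r d))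
  (fun d g => mem_homSubgroup_iff l m (r d) g)

include hr in
theorem isEquivalence_restrictBase : (restrictBase l m r).IsEquivalence := by
  -- Coinduction ranges over all base points at once, so finitely many are needed for
  -- finite-dimensional fibres.
  have : Finite (DoubleCoset.Quotient (l.H : Set G) (m.H : Set G)) :=
    Finite.of_surjective (DoubleCoset.mk l.H m.H) (Function.LeftInverse.surjective hr)
  have hbase : ∀ x, TwoRepData.SameChar l.indData m.indData x →
      ∃ d : HomIndex l m r, ∃ g : G, g • basePoint l m (r d) = x := by
    intro x hx
    obtain ⟨d, g, e⟩ := exists_smul_basePoint l m r hr x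
    refine ⟨⟨d, ?_⟩, g, e⟩
    rw [← sameChar_basePoint_iff, ← inv_smul_eq_iff.2 e.symm]
    exact hx.smul _
  have hdisj : ∀ d d' : HomIndex l m r, ∀ g : G,
      g • basePoint l m (r d) = basePoint l m (r d') → d = d' := fun d d' g e =>
    Subtype.ext (eq_of_smul_basePoint l m r hr _ _ g e)
  exact
    { faithful := TwistedBundle.restrict_faithful _ _ _ hbase
      full := TwistedBundle.restrict_full _ _ _ hbase hdisj
      essSurj := TwistedBundle.restrict_essSurj _ TwoRepData.twist_cocycle
        (fun d g => ((sameChar_basePoint_iff l m _).2 d.2).smul g) hdisj }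

include hr in
/-- The category of 1-morphisms between 2-representations labelled by `l` and `m`. -/
theorem exists_equivalence_homSum (F F' : TwoRep G A) (hF : F.IsLabelledBy l)
    (hF' : F'.IsLabelledBy m) :
    ∃ e : CategoryTheory.Equivalence (F ⟶ F') (l.HomSum m r),
      e.functor.Additive ∧ e.functor.Linear ℂ := by
  obtain ⟨e⟩ := hF
  obtain ⟨e'⟩ := hF'
  choose μ hμ using exists_rescaling l m
  have := isEquivalence_precomp_inv e F'
  have := isEquivalence_postcomp e' l.ind
  have := isEquivalence_restrictBase l m r hr
  let R : DirectSumCat (fun d : HomIndex l m r => ProjRep fun g h : homSubgroup l m (r d) =>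
      TwoRepData.twist l.indData m.indData (basePoint l m (r d)) g h) ⥤ l.HomSum m r :=
    directSumFunctor fun d => ProjRep.rescale (μ (r d)) (hμ (r d))
  have : R.Additive := inferInstanceAs (directSumFunctor _).Additive
  have : R.Linear ℂ := inferInstanceAs ((directSumFunctor _).Linear ℂ)
  have : R.IsEquivalence := inferInstanceAs (directSumFunctor _).IsEquivalence
  let S : (l.ind ⟶ m.ind) ⥤ l.HomSum m r :=
    TwoRepData.bundleFunctor l.indData m.indData ⋙ restrictBase l m r ⋙ R
  have : S.Additive := inferInstanceAs
    (TwoRepData.bundleFunctor l.indData m.indData ⋙ restrictBase l m r ⋙ R).Additive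
  have : S.Linear ℂ := inferInstanceAs
    ((TwoRepData.bundleFunctor l.indData m.indData ⋙ restrictBase l m r ⋙ R).Linear ℂ)
  have : S.IsEquivalence := inferInstanceAs
    (TwoRepData.bundleFunctor l.indData m.indData ⋙ restrictBase l m r ⋙ R).IsEquivalence
  -- The chosen equivalences replace F and F' by the induced 2-representations, to which the bundle
  -- description applies.
  exact ⟨(Bicategory.precomp F' e.inv ⋙ Bicategory.postcomp l.ind e'.hom ⋙ S).asEquivalence,
    inferInstanceAs (Bicategory.precomp F' e.inv ⋙ Bicategory.postcomp l.ind e'.hom ⋙ S).Additive,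
    inferInstanceAs
      ((Bicategory.precomp F' e.inv ⋙ Bicategory.postcomp l.ind e'.hom ⋙ S).Linear ℂ)⟩

end SimpleLabel

/-! ### Existence of nonzero 1-morphisms -/

namespace ProjRep

variable {L : Type u} [Group L] [Finite L] (w : L → L → Circle)
  (hw : ∀ x y z, w y z * w x (y * z) = w (x * y) z * w x y)

/-- The action on the twisted regular representation. -/
def regularAction (x : L) : (Fin (Nat.card L) → ℂ) ≃ₗ[ℂ] (Fin (Nat.card L) → ℂ) where
  toFun f k := (w x (x⁻¹ * (Finite.equivFin L).symm k) : ℂ)⁻¹ *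
    f (Finite.equivFin L (x⁻¹ * (Finite.equivFin L).symm k))
  invFun f k := (w x ((Finite.equivFin L).symm k) : ℂ) *
    f (Finite.equivFin L (x * (Finite.equivFin L).symm k))
  map_add' f f' := by funext k; simp [mul_add]
  map_smul' c f := by funext k; simp [mul_left_comm]
  left_inv f := by funext k; simp
  right_inv f := by funext k; simp

/-- The twisted regular representation. -/
def regular : ProjRep w where
  space := Fin (Nat.card L) → ℂ
  action := regularAction w
  action_mul x y f := by
    funext k
    have h := hw x y (y⁻¹ * (x⁻¹ * (Finite.equivFin L).symm k))
    rw [mul_inv_cancel_left] at h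
    have h' : (w (x * y) (y⁻¹ * (x⁻¹ * (Finite.equivFin L).symm k)) : ℂ)⁻¹ =
        (w x y : ℂ) * ((w x (x⁻¹ * (Finite.equivFin L).symm k) : ℂ)⁻¹ *
          (w y (y⁻¹ * (x⁻¹ * (Finite.equivFin L).symm k)) : ℂ)⁻¹) := by
      simp only [← Circle.coe_inv, ← Circle.coe_mul]
      rw [← mul_inv_rev, h, mul_inv_rev, mul_inv_cancel_left]
    simp only [regularAction, Pi.smul_apply, LinearEquiv.coe_mk, LinearMap.coe_mk, AddHom.coe_mk,
      smul_eq_mul, Equiv.symm_apply_apply, mul_inv_rev, mul_assoc]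
    rw [h']
    simp only [mul_assoc]

theorem not_isZero_regular : ¬ Limits.IsZero (regular w hw) := by
  intro h
  have h1 : 𝟙 (regular w hw) = 0 := h.eq_of_src _ _
  have h2 := congrFun (LinearMap.congr_fun (congrArg Subtype.val h1)
    (fun _ => 1 : Fin (Nat.card L) → ℂ)) (Finite.equivFin L 1)
  exact one_ne_zero h2

end ProjRep

namespace SimpleLabel

variable {G : Type u} {A : Type v} [Group G] [CommGroup A] [MulDistribMulAction G A]
  (l m : SimpleLabel G A)

theorem homCocycle_cocycle (g : G) (x y z : homSubgroup l m g) :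
    homCocycle l m g y z * homCocycle l m g x (y * z) =
      homCocycle l m g (x * y) z * homCocycle l m g x y := by
  have h1 := l.cocycle_eq ⟨x, x.2.1⟩ ⟨y, y.2.1⟩ ⟨z, z.2.1⟩
  have h2 := (m.conj g).cocycle_eq ⟨x, x.2.2⟩ ⟨y, y.2.2⟩ ⟨z, z.2.2⟩
  change (l.u ⟨y, y.2.1⟩ ⟨z, z.2.1⟩)⁻¹ * (m.conj g).u ⟨y, y.2.2⟩ ⟨z, z.2.2⟩ *
    ((l.u ⟨x, x.2.1⟩ (⟨y, y.2.1⟩ * ⟨z, z.2.1⟩))⁻¹ *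
      (m.conj g).u ⟨x, x.2.2⟩ (⟨y, y.2.2⟩ * ⟨z, z.2.2⟩)) =
    (l.u (⟨x, x.2.1⟩ * ⟨y, y.2.1⟩) ⟨z, z.2.1⟩)⁻¹ *
      (m.conj g).u (⟨x, x.2.2⟩ * ⟨y, y.2.2⟩) ⟨z, z.2.2⟩ *
    ((l.u ⟨x, x.2.1⟩ ⟨y, y.2.1⟩)⁻¹ * (m.conj g).u ⟨x, x.2.2⟩ ⟨y, y.2.2⟩)
  rw [mul_mul_mul_comm, ← mul_inv, h1, h2, mul_inv, mul_mul_mul_comm]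

/-- Because α is H-invariant and β is K-invariant, the condition α = ᵍβ depends only on HgK, so it
may be tested on any representative. -/
theorem conjChar_eq_of_doubleCoset {g g' : G}
    (h : DoubleCoset.mk l.H m.H g = DoubleCoset.mk l.H m.H g') (e : l.α = conjChar g m.α) :
    l.α = conjChar g' m.α := by
  obtain ⟨x, hx, y, hy, rfl⟩ := (DoubleCoset.eq l.H m.H _ _).1 h
  ext a
  have h1 := l.invariant _ (inv_mem hx) a
  rw [← h1, e]
  simp only [conjChar_apply, mul_inv_rev, mul_smul]
  rw [m.invariant _ (inv_mem hy)]

variable [Finite G]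

/-- The double coset of g indexes a summand, and the family of twisted regular representations is
nonzero there. An equivalence of categories reflects this to a nonzero 1-morphism. -/
theorem hasNonzeroHom_of_conjChar_eq (F F' : TwoRep G A) (hF : F.IsLabelledBy l)
    (hF' : F'.IsLabelledBy m) (g : G) (h : l.α = conjChar g m.α) : F.HasNonzeroHom F' := by
  obtain ⟨r, hr⟩ : ∃ r : DoubleCoset.Quotient (l.H : Set G) (m.H : Set G) → G,
      ∀ d, DoubleCoset.mk l.H m.H (r d) = d := ⟨Quotient.out, Quotient.out_eq'⟩
  obtain ⟨e, he, -⟩ := exists_equivalence_homSum l m r hr F F' hF hF'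
  let X : l.HomSum m r := fun d => ProjRep.regular _ (homCocycle_cocycle l m (r d.1))
  refine ⟨e.inverse.obj X, fun hz => ?_⟩
  have hX : Limits.IsZero X := (e.functor.map_isZero hz).of_iso (e.counitIso.app X).symm
  let d : HomIndex l m r := ⟨DoubleCoset.mk l.H m.H g, by
    rw [inv_mul_eq_one]
    exact conjChar_eq_of_doubleCoset l m (hr _).symm h⟩
  have h1 : 𝟙 X = 0 := hX.eq_of_src _ _
  refine ProjRep.not_isZero_regular _ (homCocycle_cocycle l m (r d.1)) ?_
  rw [Limits.IsZero.iff_id_eq_zero]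
  exact congrFun h1 d

end SimpleLabel

/-! ### Supports of matrices -/

namespace Mat

variable {n m k : ℕ}

/-- The entry `(i, j)` of a matrix of vector spaces is nonzero. -/
def Supp (M : Mat n m) (i : Fin n) (j : Fin m) : Prop := Nontrivial (M.entry i j)

theorem supp_congr {M N : Mat n m} (e : M ≅ N) {i j} : M.Supp i j ↔ N.Supp i j :=
  (entryEquiv e i j).toEquiv.nontrivial_congr

theorem supp_lineMat {P : Fin n → Fin m → Prop} {i j} : (lineMat P).Supp i j ↔ P i j := by
  constructor
  · intro h
    by_contra hp
    have : IsEmpty (PLift (P i j)) := ⟨fun q => hp q.down⟩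
    exact not_subsingleton_iff_nontrivial.2 h (inferInstanceAs (Subsingleton (PLift (P i j) → ℂ)))
  · intro h
    have : Nonempty (PLift (P i j)) := ⟨⟨h⟩⟩
    exact inferInstanceAs (Nontrivial (PLift (P i j) → ℂ))

/-- Over a field a tensor product vanishes only if a factor does, so supports multiply like Boolean
matrices. -/
theorem supp_prod {M : Mat n m} {N : Mat m k} {i t} :
    (M.prod N).Supp i t ↔ ∃ j, M.Supp i j ∧ N.Supp j t := by
  have key : ∀ j, Nontrivial (M.entry i j ⊗[ℂ] N.entry j t) ↔ M.Supp i j ∧ N.Supp j t := by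
    intro j
    rw [← Module.finrank_pos_iff (R := ℂ), Module.finrank_tensorProduct, CanonicallyOrderedAdd.mul_pos,
      Module.finrank_pos_iff, Module.finrank_pos_iff]
    rfl
  constructor
  · intro h
    by_contra! hn
    have : ∀ j, Subsingleton (M.entry i j ⊗[ℂ] N.entry j t) := fun j =>
      not_nontrivial_iff_subsingleton.1 fun h => hn j ((key j).1 h).1 ((key j).1 h).2
    exact not_subsingleton_iff_nontrivial.2 h
      (inferInstanceAs (Subsingleton (∀ j, M.entry i j ⊗[ℂ] N.entry j t)))
  · rintro ⟨j, hj⟩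
    have := (key j).2 hj
    exact Pi.nontrivial_at j (f := fun j => M.entry i j ⊗[ℂ] N.entry j t)

/-- A matrix with an inverse up to isomorphism has nonzero entries exactly where the transpose of
the inverse has, and one in each row and column. -/
theorem supp_of_inverse {M : Mat n m} {N : Mat m n} (e : M.prod N ≅ one n)
    (e' : N.prod M ≅ one m) :
    (∀ i, ∃ j, M.Supp i j) ∧ (∀ {i i' j}, M.Supp i j → M.Supp i' j → i = i') ∧
      (∀ {i j}, M.Supp i j → N.Supp j i) := by
  have h1 : ∀ {i j i'}, M.Supp i j → N.Supp j i' → i = i' := fun h h' =>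
    supp_lineMat.1 ((supp_congr e).1 (supp_prod.2 ⟨_, h, h'⟩))
  have h2 : ∀ j, ∃ i, N.Supp j i ∧ M.Supp i j := fun j =>
    supp_prod.1 ((supp_congr e').2 (supp_lineMat.2 rfl))
  refine ⟨fun i => ?_, fun {i i' j} h h' => ?_, fun {i j} h => ?_⟩
  · obtain ⟨j, hj, -⟩ := supp_prod.1 ((supp_congr e).2 (supp_lineMat.2 (rfl : i = i)))
    exact ⟨j, hj⟩
  · obtain ⟨t, ht, -⟩ := h2 j
    rw [h1 h ht, h1 h' ht]
  · obtain ⟨t, ht, -⟩ := h2 j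
    rwa [h1 h ht]

end Mat

/-! ### Simplicity as transitivity on indices -/

namespace TwoRep

variable {G : Type u} {A : Type v} [Group G] [CommGroup A] [MulDistribMulAction G A]

/-- The compositor of a 2-representation. -/
def compMat (F : TwoRep G A) (g h : G) : F.mat (g * h) ≅ (F.mat g).prod (F.mat h) :=
  F.mapComp (SplitTwoGroup.cell A g) (SplitTwoGroup.cell A h)

/-- The unit constraint of a 2-representation. -/
def unitMat (F : TwoRep G A) : F.mat 1 ≅ Mat.one F.dim := F.mapId .pt

/-- The matrix of a 1-morphism of 2-representations. -/
def homMat {F F' : TwoRep G A} (η : F ⟶ F') : Mat F.dim F'.dim := η.app .pt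

/-- The naturality isomorphism of a 1-morphism of 2-representations. -/
def homNat {F F' : TwoRep G A} (η : F ⟶ F') (g : G) :
    (F.mat g).prod (homMat η) ≅ (homMat η).prod (F'.mat g) :=
  η.naturality (SplitTwoGroup.cell A g)

/-- The isomorphism of matrices given by an isomorphism of 1-morphisms. -/
def homMatIso {F F' : TwoRep G A} {η θ : F ⟶ F'} (e : η ≅ θ) : homMat η ≅ homMat θ where
  hom := e.hom.as.app .pt
  inv := e.inv.as.app .pt
  hom_inv_id := congrArg (fun f => f.as.app .pt) e.hom_inv_id
  inv_hom_id := congrArg (fun f => f.as.app .pt) e.inv_hom_id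

/-- The isomorphism `F_g ≅ 1` for `g = 1`. -/
def unitMatOf (F : TwoRep G A) {g : G} (h : g = 1) : F.mat g ≅ Mat.one F.dim :=
  eqToIso (by rw [h]) ≪≫ F.unitMat

/-- Any two indices are related by the action of `G`. -/
def Transitive (F : TwoRep G A) : Prop := F.dim ≠ 0 ∧ ∀ i j, ∃ g, (F.mat g).Supp i j

theorem supp_inv (F : TwoRep G A) {g : G} {i j} (h : (F.mat g).Supp i j) :
    (F.mat g⁻¹).Supp j i :=
  (Mat.supp_of_inverse ((F.compMat g g⁻¹).symm ≪≫ F.unitMatOf (mul_inv_cancel g))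
    ((F.compMat g⁻¹ g).symm ≪≫ F.unitMatOf (inv_mul_cancel g))).2.2 h

theorem supp_mul (F : TwoRep G A) {g h : G} {i j k} (h1 : (F.mat g).Supp i j)
    (h2 : (F.mat h).Supp j k) : (F.mat (g * h)).Supp i k :=
  (Mat.supp_congr (F.compMat g h)).2 (Mat.supp_prod.2 ⟨j, h1, h2⟩)

/-- The matrix of an equivalence is supported on the graph of a bijection of indices, and naturality
carries the supports of the matrices of F along it. -/
theorem Transitive.of_equivalence {F F' : TwoRep G A} (hF : F.Transitive)
    (e : Bicategory.Equivalence F' F) : F'.Transitive := by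
  obtain ⟨hr, hc, -⟩ := Mat.supp_of_inverse (M := homMat e.hom) (N := homMat e.inv)
    (homMatIso e.unit.symm) (homMatIso e.counit)
  obtain ⟨hr', -, -⟩ := Mat.supp_of_inverse (M := homMat e.inv) (N := homMat e.hom)
    (homMatIso e.counit) (homMatIso e.unit.symm)
  refine ⟨fun h0 => ?_, fun i i' => ?_⟩
  · obtain ⟨t, -⟩ := hr' ⟨0, Nat.pos_of_ne_zero hF.1⟩
    exact (Fin.cast h0 t).elim0
  · obtain ⟨j, hj⟩ := hr i
    obtain ⟨j', hj'⟩ := hr i'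
    obtain ⟨g, hg⟩ := hF.2 j j'
    obtain ⟨t, ht, ht'⟩ := Mat.supp_prod.1
      ((Mat.supp_congr (homNat e.hom g)).2 (Mat.supp_prod.2 ⟨j, hj, hg⟩))
    rw [hc hj' ht']
    exact ⟨g, ht⟩

theorem Transitive.isSimple {F : TwoRep G A} (hF : F.Transitive) : F.IsSimple := by
  refine ⟨hF.1, fun F' ⟨e⟩ S hS => ?_⟩
  have hF' := hF.of_equivalence e
  rw [or_iff_not_imp_left, ← ne_eq, ← Set.nonempty_iff_ne_empty]
  rintro ⟨i, hi⟩
  refine Set.eq_univ_of_forall fun j => ?_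
  obtain ⟨g, hg⟩ := hF'.2 i j
  by_contra hj
  exact not_subsingleton_iff_nontrivial.2 hg (hS g i j fun h => hj (h.1 hi))

/-- The indices connected to j form a block, since supports are closed under products and inverses.
The block contains j, so by simplicity it is everything. -/
theorem IsSimple.transitive {F : TwoRep G A} (hF : F.IsSimple) : F.Transitive := by
  refine ⟨hF.1, fun i j => ?_⟩
  have h := hF.2 F ⟨Bicategory.Equivalence.id F⟩ {i | ∃ g, (F.mat g).Supp i j} fun g i k hik => by
    rw [← not_nontrivial_iff_subsingleton]
    refine fun hn => hik ⟨fun ⟨h, hh⟩ => ⟨_, F.supp_mul (F.supp_inv hn) hh⟩, fun ⟨h, hh⟩ =>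
      ⟨_, F.supp_mul hn hh⟩⟩
  have hj : j ∈ {i | ∃ g, (F.mat g).Supp i j} :=
    ⟨1, (Mat.supp_congr F.unitMat).2 (Mat.supp_lineMat.2 rfl)⟩
  rcases h with h | h
  · rw [h] at hj
    exact hj.elim
  · have : i ∈ {i | ∃ g, (F.mat g).Supp i j} := by rw [h]; trivial
    exact this

/-- A 1-morphism is a zero object exactly when its identity vanishes, which can be read off entry by
entry. -/
theorem hasNonzeroHom_iff {F F' : TwoRep G A} :
    F.HasNonzeroHom F' ↔ ∃ η : F ⟶ F', ∃ i j, (homMat η).Supp i j := by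
  refine exists_congr fun η => ?_
  rw [← not_iff_not, not_not]
  push Not
  constructor
  · intro h i j
    rw [Mat.Supp, not_nontrivial_iff_subsingleton]
    have h1 : 𝟙 η = 0 := h.eq_of_src _ _
    have h2 : 𝟙 (homMat η) = 0 := congrArg (fun f => f.as.app .pt) h1
    refine subsingleton_of_forall_eq 0 fun v => ?_
    exact LinearMap.congr_fun (congrFun (congrFun (congrArg Mat.Hom.app h2) i) j) v
  · intro h
    rw [Limits.IsZero.iff_id_eq_zero]
    refine mod_ext fun _ => Mat.hom_ext fun i j v => ?_
    have : Subsingleton ((homMat η).entry i j) := not_nontrivial_iff_subsingleton.1 (h i j)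
    exact Subsingleton.elim (α := (homMat η).entry i j) _ _

end TwoRep

namespace SimpleLabel

variable {G : Type u} {A : Type v} [Group G] [CommGroup A] [MulDistribMulAction G A] [Finite G]

theorem transitive_ind (l : SimpleLabel G A) : l.ind.Transitive := by
  refine ⟨Nat.card_pos.ne', fun (i : Fin (Nat.card (G ⧸ l.H))) (j : Fin (Nat.card (G ⧸ l.H))) => ?_⟩
  obtain ⟨g, hg⟩ := MulAction.exists_smul_eq G (l.cosetEquiv.symm j) (l.cosetEquiv.symm i)
  refine ⟨g, Mat.supp_lineMat.2 ?_⟩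
  change i = l.indPerm g j
  conv_rhs => rw [← l.cosetEquiv.apply_symm_apply j]
  rw [indPerm_cosetEquiv, hg, Equiv.apply_symm_apply]

end SimpleLabel

/-! ### The characters of a 2-representation -/

namespace Mat

variable {n m k : ℕ}

/-- The scalars by which an endomorphism of the identity matrix acts. -/
def diag (f : one n ⟶ one n) (i : Fin n) : ℂ := f.app i i (oneVec i) ⟨rfl⟩

theorem app_one (f : one n ⟶ one n) (i j v) : f.app i j v = diag f i • v := by
  refine LinearMap.congr_fun (g := diag f i • LinearMap.id) (vec_ext ?_) v
  rintro rfl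
  have key : ∀ v : Line (i = i), v = v ⟨rfl⟩ • basisVec (i = i) := fun v => by
    funext q
    simp [basisVec]
  exact key _

theorem app_eq_smul_of_iso {M : Mat n n} (e : M ≅ one n) (f : M ⟶ M) (i j v) :
    f.app i j v = diag (e.inv ≫ f ≫ e.hom) i • v := by
  have h : f = e.hom ≫ (e.inv ≫ f ≫ e.hom) ≫ e.inv := by simp
  conv_lhs => rw [h]
  rw [comp_app, comp_app, app_one, map_smul, ← comp_app, e.hom_inv_id, id_app]

theorem hprod_id_app_eq_smul {M : Mat n m} {N : Mat m k} {f : N ⟶ N} {t : Fin k} {c : ℂ}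
    (h : ∀ j v, f.app j t v = c • v) (i v) : (hprod (𝟙 M) f).app i t v = c • v := by
  refine LinearMap.congr_fun (g := c • LinearMap.id) (prod_ext fun j a b => ?_) v
  rw [hprod_pure, h, map_smul]
  rfl

theorem hprod_app_id_eq_smul {M : Mat n m} {N : Mat m k} {f : M ⟶ M} {i : Fin n} {c : ℂ}
    (h : ∀ j v, f.app i j v = c • v) (t v) : (hprod f (𝟙 N)).app i t v = c • v := by
  refine LinearMap.congr_fun (g := c • LinearMap.id) (prod_ext fun j a b => ?_) v
  rw [hprod_pure, h, pure_smul_left]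
  rfl

end Mat

namespace TwoRep

variable {G : Type u} {A : Type v} [Group G] [CommGroup A] [MulDistribMulAction G A]
  (F : TwoRep G A)

/-- The action of `a ∈ A` on the matrix of `g`. -/
def actMat (g : G) (a : A) : F.mat g ⟶ F.mat g :=
  F.map₂ (SplitTwoGroup.TwoCell.mk rfl a : SplitTwoGroup.cell A g ⟶ SplitTwoGroup.cell A g)

theorem actMat_one (g : G) : F.actMat g (1 : A) = 𝟙 (F.mat g) :=
  F.map₂_id (SplitTwoGroup.cell A g)

theorem actMat_mul (g : G) (a b : A) : F.actMat g (a * b) = F.actMat g a ≫ F.actMat g b :=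
  F.map₂_comp (SplitTwoGroup.TwoCell.mk rfl a : SplitTwoGroup.cell A g ⟶ SplitTwoGroup.cell A g)
    (SplitTwoGroup.TwoCell.mk rfl b : SplitTwoGroup.cell A g ⟶ SplitTwoGroup.cell A g)

theorem actMat_left (g h : G) (a : A) : F.actMat (g * h) (g • a) =
    (F.compMat g h).hom ≫ Mat.hprod (𝟙 (F.mat g)) (F.actMat h a) ≫ (F.compMat g h).inv :=
  F.map₂_whisker_left (SplitTwoGroup.cell A g)
    (SplitTwoGroup.TwoCell.mk rfl a : SplitTwoGroup.cell A h ⟶ SplitTwoGroup.cell A h)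

theorem actMat_right (g h : G) (a : A) : F.actMat (g * h) a =
    (F.compMat g h).hom ≫ Mat.hprod (F.actMat g a) (𝟙 (F.mat h)) ≫ (F.compMat g h).inv :=
  F.map₂_whisker_right
    (SplitTwoGroup.TwoCell.mk rfl a : SplitTwoGroup.cell A g ⟶ SplitTwoGroup.cell A g)
    (SplitTwoGroup.cell A h)

/-- The scalar by which `a ∈ A` acts on the `i`-th diagonal entry of the matrix of `1`. -/
def scalar (i : Fin F.dim) : A →* ℂ where
  toFun a := Mat.diag (F.unitMat.inv ≫ F.actMat 1 a ≫ F.unitMat.hom) i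
  map_one' := by
    rw [actMat_one, Category.id_comp, Iso.inv_hom_id]
    rfl
  map_mul' a b := by
    -- Commutativity of A lets b act first, so that composition of maps yields the scalars in the
    -- order of the product ab.
    have h : F.unitMat.inv ≫ F.actMat 1 (a * b) ≫ F.unitMat.hom =
      (F.unitMat.inv ≫ F.actMat 1 b ≫ F.unitMat.hom) ≫
        (F.unitMat.inv ≫ F.actMat 1 a ≫ F.unitMat.hom) := by
      rw [mul_comm, actMat_mul]
      simp
    rw [h]
    rw [Mat.diag, Mat.comp_app, Mat.app_one]
    rfl

theorem actMat_one_app (a : A) (i j v) : (F.actMat 1 a).app i j v = F.scalar i a • v :=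
  Mat.app_eq_smul_of_iso F.unitMat _ i j v

theorem actMat_one_app' (a : A) (i j v) : (F.actMat 1 a).app i j v = F.scalar j a • v := by
  by_cases h : i = j
  · subst h
    exact F.actMat_one_app a i i v
  · have : Subsingleton ((F.mat 1).entry i j) := not_nontrivial_iff_subsingleton.1 fun hn =>
      h (Mat.supp_lineMat.1 ((Mat.supp_congr F.unitMat).1 hn))
    exact Subsingleton.elim _ _

/-- F_g is F_g ∘ F_1, and whiskering a on the left by g turns it into g • a. The scalar is thus read
off the column index, while in `actMat_app` F_g is F_1 ∘ F_g and the row index decides. -/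
theorem actMat_smul_app (g : G) (a : A) (i j v) :
    (F.actMat g (g • a)).app i j v = F.scalar j a • v := by
  -- A variable g' in place of g * 1 avoids transport between the matrices of equal group elements.
  have key : ∀ g', g * 1 = g' → ∀ v, (F.actMat g' (g • a)).app i j v = F.scalar j a • v := by
    rintro _ rfl v
    rw [actMat_left, Mat.comp_app, Mat.comp_app,
      Mat.hprod_id_app_eq_smul (fun i v => F.actMat_one_app' a i j v), map_smul, ← Mat.comp_app,
      Iso.hom_inv_id, Mat.id_app]
  exact key g (mul_one g) v

theorem actMat_app (g : G) (a : A) (i j v) :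
    (F.actMat g a).app i j v = F.scalar i a • v := by
  have key : ∀ g', 1 * g = g' → ∀ v, (F.actMat g' a).app i j v = F.scalar i a • v := by
    rintro _ rfl v
    rw [actMat_right, Mat.comp_app, Mat.comp_app,
      Mat.hprod_app_id_eq_smul (fun j v => F.actMat_one_app a i j v), map_smul, ← Mat.comp_app,
      Iso.hom_inv_id, Mat.id_app]
  exact key g (one_mul g) v

theorem scalar_smul {g : G} {i j} (h : (F.mat g).Supp i j) (a : A) :
    F.scalar i (g • a) = F.scalar j a := by
  obtain ⟨v, hv⟩ := @exists_ne _ h 0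
  refine smul_left_injective ℂ hv ?_
  change F.scalar i (g • a) • v = F.scalar j a • v
  rw [← actMat_app, actMat_smul_app]

/-- Naturality at the 2-cell a over the unit equates the row scalar of F with the column scalar of
F' on a nonzero entry. -/
theorem scalar_eq_of_hom {F F' : TwoRep G A} (η : F ⟶ F') {i j} (h : (homMat η).Supp i j) :
    F.scalar i = F'.scalar j := by
  ext a
  have hn : Mat.hprod (F.actMat 1 a) (𝟙 (homMat η)) ≫ (homNat η 1).hom =
      (homNat η 1).hom ≫ Mat.hprod (𝟙 (homMat η)) (F'.actMat 1 a) :=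
    η.naturality_naturality (a := .pt) (b := .pt) (f := SplitTwoGroup.cell A 1)
      (g := SplitTwoGroup.cell A 1) (SplitTwoGroup.TwoCell.mk rfl a)
  have hs : ((F.mat 1).prod (homMat η)).Supp i j :=
    Mat.supp_prod.2 ⟨i, (Mat.supp_congr F.unitMat).2 (Mat.supp_lineMat.2 rfl), h⟩
  obtain ⟨v, hv⟩ := @exists_ne _ hs 0
  have e := congrArg (fun f => Mat.Hom.app f i j v) hn
  simp only [Mat.comp_app] at e
  rw [Mat.hprod_app_id_eq_smul (fun t v => F.actMat_one_app a i t v),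
    Mat.hprod_id_app_eq_smul (fun t v => F'.actMat_one_app' a t j v), map_smul] at e
  exact smul_left_injective ℂ (((Mat.entryEquiv (homNat η 1) i j).map_ne_zero_iff).2 hv) e

theorem hasNonzeroHom_of_equivalence {F F' : TwoRep G A} (hF : F.dim ≠ 0)
    (e : Bicategory.Equivalence F F') : F.HasNonzeroHom F' := by
  obtain ⟨hr, -⟩ := Mat.supp_of_inverse (M := homMat e.hom) (N := homMat e.inv)
    (homMatIso e.unit.symm) (homMatIso e.counit)
  obtain ⟨j, hj⟩ := hr ⟨0, Nat.pos_of_ne_zero hF⟩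
  exact hasNonzeroHom_iff.2 ⟨e.hom, _, j, hj⟩

variable [Finite A]

/-- The characters of a 2-representation. -/
def char (i : Fin F.dim) : A →* Circle where
  -- A is finite, so the scalars are roots of unity and lie on the circle.
  toFun a := ⟨F.scalar i a, by
    refine mem_sphere_zero_iff_norm.2
      (Complex.norm_eq_one_of_pow_eq_one (n := Nat.card A) ?_ Nat.card_pos.ne')
    rw [← map_pow, pow_card_eq_one', map_one]⟩
  map_one' := Circle.ext (map_one _)
  map_mul' a b := Circle.ext (map_mul _ a b)

theorem coe_char (i : Fin F.dim) (a : A) : (F.char i a : ℂ) = F.scalar i a := rfl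

theorem char_eq_conjChar {g : G} {i j} (h : (F.mat g).Supp i j) :
    F.char i = conjChar g (F.char j) := by
  ext a
  rw [conjChar_apply, coe_char, coe_char, ← F.scalar_smul h, smul_inv_smul]

theorem char_eq_of_hom {F F' : TwoRep G A} (η : F ⟶ F') {i j} (h : (homMat η).Supp i j) :
    F.char i = F'.char j := by
  ext a
  rw [coe_char, coe_char, scalar_eq_of_hom η h]

/-- The orbit of the characters of a simple 2-representation. -/
def orbit (hF : F.dim ≠ 0) : Quotient (orbitSetoid G A) :=
  Quotient.mk _ (F.char ⟨0, Nat.pos_of_ne_zero hF⟩)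

theorem Transitive.orbit_eq {F : TwoRep G A} (hF : F.Transitive) (i) :
    F.orbit hF.1 = Quotient.mk _ (F.char i) := by
  obtain ⟨g, hg⟩ := hF.2 ⟨0, Nat.pos_of_ne_zero hF.1⟩ i
  exact Quotient.sound ⟨g, F.char_eq_conjChar hg⟩

/-- A nonzero entry (i, j) identifies a character of F with one of F', and transitivity makes every
index represent the orbit. This gives both the necessity in part 2 and the invariant of components
in part 3. -/
theorem Transitive.orbit_eq_of_hom {F F' : TwoRep G A} (hF : F.Transitive) (hF' : F'.Transitive)
    (h : F.HasNonzeroHom F') : F.orbit hF.1 = F'.orbit hF'.1 := by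
  obtain ⟨η, i, j, hij⟩ := hasNonzeroHom_iff.1 h
  rw [hF.orbit_eq i, hF'.orbit_eq j, char_eq_of_hom η hij]

theorem char_toTwoRep (D : TwoRepData G A) (i : Fin D.dim) :
    char D.toTwoRep i = D.char i := by
  ext a
  have hs : (Mat.perm (D.perm 1)).Supp i i := Mat.supp_lineMat.2 (by simp)
  have e : D.mapCell 1 1 a = actMat D.toTwoRep 1 a := rfl
  have h1 := D.mapCell_app 1 1 a (i := i) (j := i) (by simp)
  rw [e] at h1
  have h2 := actMat_app D.toTwoRep 1 a i i (D.permVec 1 i i)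
  have hv : D.permVec 1 i i ≠ 0 := fun h0 => by
    have : ∀ v : (Mat.perm (D.perm 1)).entry i i, v = 0 := fun v =>
      LinearMap.congr_fun (f := LinearMap.id) (g := 0) (D.perm_ext fun _ => h0) v
    exact not_subsingleton_iff_nontrivial.2 hs (subsingleton_of_forall_eq 0 this)
  exact smul_left_injective ℂ hv (h2.symm.trans h1)

end TwoRep

namespace SimpleLabel

variable {G : Type u} {A : Type v} [Group G] [CommGroup A] [MulDistribMulAction G A] [Finite G]

theorem transitive_of_isLabelledBy {F : TwoRep G A} {l : SimpleLabel G A}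
    (h : F.IsLabelledBy l) : F.Transitive :=
  l.transitive_ind.of_equivalence h.some

variable [Finite A]

theorem orbit_ind (l : SimpleLabel G A) :
    l.ind.orbit l.transitive_ind.1 = Quotient.mk _ l.α :=
  (l.transitive_ind.orbit_eq (l.cosetEquiv (QuotientGroup.mk 1))).trans (by
    have h : TwoRep.char l.ind (l.cosetEquiv (QuotientGroup.mk 1)) = _ :=
      (TwoRep.char_toTwoRep l.indData _).trans (l.char_cosetEquiv 1)
    rw [h]
    exact Quotient.sound ⟨1, rfl⟩)

theorem orbit_eq_of_isLabelledBy {F : TwoRep G A} {l : SimpleLabel G A}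
    (h : F.IsLabelledBy l) : F.orbit (transitive_of_isLabelledBy h).1 = Quotient.mk _ l.α := by
  have ht := transitive_of_isLabelledBy h
  rw [ht.orbit_eq_of_hom l.transitive_ind (TwoRep.hasNonzeroHom_of_equivalence ht.1 h.some), orbit_ind]

end SimpleLabel

/-! ### 1-morphisms to the 2-representation induced from the trivial subgroup -/

namespace TwoRep

variable {G : Type u} {A : Type v} [Group G] [CommGroup A] [MulDistribMulAction G A]
  (F : TwoRep G A)

/-- The map between the matrices of equal elements. -/
def castMat {g h : G} (e : g = h) : F.mat g ⟶ F.mat h :=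
  F.map₂ (SplitTwoGroup.isoOfEq (by rw [e]) :
    SplitTwoGroup.cell A g ≅ SplitTwoGroup.cell A h).hom

theorem castMat_rfl (g : G) : F.castMat (rfl : g = g) = 𝟙 (F.mat g) := F.actMat_one g

theorem castMat_assoc (g h k : G) : F.castMat (mul_assoc g h k) =
    (F.compMat (g * h) k).hom ≫ Mat.hprod (F.compMat g h).hom (𝟙 (F.mat k)) ≫
      (Mat.assoc (F.mat g) (F.mat h) (F.mat k)).hom ≫
      Mat.hprod (𝟙 (F.mat g)) (F.compMat h k).inv ≫ (F.compMat g (h * k)).inv :=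
  F.map₂_associator (SplitTwoGroup.cell A g) (SplitTwoGroup.cell A h) (SplitTwoGroup.cell A k)

theorem castMat_one_mul (g : G) : F.castMat (one_mul g) =
    (F.compMat 1 g).hom ≫ Mat.hprod F.unitMat.hom (𝟙 (F.mat g)) ≫
      (Mat.leftUnit (F.mat g)).hom :=
  F.map₂_left_unitor (SplitTwoGroup.cell A g)

variable {F}

/-- The multiplication of entries of the matrices of a 2-representation, with the product
identified as an entry of the matrix of an element equal to the product. -/
def mulEntry {g h k : G} (e : g * h = k) {i j t} (p : (F.mat g).entry i j)
    (q : (F.mat h).entry j t) : (F.mat k).entry i t :=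
  (F.castMat e).app i t ((F.compMat g h).inv.app i t (Mat.pure _ _ i j t p q))

theorem mulEntry_assoc {g h k a b c : G} (e₁ : g * h = a) (e₂ : a * k = c) (e₃ : h * k = b)
    (e₄ : g * b = c) {i j s t} (p : (F.mat g).entry i j) (q : (F.mat h).entry j s)
    (r : (F.mat k).entry s t) :
    mulEntry e₂ (mulEntry e₁ p q) r = mulEntry e₄ p (mulEntry e₃ q r) := by
  subst e₁ e₂ e₃
  have key : (F.castMat (mul_assoc g h k)).app i t (mulEntry rfl (mulEntry rfl p q) r) =
      mulEntry rfl p (mulEntry rfl q r) := by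
    simp only [mulEntry, castMat_rfl, Mat.id_app]
    rw [castMat_assoc]
    simp only [Mat.comp_app]
    rw [← Mat.comp_app (F.compMat (g * h) k).inv, Iso.inv_hom_id, Mat.id_app, Mat.hprod_pure,
      ← Mat.comp_app (F.compMat g h).inv, Iso.inv_hom_id, Mat.id_app, Mat.id_app,
      Mat.assoc_hom_pure, Mat.hprod_pure, Mat.id_app]
  -- The products (gh)k and g(hk) are equal only up to associativity; a free target d permits
  -- substitution in the direction to which `key` applies.
  have gen : ∀ (d : G) (e : g * h * k = d) (e' : g * (h * k) = d),
      (F.castMat e).app i t ((F.compMat (g * h) k).inv.app i t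
        (Mat.pure _ _ i s t (mulEntry rfl p q) r)) = mulEntry e' p (mulEntry rfl q r) := by
    rintro _ e rfl
    rw [← key]
    simp only [mulEntry, castMat_rfl, Mat.id_app]
  exact gen _ rfl e₄

theorem mulEntry_unit {g k : G} (e : 1 * g = k) (e' : g = k) {i t} (q : (F.mat g).entry i t) :
    mulEntry e (F.unitMat.inv.app i i (Mat.oneVec i)) q = (F.castMat e').app i t q := by
  subst e'
  rw [mulEntry, castMat_one_mul, castMat_rfl]
  simp only [Mat.comp_app]
  rw [← Mat.comp_app (F.compMat 1 g).inv, Iso.inv_hom_id, Mat.id_app, Mat.hprod_pure,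
    ← Mat.comp_app F.unitMat.inv, Iso.inv_hom_id, Mat.id_app, Mat.id_app, Mat.leftUnit_hom_pure]

/-- The isomorphism `F_g ∘ F_h ≅ F_k` for `g h = k`. -/
def mulIso (F : TwoRep G A) {g h k : G} (e : g * h = k) : (F.mat g).prod (F.mat h) ≅ F.mat k where
  hom := (F.compMat g h).inv ≫ F.castMat e
  inv := F.castMat e.symm ≫ (F.compMat g h).hom
  hom_inv_id := by
    subst e
    rw [castMat_rfl]
    simp
  inv_hom_id := by
    subst e
    rw [castMat_rfl]
    simp

variable (F) [Finite A] (D : TwoRepData G A) (t : Fin F.dim) (R : Fin D.dim → G)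
  (hR : ∀ g i, g * R i = R (D.perm g i))

omit [Finite A] in
/-- The matrix with columns the `t`-th columns of the matrices `F_g` for a family of `g`. -/
def colMat : Mat F.dim D.dim where
  entry j i := (F.mat (R i)).entry j t

omit [Finite A] in
/-- Multiplication on the entries of `colMat`. -/
def colMul (g : G) {i i' : Fin D.dim} (e : i' = D.perm g i) {j k} (p : (F.mat g).entry j k)
    (v : (colMat F D t R).entry k i) : (colMat F D t R).entry j i' :=
  mulEntry (by rw [e]; exact hR g i) p v

omit [Finite A] in
/-- The naturality isomorphism on `colMat` given by multiplication. -/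
def colNat (g : G) : (F.mat g).prod (colMat F D t R) ≅
    (colMat F D t R).prod (Mat.perm (D.perm g)) :=
  Mat.isoMk fun j i => (Mat.entryEquiv (F.mulIso (hR g i)) j t).trans
    (Mat.permRight (colMat F D t R) (D.perm g) rfl j)

omit [Finite A] in
theorem colNat_pure (g : G) {i i' : Fin D.dim} (e : i' = D.perm g i) {j k}
    (p : (F.mat g).entry j k) (v : (colMat F D t R).entry k i) :
    (colNat F D t R hR g).hom.app j i (Mat.pure _ _ j k i p v) =
      Mat.pure _ _ j i' i (colMul F D t R hR g e p v) (Mat.permVec (D.perm g) i' i) := by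
  subst e
  rfl

omit [Finite A] in
theorem colMul_colMul (g h : G) {i i' i'' : Fin D.dim} (e : i' = D.perm h i)
    (e' : i'' = D.perm g i') (e'' : i'' = D.perm (g * h) i) {j k s} (p : (F.mat g).entry j k)
    (q : (F.mat h).entry k s) (v : (colMat F D t R).entry s i) :
    colMul F D t R hR (g * h) e'' ((F.compMat g h).inv.app j s (Mat.pure _ _ j k s p q)) v =
      colMul F D t R hR g e' p (colMul F D t R hR h e q v) := by
  have h1 : mulEntry rfl p q = (F.compMat g h).inv.app j s (Mat.pure _ _ j k s p q) := by
    rw [mulEntry, castMat_rfl, Mat.id_app]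
  rw [← h1]
  exact mulEntry_assoc _ _ _ _ p q v

omit [Finite A] in
theorem colMul_unit {i : Fin D.dim} (e : i = D.perm 1 i) {j} (v : (colMat F D t R).entry j i) :
    colMul F D t R hR 1 e (F.unitMat.inv.app j j (Mat.oneVec j)) v = v := by
  refine (mulEntry_unit _ rfl v).trans ?_
  rw [castMat_rfl]
  rfl

/-- A nonzero entry of `colMat` in row j is an entry (j, t) of some F_R, so the j-th character of F
is the R-conjugate of the t-th one, which is what D prescribes for that column. -/
theorem colNat_naturality (hχ : ∀ i, D.char i = conjChar (R i) (F.char t)) (g : G) (a : A) :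
    Mat.hprod (F.actMat g a) (𝟙 (colMat F D t R)) ≫ (colNat F D t R hR g).hom =
      (colNat F D t R hR g).hom ≫ Mat.hprod (𝟙 (colMat F D t R)) (D.mapCell g g a) := by
  refine Mat.hom_prod_ext fun j k i p v => ?_
  rw [Mat.comp_app, Mat.comp_app, Mat.hprod_pure, F.actMat_app, Mat.id_app, Mat.pure_smul_left,
    Mat.app_smul, colNat_pure F D t R hR g rfl, Mat.hprod_pure, Mat.id_app,
    D.mapCell_app _ _ _ rfl, Mat.pure_smul_right]
  by_cases hs : (colMat F D t R).Supp j (D.perm g i)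
  · rw [hχ, ← F.char_eq_conjChar hs, F.coe_char]
  · have := not_nontrivial_iff_subsingleton.1 hs
    rw [Subsingleton.elim (colMul F D t R hR g rfl p v) 0, map_zero, LinearMap.zero_apply,
      smul_zero, smul_zero]

variable (hc : ∀ i g h, D.cocycle i g h = 1)

omit [Finite A] in
include hc in
theorem colNat_id :
    (colNat F D t R hR 1).hom ≫ Mat.hprod (𝟙 (colMat F D t R)) D.unitIso.hom =
      Mat.hprod F.unitMat.hom (𝟙 (colMat F D t R)) ≫
        (Mat.leftUnit (colMat F D t R)).hom ≫ (Mat.rightUnit (colMat F D t R)).inv := by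
  refine Mat.hom_prod_ext fun j k i p v => ?_
  obtain ⟨p, rfl⟩ := (Mat.entryEquiv F.unitMat j k).symm.surjective p
  -- Through the unit isomorphism the entry (j, k) of F_1 is spanned by a basis vector, and is zero
  -- unless j = k.
  have key : ∀ f f' : ((F.mat 1).prod (colMat F D t R)).entry j i →ₗ[ℂ]
      ((colMat F D t R).prod (Mat.one D.dim)).entry j i,
      (∀ e : j = k, f (Mat.pure _ _ j k i (F.unitMat.inv.app j k
        (Mat.vec (fun i j => i = j) j k)) v) = f' (Mat.pure _ _ j k i (F.unitMat.inv.app j k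
        (Mat.vec (fun i j => i = j) j k)) v)) →
      f (Mat.pure _ _ j k i (F.unitMat.inv.app j k p) v) =
        f' (Mat.pure _ _ j k i (F.unitMat.inv.app j k p) v) := by
    intro f f' h
    have : f ∘ₗ (Mat.pure _ _ j k i).flip v ∘ₗ F.unitMat.inv.app j k =
        f' ∘ₗ (Mat.pure _ _ j k i).flip v ∘ₗ F.unitMat.inv.app j k := Mat.vec_ext h
    exact LinearMap.congr_fun this p
  refine key _ _ ?_
  rintro rfl
  have e : i = D.perm 1 i := by simp
  rw [Mat.comp_app, Mat.comp_app, Mat.comp_app, colNat_pure F D t R hR 1 e, Mat.hprod_pure,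
    Mat.hprod_pure, Mat.id_app, Mat.id_app, D.unitIso_hom_app e, hc, ← Mat.comp_app F.unitMat.inv,
    Iso.inv_hom_id, Mat.id_app, Mat.leftUnit_hom_pure, Mat.rightUnit_inv_app, colMul_unit]
  simp

omit [Finite A] in
include hc in
theorem colNat_comp (g h : G) :
    (colNat F D t R hR (g * h)).hom ≫ Mat.hprod (𝟙 (colMat F D t R)) (D.compIso g h).hom =
      Mat.hprod (F.compMat g h).hom (𝟙 (colMat F D t R)) ≫
        (Mat.assoc (F.mat g) (F.mat h) (colMat F D t R)).hom ≫
        Mat.hprod (𝟙 (F.mat g)) (colNat F D t R hR h).hom ≫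
        (Mat.assoc (F.mat g) (colMat F D t R) (Mat.perm (D.perm h))).inv ≫
        Mat.hprod (colNat F D t R hR g).hom (𝟙 (Mat.perm (D.perm h))) ≫
        (Mat.assoc (colMat F D t R) (Mat.perm (D.perm g)) (Mat.perm (D.perm h))).hom := by
  -- F_{gh} has no pure tensors of its own. Precomposing with the invertible compositor permits
  -- testing on pure tensors from F_g and F_h.
  have hi : ∀ {A' : Mat F.dim D.dim} (f f' : (F.mat (g * h)).prod (colMat F D t R) ⟶ A'),
      Mat.hprod (F.compMat g h).inv (𝟙 _) ≫ f = Mat.hprod (F.compMat g h).inv (𝟙 _) ≫ f' →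
      f = f' := by
    intro A' f f' e
    have := congrArg (fun x => Mat.hprod (F.compMat g h).hom (𝟙 (colMat F D t R)) ≫ x) e
    have h1 : Mat.hprod (F.compMat g h).hom (𝟙 (colMat F D t R)) ≫
        Mat.hprod (F.compMat g h).inv (𝟙 _) = 𝟙 _ := Mat.hom_prod_ext fun j k i p v => by
      rw [Mat.comp_app, Mat.hprod_pure, Mat.hprod_pure, ← Mat.comp_app, Iso.hom_inv_id]
      rfl
    simpa only [← Category.assoc, h1, Category.id_comp] using this
  refine hi _ _ (Mat.Hom.ext ?_)
  funext j i
  refine Mat.prod_ext₃ fun k s p q v => ?_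
  have e : D.perm g (D.perm h i) = D.perm (g * h) i := by simp
  simp only [Mat.comp_app]
  rw [Mat.hprod_pure, colNat_pure F D t R hR (g * h) e, Mat.hprod_pure, Mat.id_app, Mat.id_app,
    D.compIso_hom_app g h e, hc, Mat.hprod_pure, ← Mat.comp_app (F.compMat g h).inv,
    Iso.inv_hom_id, Mat.id_app, Mat.id_app, Mat.assoc_hom_pure, Mat.hprod_pure,
    colNat_pure F D t R hR h rfl, Mat.id_app, Mat.assoc_inv_pure, Mat.hprod_pure,
    colNat_pure F D t R hR g rfl, Mat.id_app, Mat.assoc_hom_pure,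
    colMul_colMul F D t R hR g h rfl rfl e]
  simp

/-- The 1-morphism to a strict 2-representation on translates of an element, given by the columns
of the matrices of `F`. -/
def colHom (hχ : ∀ i, D.char i = conjChar (R i) (F.char t)) : F ⟶ D.toTwoRep where
  app
    | .pt => colMat F D t R
  naturality {a b} g :=
    match a, b, g with
    | .pt, .pt, g => colNat F D t R hR g.elt
  naturality_naturality {a b f g} x := by
    cases a
    cases b
    obtain ⟨e, x⟩ := x
    obtain rfl := e
    exact colNat_naturality F D t R hR hχ f.elt x
  naturality_id a := by
    cases a
    exact colNat_id F D t R hR hc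
  naturality_comp {a b c} g h := by
    cases a
    cases b
    cases c
    exact colNat_comp F D t R hR hc g.elt h.elt

-- The matrix of `R i` is invertible up to isomorphism, so its t-th column has a nonzero entry; this
-- is a nonzero entry of `colMat`.
include hR hc in
theorem hasNonzeroHom_toTwoRep (hχ : ∀ i, D.char i = conjChar (R i) (F.char t))
    (hD : D.dim ≠ 0) : F.HasNonzeroHom D.toTwoRep := by
  let i : Fin D.dim := ⟨0, Nat.pos_of_ne_zero hD⟩
  -- A nonzero entry in row t of the matrix of (R i)⁻¹ becomes one in column t of the matrix of R i.
  obtain ⟨hr, -, -⟩ := Mat.supp_of_inverse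
    ((F.compMat (R i)⁻¹ (R i)).symm ≪≫ F.unitMatOf (inv_mul_cancel _))
    ((F.compMat (R i) (R i)⁻¹).symm ≪≫ F.unitMatOf (mul_inv_cancel _))
  obtain ⟨j, hj⟩ := hr t
  have h1 := F.supp_inv hj
  rw [inv_inv] at h1
  exact hasNonzeroHom_iff.2 ⟨colHom F D t R hR hc hχ, j, i, h1⟩

end TwoRep

namespace SimpleLabel

variable {G : Type u} {A : Type v} [Group G] [CommGroup A] [MulDistribMulAction G A]

/-- The label with the trivial subgroup and a given character. -/
def trivialLabel (G : Type u) [Group G] [MulDistribMulAction G A] (α : A →* Circle) :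
    SimpleLabel G A where
  H := ⊥
  u _ _ := 1
  cocycle_eq _ _ _ := rfl
  α := α
  invariant h hh a := by rw [Subgroup.mem_bot.1 hh, one_smul]

variable [Finite G]

/-- For the trivial subgroup the correction hᵢ(g) is 1, so left multiplication permutes the
representatives exactly, as the column construction requires. -/
theorem mul_rep_trivialLabel (α : A →* Circle) (g : G) (i) :
    g * (trivialLabel G α).rep i =
      (trivialLabel G α).rep ((trivialLabel G α).indPerm g i) := by
  have h := Subgroup.mem_bot.1 ((trivialLabel G α).stabElt g i).2
  exact (inv_mul_eq_one.1 h).symm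

/-- This applies to every 2-representation, labelled or not, and so connects arbitrary simple
objects to standard ones. -/
theorem hasNonzeroHom_trivialLabel [Finite A] (F : TwoRep G A) (t : Fin F.dim) :
    F.HasNonzeroHom (trivialLabel G (F.char t)).ind :=
  F.hasNonzeroHom_toTwoRep _ t (trivialLabel G (F.char t)).rep (mul_rep_trivialLabel (F.char t))
    (fun _ _ _ => rfl) (fun _ => rfl) (trivialLabel G (F.char t)).transitive_ind.1

end SimpleLabel

/-! ### Connected components -/

namespace TwoRep

variable {G : Type u} {A : Type v} [Group G] [CommGroup A] [MulDistribMulAction G A] [Finite A]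

theorem exists_char_eq_conjChar (F : TwoRep G A) (g : G) (j : Fin F.dim) :
    ∃ i, F.char i = conjChar g (F.char j) := by
  obtain ⟨hr, -, -⟩ := Mat.supp_of_inverse
    ((F.compMat g⁻¹ g).symm ≪≫ F.unitMatOf (inv_mul_cancel g))
    ((F.compMat g g⁻¹).symm ≪≫ F.unitMatOf (mul_inv_cancel g))
  obtain ⟨i, hi⟩ := hr j
  have h := F.supp_inv hi
  rw [inv_inv] at h
  exact ⟨i, F.char_eq_conjChar h⟩

variable (G A) in
/-- The orbit of characters of a connected component. -/
def componentOrbit : Components G A → Quotient (orbitSetoid G A) :=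
  Quot.lift (fun F => F.1.orbit F.2.1) fun F F' h =>
    F.2.transitive.orbit_eq_of_hom F'.2.transitive h

variable [Finite G]

/-- Simple objects with the same orbit share a character up to the choice of index, and so both map
nontrivially to the 2-representation induced from it and the trivial subgroup. -/
theorem componentOrbit_bijective : Function.Bijective (componentOrbit G A) := by
  constructor
  · rintro ⟨F, hF⟩ ⟨F', hF'⟩ h
    obtain ⟨g, hg⟩ := Quotient.exact (s := orbitSetoid G A) h
    -- The orbits are compared at index 0; moving to the index t of F' makes the two characters
    -- equal rather than only conjugate, so the targets coincide.
    obtain ⟨t, ht⟩ := F'.exists_char_eq_conjChar g ⟨0, Nat.pos_of_ne_zero hF'.1⟩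
    have h1 := SimpleLabel.hasNonzeroHom_trivialLabel F ⟨0, Nat.pos_of_ne_zero hF.1⟩
    have h2 := SimpleLabel.hasNonzeroHom_trivialLabel F' t
    rw [ht, ← hg] at h2
    let l := SimpleLabel.trivialLabel G (F.char ⟨0, Nat.pos_of_ne_zero hF.1⟩)
    have e1 : component F hF = component l.ind l.transitive_ind.isSimple := Quot.sound h1
    have e2 : component F' hF' = component l.ind l.transitive_ind.isSimple := Quot.sound h2
    exact e1.trans e2.symm
  · intro q
    induction q using Quotient.inductionOn with
    | h α =>
      let l := SimpleLabel.trivialLabel G α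
      exact ⟨component l.ind l.transitive_ind.isSimple, l.orbit_ind⟩

end TwoRep

end HigherRep
end

theorem mainTheorem4 {G : Type*} {A : Type*} [Group G] [Finite G] [CommGroup A] [Finite A]
    [MulDistribMulAction G A] :
    (∀ (l m : HigherRep.SimpleLabel G A) (F F' : HigherRep.TwoRep G A),
      F.IsLabelledBy l → F'.IsLabelledBy m →
      ∀ r : DoubleCoset.Quotient (l.H : Set G) (m.H : Set G) → G,
      (∀ d, DoubleCoset.mk l.H m.H (r d) = d) →
      ∃ e : CategoryTheory.Equivalence (F ⟶ F') (l.HomSum m r),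
        e.functor.Additive ∧ e.functor.Linear ℂ) ∧
    (∀ (l m : HigherRep.SimpleLabel G A) (F F' : HigherRep.TwoRep G A),
      F.IsLabelledBy l → F'.IsLabelledBy m →
      (F.HasNonzeroHom F' ↔ ∃ g : G, l.α = HigherRep.conjChar g m.α)) ∧
    (∃ Θ : HigherRep.TwoRep.Components G A ≃ Quotient (HigherRep.orbitSetoid G A),
      ∀ (l : HigherRep.SimpleLabel G A) (F : HigherRep.TwoRep G A), F.IsLabelledBy l →
        ∃ hF : F.IsSimple, Θ (F.component hF) = Quotient.mk (HigherRep.orbitSetoid G A) l.α) := by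
  refine ⟨fun l m F F' hF hF' r hr =>
      HigherRep.SimpleLabel.exists_equivalence_homSum l m r hr F F' hF hF',
    fun l m F F' hF hF' => ⟨fun h => ?_, fun ⟨g, hg⟩ =>
      HigherRep.SimpleLabel.hasNonzeroHom_of_conjChar_eq l m F F' hF hF' g hg⟩,
    Equiv.ofBijective _ HigherRep.TwoRep.componentOrbit_bijective, fun l F hF =>
      ⟨(HigherRep.SimpleLabel.transitive_of_isLabelledBy hF).isSimple,
        HigherRep.SimpleLabel.orbit_eq_of_isLabelledBy hF⟩⟩
  -- Necessity in part 2 needs no description of the category of 1-morphisms: the orbits of α and β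
  -- are invariants of F and F' that a nonzero 1-morphism identifies.
  have h1 := HigherRep.TwoRep.Transitive.orbit_eq_of_hom
    (HigherRep.SimpleLabel.transitive_of_isLabelledBy hF)
    (HigherRep.SimpleLabel.transitive_of_isLabelledBy hF') h
  rw [HigherRep.SimpleLabel.orbit_eq_of_isLabelledBy hF,
    HigherRep.SimpleLabel.orbit_eq_of_isLabelledBy hF'] at h1
  exact Quotient.exact (s := HigherRep.orbitSetoid G A) h1
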